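/- Let $d\ge 4$ and $\omega_0\in\mathbb R^d$. On $\mathbb R^{2d}\ni(x,y)$ put $r_j=\tfrac12(x_j^2+y_j^2)$, $r=(r_1,\dots,r_d)$. A ($C^n$, $n\ge1$) $k$-dimensional torus in $\mathbb R^{2d}$ is the image of a $C^n$ embedding $\iota:\mathbb R^k/\mathbb Z^k\to\mathbb R^{2d}$; a flow $\Phi^t$ is linear on it, with frequency $\alpha\in\mathbb R^k$, if $\Phi^t(\iota(\theta))=\iota(\theta+t\alpha)$ for all $t,\theta$. There exists $H\in C^\infty(\mathbb R^{2d})$ with $H(x,y)=\langle\omega_0,r\rangle+O(|(x,y)|^3)$ at the origin, whose Hamiltonian flow $\Phi^t_H$ (of $\dot x=\partial_yH$, $\dot y=-\partial_xH$) is defined for all $t\in\mathbb R$, such that the following hold. 1. $\Phi^t_H$ has no invariant torus of dimension $d$, in the following sense: there is no $C^1$ torus of dimension $d$ on which $\Phi_H^t$ is linear and which is Lagrangian or has nonresonant frequency (i.e. $\langle m,\alpha\rangle\ne0$ for all $m\in\mathbb Z^d\setminus\{0\}$); moreover, no $\Phi^t_H$-invariant set homeomorphic to $(\mathbb R/\mathbb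 Z)^d$, whatever the dynamics on it, is disjoint from $\bigcup_i\{r_i=0\}$. 2. For each $i\le d$ the set $\{r_i=0\}$ is foliated by invariant tori of dimension $\le d-1$: each of the sets $\{r=c\}$, $c\in[0,\infty)^d$, $c_i=0$, is a $C^\infty$ torus of dimension $\le d-1$ on which $\Phi^t_H$ is linear. 3. Every other orbit, i.e. that of each $p$ with $r_i(p)\ne0$ for all $i$, accumulates on one of the sets $\{r_i=0\}$ or at infinity: there are times $t_n$ with $|t_n|\to\infty$ such that either $\Phi_H^{t_n}(p)$ converges to a point of some $\{r_i=0\}$, or $|\Phi_H^{t_n}(p)|\to\infty$. 4. If the coordinates of $\omega_0$ are not all of the same sign, i.e. $\omega_{0,i}<0<\omega_{0,j}$ for some $i,j$, then $\Phi^t_H$ is diffusive: for every $A>0$ there are $p\in\mathbb R^{2d}$ and $t_1,t_2\in\mathbb R$ with $|\Phi_H^{t_1}(p)|\le A^{-1}$ and $|\Phi_H^{t_2}(p)|\ge A$. -/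

import Mathlib

open scoped ContDiff Topology

noncomputable section

/-- The phase space `ℝ^{2d}` with points `z = (x, y)`. (All notions below are insensitive to
replacing the norm by an equivalent one.) -/
abbrev Phase (d : ℕ) : Type := (Fin d → ℝ) × (Fin d → ℝ)

/-- The action `r_j = (x_j² + y_j²) / 2`. -/
def action {d : ℕ} (j : Fin d) (z : Phase d) : ℝ := (z.1 j ^ 2 + z.2 j ^ 2) / 2

/-- The quadratic form `⟨w, r⟩ = ∑ w_j r_j`. -/
def quadPart {d : ℕ} (w : Fin d → ℝ) (z : Phase d) : ℝ := ∑ j, w j * action j z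

/-- The Hamiltonian vector field `X_H = (∂_y H, -∂_x H)`. -/
def hamVectorField {d : ℕ} (H : Phase d → ℝ) (z : Phase d) : Phase d :=
  (fun j => fderiv ℝ H z (0, Pi.single j 1), fun j => - fderiv ℝ H z (Pi.single j 1, 0))

/-- `Φ` is the (complete) flow of `X_H`: for each `z`, the curve `t ↦ Φ t z` is defined for all
times and is the integral curve of `X_H` through `z`. -/
def IsHamFlow {d : ℕ} (H : Phase d → ℝ) (Φ : ℝ → Phase d → Phase d) : Prop :=
  ∀ z, Φ 0 z = z ∧ ∀ t, HasDerivAt (fun s => Φ s z) (hamVectorField H (Φ t z)) t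

/-- The standard symplectic form on `ℝ^{2d}`. -/
def sympForm {d : ℕ} (u v : Phase d) : ℝ := ∑ j, (u.1 j * v.2 j - u.2 j * v.1 j)

/-- `ι : ℝ^k → ℝ^{2d}` induces a `C^n` embedding of the torus `ℝ^k / ℤ^k` (`n ≥ 1`; `n = ⊤` in `ℕ∞` means smooth): it is `C^n`,
two points have the same image exactly when they differ by an integer vector, and it is an
immersion. -/
def IsTorusEmbedding {d k : ℕ} (n : ℕ∞) (ι : (Fin k → ℝ) → Phase d) : Prop :=
  ContDiff ℝ n ι ∧
  (∀ θ θ', ι θ = ι θ' ↔ ∃ m : Fin k → ℤ, θ' = θ + fun j => (m j : ℝ)) ∧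
  ∀ θ, Function.Injective (fderiv ℝ ι θ)

/-- The flow acts on the torus parametrized by `ι` as the translation flow `θ ↦ θ + t α`. -/
def IsLinearFlowOn {d k : ℕ} (Φ : ℝ → Phase d → Phase d) (ι : (Fin k → ℝ) → Phase d)
    (α : Fin k → ℝ) : Prop :=
  ∀ t θ, Φ t (ι θ) = ι (θ + t • α)

/-- The symplectic form vanishes on the tangent spaces of the torus parametrized by `ι`; for
`k = d` this says that the torus is Lagrangian. -/
def IsIsotropic {d k : ℕ} (ι : (Fin k → ℝ) → Phase d) : Prop :=
  ∀ θ u v, sympForm (fderiv ℝ ι θ u) (fderiv ℝ ι θ v) = 0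

/-- `⟨m, α⟩ ≠ 0` for every nonzero integer vector `m`. -/
def IsNonresonant {k : ℕ} (α : Fin k → ℝ) : Prop :=
  ∀ m : Fin k → ℤ, m ≠ 0 → ∑ j, (m j : ℝ) * α j ≠ 0

/-- The curve `γ` has a limit point in `S` along times going to infinity (forward or backward). -/
def AccumulatesOn {d : ℕ} (γ : ℝ → Phase d) (S : Set (Phase d)) : Prop :=
  ∃ q ∈ S, ∃ t : ℕ → ℝ, Filter.Tendsto (fun n => |t n|) Filter.atTop Filter.atTop ∧
    Filter.Tendsto (fun n => γ (t n)) Filter.atTop (𝓝 q)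

/-- The curve `γ` goes to infinity along a sequence of times. -/
def AccumulatesAtInfinity {d : ℕ} (γ : ℝ → Phase d) : Prop :=
  ∃ t : ℕ → ℝ, Filter.Tendsto (fun n => |t n|) Filter.atTop Filter.atTop ∧
    Filter.Tendsto (fun n => ‖γ (t n)‖) Filter.atTop Filter.atTop

/-- For every `A > 0` some orbit visits both `{‖z‖ ≤ 1/A}` and `{‖z‖ ≥ A}`. -/
def IsDiffusive {d : ℕ} (Φ : ℝ → Phase d → Phase d) : Prop :=
  ∀ A : ℝ, 0 < A → ∃ (p : Phase d) (t₁ t₂ : ℝ), ‖Φ t₁ p‖ ≤ A⁻¹ ∧ A ≤ ‖Φ t₂ p‖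

end

/-! The Hamiltonian is a limit of conjugates of integrable Hamiltonians, in the manner of Anosov and
Katok. A `Stage` consists of h = ∑ w_i(r_q) r_i, whose flow rotates every plane (x_j, y_j), and of a
symplectic diffeomorphism e that preserves r_q and fixes every set {r_i = 0}; its Hamiltonian is h ∘
e⁻¹. Since w depends on the single action r_q, a resonance can be imposed on a whole slab. On a zone
of r_q the curve w runs in the segment between two vectors, and after an arbitrarily small change
some integer vector k ≠ 0 with k_q = 0 is orthogonal to both: these are three rational equations in
d ≥ 4 unknowns (`exists_resonance`).

At such a resonance, h is invariant under every map f that is the identity outside the zone and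
moves the actions along k only. Hence e can be replaced by e ∘ f, however violent f is, without
changing the Hamiltonian or its flow (`exists_conj`). The map f is an iterate of the time-one map of
a cut-off multiple of Re Z^k, where Z^k is the resonant monomial. On {Re Z^k = 0} it moves the
actions monotonically along k, in a direction given by the sign of Im Z^k, and drives them out of a
prescribed box (`exists_push`). Then w is moved off the resonance by a tiny multiple of k. Now Z^k
turns at a speed l > 0, so every interior orbit of the zone meets {Re Z^k = 0} with either sign of
Im Z^k within time 2π/l, and its image under the new conjugation leaves a given compact set
(`exists_resonant_step`, `exists_escape_step`). If ω₀ has coordinates of both signs, k can be chosen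
nonnegative near r_q = 0, and the push carries an orbit from a small ball to a large one
(`exists_diffusion_step`).

Each change is small in C^n and alters the flow little on a time span containing all the excursions
found so far. Therefore Hamiltonians and flows converge (`exists_smooth_limit`, `exists_flow_limit`)
and the excursions survive up to small errors. Every zone is treated infinitely often, which makes
every interior orbit accumulate on some {r_i = 0} or at infinity (`accumulates_of_escape`). On {r_i
= 0} every e is the identity, so the limit flow is still a rotation there.

The absence of tori follows formally. A linear flow returns as close as it departs, so a torus
carrying one lies inside ⋃ {r_i = 0}; there, tangent spaces exclude Lagrangian d-tori and a
dimension count excludes nonresonant ones (`not_isotropic_and_not_nonresonant`). -/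

noncomputable section

/-! ### Smooth time-one maps, by inverting the Picard map on a Banach space of paths. -/

section TimeOneMap

open Set unitInterval MeasureTheory

/-- Postcomposition with a continuous map, as a map between spaces of paths. -/
def pathComp {E F : Type} [TopologicalSpace E] [TopologicalSpace F] (X : C(E, F)) (γ : C(I, E)) :
    C(I, F) := X.comp γ

/-- Pointwise application of a path of operators to a path of vectors. -/
def pathApply (E F : Type) [NormedAddCommGroup E] [NormedSpace ℝ E] [NormedAddCommGroup F]
    [NormedSpace ℝ F] : C(I, E →L[ℝ] F) →L[ℝ] C(I, E) →L[ℝ] C(I, F) :=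
  LinearMap.mkContinuous₂
    (LinearMap.mk₂ ℝ (fun (A : C(I, E →L[ℝ] F)) (η : C(I, E)) =>
      (⟨fun t => A t (η t), A.continuous.clm_apply η.continuous⟩ : C(I, F)))
      (fun A B η => by ext t; simp) (fun c A η => by ext t; simp)
      (fun A η ξ => by ext t; simp) (fun c A η => by ext t; simp)) 1
    (fun A η => by
      rw [ContinuousMap.norm_le _ (by positivity)]
      intro t
      simp only [LinearMap.mk₂_apply, ContinuousMap.coe_mk, one_mul]
      refine ((A t).le_opNorm _).trans ?_
      gcongr
      · exact A.norm_coe_le_norm t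
      · exact η.norm_coe_le_norm t)

theorem pathApply_apply {E F : Type} [NormedAddCommGroup E] [NormedSpace ℝ E]
    [NormedAddCommGroup F] [NormedSpace ℝ F] (A : C(I, E →L[ℝ] F)) (η : C(I, E)) (t : I) :
    pathApply E F A η t = A t (η t) := rfl

theorem isBoundedLinearMap_pathApply (E F : Type) [NormedAddCommGroup E] [NormedSpace ℝ E]
    [NormedAddCommGroup F] [NormedSpace ℝ F] :
    IsBoundedLinearMap ℝ (fun A : C(I, E →L[ℝ] F) => pathApply E F A) where
  map_add A B := by ext η t; rfl
  map_smul c A := by ext η t; rfl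
  bound := by
    refine ⟨1, one_pos, fun A => ContinuousLinearMap.opNorm_le_bound _ (by positivity) fun η => ?_⟩
    rw [ContinuousMap.norm_le _ (by positivity), one_mul]
    intro t
    refine ((A t).le_opNorm _).trans ?_
    gcongr
    · exact A.norm_coe_le_norm t
    · exact η.norm_coe_le_norm t

/-- The range of a path is compact, so `X'` is uniformly continuous around it, and the mean value
inequality gives a remainder that is small uniformly in time. -/
theorem hasFDerivAt_pathComp {E F : Type} [NormedAddCommGroup E] [NormedSpace ℝ E]
    [NormedAddCommGroup F] [NormedSpace ℝ F] {X : C(E, F)} {X' : C(E, E →L[ℝ] F)}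
    (h : ∀ x, HasFDerivAt X (X' x) x) (γ : C(I, E)) :
    HasFDerivAt (pathComp X) (pathApply E F (pathComp X' γ)) γ := by
  rw [hasFDerivAt_iff_isLittleO_nhds_zero, Asymptotics.isLittleO_iff]
  intro c hc
  have hK : IsCompact (range γ) := isCompact_range γ.continuous
  have hu := hK.uniformContinuousAt_of_continuousAt X' (fun a _ => X'.continuous.continuousAt)
    (Metric.dist_mem_uniformity hc)
  rw [Metric.mem_uniformity_dist] at hu
  obtain ⟨δ, hδ, hu⟩ := hu
  filter_upwards [Metric.ball_mem_nhds (0 : C(I, E)) hδ] with η hη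
  rw [ContinuousMap.norm_le _ (by positivity)]
  intro t
  have hηt : ‖η t‖ < δ := lt_of_le_of_lt (η.norm_coe_le_norm t) (by simpa using hη)
  have key := (convex_ball (γ t) δ).norm_image_sub_le_of_norm_hasFDerivWithin_le'
    (f := X) (f' := X') (φ := X' (γ t)) (C := c) (x := γ t) (y := γ t + η t)
    (fun x _ => (h x).hasFDerivWithinAt) (fun x hx => by
      have := @hu (γ t) x (by rw [dist_comm]; simpa using hx) (mem_range_self t)
      rw [← dist_eq_norm, dist_comm]; exact le_of_lt this)
    (by simpa using hδ) (by simpa using hηt)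
  simp only [pathComp, ContinuousMap.coe_sub, Pi.sub_apply, ContinuousMap.comp_apply,
    ContinuousMap.coe_add, Pi.add_apply, pathApply_apply, add_sub_cancel_left] at key ⊢
  exact key.trans (mul_le_mul_of_nonneg_left (η.norm_coe_le_norm t) hc.le)

/-- The derivative of the superposition operator of `X` is that of `fderiv ℝ X` followed by the
bounded linear map `pathApply`, so one induction on `n` suffices, provided the target space may
vary. -/
theorem contDiff_nat_pathComp {E : Type} [NormedAddCommGroup E] [NormedSpace ℝ E] (n : ℕ) :
    ∀ {F : Type} [NormedAddCommGroup F] [NormedSpace ℝ F] (X : C(E, F)),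
      ContDiff ℝ ∞ X → ContDiff ℝ n (pathComp X) := by
  induction n with
  | zero =>
    intro F _ _ X hX
    rw [Nat.cast_zero, contDiff_zero]
    exact X.continuous_postcomp
  | succ n ih =>
    intro F _ _ X hX
    rw [Nat.cast_succ, contDiff_succ_iff_hasFDerivAt]
    have hX' : ContDiff ℝ ∞ (fderiv ℝ X) := hX.fderiv_right (by simp)
    have hB : ContDiff ℝ n (fun A => pathApply E F A) :=
      (isBoundedLinearMap_pathApply E F).contDiff
    refine ⟨fun γ => pathApply E F (pathComp ⟨fderiv ℝ X, hX'.continuous⟩ γ),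
      hB.comp (ih ⟨fderiv ℝ X, hX'.continuous⟩ hX'), fun γ => hasFDerivAt_pathComp (fun x => ?_) γ⟩
    exact (hX.differentiable (by simp) x).hasFDerivAt

variable {E : Type} [NormedAddCommGroup E] [NormedSpace ℝ E] [CompleteSpace E]

/-- The primitive of a path, vanishing at time `0`. -/
def pathPrimitive (E : Type) [NormedAddCommGroup E] [NormedSpace ℝ E] [CompleteSpace E] :
    C(I, E) →L[ℝ] C(I, E) :=
  LinearMap.mkContinuous
    { toFun := fun η => ⟨fun t => ∫ s in (0 : ℝ)..t, IccExtend zero_le_one η s,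
        (intervalIntegral.continuous_primitive (fun a b =>
          (η.continuous.Icc_extend').intervalIntegrable a b) 0).comp continuous_subtype_val⟩
      map_add' := fun η ξ => by
        ext t
        simp only [ContinuousMap.coe_mk, ContinuousMap.coe_add, Pi.add_apply]
        rw [← intervalIntegral.integral_add (η.continuous.Icc_extend'.intervalIntegrable _ _)
          (ξ.continuous.Icc_extend'.intervalIntegrable _ _)]
        rfl
      map_smul' := fun c η => by
        ext t
        simp only [ContinuousMap.coe_mk, ContinuousMap.coe_smul, Pi.smul_apply, RingHom.id_apply]
        rw [← intervalIntegral.integral_smul]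
        rfl } 1
    (fun η => by
      rw [ContinuousMap.norm_le _ (by positivity)]
      intro t
      have := intervalIntegral.norm_integral_le_of_norm_le_const (a := 0) (b := (t : ℝ))
        (f := IccExtend zero_le_one η) (C := ‖η‖) (fun s _ => η.norm_coe_le_norm _)
      refine this.trans ?_
      rw [sub_zero, abs_of_nonneg t.2.1, one_mul]
      exact mul_le_of_le_one_right (norm_nonneg _) t.2.2)

theorem norm_pathPrimitive_le : ‖pathPrimitive E‖ ≤ 1 :=
  LinearMap.mkContinuous_norm_le _ zero_le_one _

theorem hasDerivAt_primitive_IccExtend (η : C(I, E)) (t : ℝ) :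
    HasDerivAt (fun t => ∫ s in (0 : ℝ)..t, IccExtend zero_le_one η s)
      (IccExtend zero_le_one η t) t := by
  have hc : Continuous (IccExtend zero_le_one η) := η.continuous.Icc_extend'
  exact intervalIntegral.integral_hasDerivAt_right (hc.intervalIntegrable _ _)
    (hc.stronglyMeasurableAtFilter _ _) hc.continuousAt

/-- `γ` solves `γ' = X(γ)` on `[0, 1]`. -/
def SolvesODE {E : Type} [NormedAddCommGroup E] [NormedSpace ℝ E] (X : E → E) (γ : ℝ → E) : Prop :=
  Continuous γ ∧ ∀ t ∈ Icc (0 : ℝ) 1, HasDerivAt γ (X (γ t)) t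

/-- The map `γ ↦ γ - ∫ X(γ)`, whose fibres over constants are the solutions of `γ' = X(γ)`. -/
def picardDefect (X : C(E, E)) (γ : C(I, E)) : C(I, E) := γ - pathPrimitive E (pathComp X γ)

theorem contDiff_picardDefect {X : C(E, E)} (hX : ContDiff ℝ ∞ X) :
    ContDiff ℝ ∞ (picardDefect X) :=
  contDiff_infty.2 fun n =>
    contDiff_id.sub ((pathPrimitive E).contDiff.comp (contDiff_nat_pathComp n X hX))

/-- Taking primitives on [0, 1] has norm at most 1, so the Picard map is the identity plus an
`L`-Lipschitz map; it is invertible as soon as `L < 1`. -/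
theorem approximatesLinearOn_picardDefect {X : C(E, E)} {L : NNReal} (hL : LipschitzWith L X) :
    ApproximatesLinearOn (picardDefect X)
      ((ContinuousLinearEquiv.refl ℝ C(I, E) : C(I, E) ≃L[ℝ] C(I, E)) : C(I, E) →L[ℝ] C(I, E))
      univ L := by
  intro γ _ ξ _
  have h1 : picardDefect X γ - picardDefect X ξ -
      ((ContinuousLinearEquiv.refl ℝ C(I, E) : C(I, E) ≃L[ℝ] C(I, E)) :
        C(I, E) →L[ℝ] C(I, E)) (γ - ξ)
      = - pathPrimitive E (pathComp X γ - pathComp X ξ) := by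
    simp only [picardDefect, map_sub, ContinuousLinearEquiv.coe_coe,
      ContinuousLinearEquiv.refl_apply]
    abel
  rw [h1, norm_neg]
  refine ((pathPrimitive E).le_of_opNorm_le norm_pathPrimitive_le _).trans ?_
  rw [one_mul, ContinuousMap.norm_le _ (by positivity)]
  intro t
  have := hL.dist_le_mul (γ t) (ξ t)
  rw [dist_eq_norm, dist_eq_norm] at this
  exact this.trans (mul_le_mul_of_nonneg_left ((γ - ξ).norm_coe_le_norm t) L.2)

/-- For a contracting field, `picardDefect` is a homeomorphism of the space of paths. -/
def picardHomeo (X : C(E, E)) (hL : LipschitzWith (1 / 2) X) : C(I, E) ≃ₜ C(I, E) :=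
  (approximatesLinearOn_picardDefect hL).toHomeomorph _ (by
    by_cases h : Subsingleton C(I, E)
    · exact Or.inl h
    · right
      rw [not_subsingleton_iff_nontrivial] at h
      have h1 : ‖((ContinuousLinearEquiv.refl ℝ C(I, E) : C(I, E) ≃L[ℝ] C(I, E)).symm :
        C(I, E) →L[ℝ] C(I, E))‖₊ = 1 := by
        rw [← NNReal.coe_inj]
        exact ContinuousLinearMap.norm_id
      rw [h1, inv_one]
      exact NNReal.half_lt_self one_ne_zero)

theorem lipschitzWith_of_norm_fderiv_le {E : Type} [NormedAddCommGroup E] [NormedSpace ℝ E]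
    {X : C(E, E)} (hX : ContDiff ℝ ∞ X) (hL : ∀ x, ‖fderiv ℝ X x‖ ≤ 1 / 2) : LipschitzWith (1 / 2) X :=
  lipschitzWith_of_nnnorm_fderiv_le (hX.differentiable (by simp)) (fun x => by
    rw [← NNReal.coe_le_coe]; simpa using hL x)

theorem hasFDerivAt_picardDefect {X : C(E, E)} (hX : ContDiff ℝ ∞ X) (γ : C(I, E)) :
    HasFDerivAt (picardDefect X) (ContinuousLinearMap.id ℝ C(I, E) - (pathPrimitive E).comp
      (pathApply E E (pathComp ⟨fderiv ℝ X, hX.continuous_fderiv (by simp)⟩ γ))) γ :=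
  (hasFDerivAt_id γ).sub ((pathPrimitive E).hasFDerivAt.comp γ
    (hasFDerivAt_pathComp (fun x => (hX.differentiable (by simp) x).hasFDerivAt) γ))

theorem norm_primitive_comp_apply_lt {A : C(I, E →L[ℝ] E)} (hA : ∀ t, ‖A t‖ ≤ 1 / 2) :
    ‖(pathPrimitive E).comp (pathApply E E A)‖ < 1 := by
  have : ‖(pathPrimitive E).comp (pathApply E E A)‖ ≤ 1 / 2 := by
    refine ContinuousLinearMap.opNorm_le_bound _ (by norm_num) fun η => ?_
    refine ((pathPrimitive E).le_of_opNorm_le norm_pathPrimitive_le _).trans ?_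
    rw [one_mul, ContinuousMap.norm_le _ (by positivity)]
    intro t
    exact ((A t).le_opNorm _).trans (mul_le_mul (hA t) (η.norm_coe_le_norm t)
      (norm_nonneg _) (by norm_num))
  linarith

/-- The derivative of `picardDefect`, as an equivalence. -/
def picardDeriv (A : C(I, E →L[ℝ] E)) (hA : ∀ t, ‖A t‖ ≤ 1 / 2) : C(I, E) ≃L[ℝ] C(I, E) :=
  ContinuousLinearEquiv.unitsEquiv ℝ C(I, E)
    (Units.oneSub ((pathPrimitive E).comp (pathApply E E A)) (norm_primitive_comp_apply_lt hA))

theorem coe_picardDeriv (A : C(I, E →L[ℝ] E)) (hA : ∀ t, ‖A t‖ ≤ 1 / 2) :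
    (picardDeriv A hA : C(I, E) →L[ℝ] C(I, E)) =
      ContinuousLinearMap.id ℝ C(I, E) - (pathPrimitive E).comp (pathApply E E A) := by
  ext1 η
  rfl

/-- The time-one map of a smooth vector field with small derivative, together with its
linearization along solutions. -/
theorem exists_timeOneMap {X : E → E} (hX : ContDiff ℝ ∞ X)
    (hL : ∀ x, ‖fderiv ℝ X x‖ ≤ 1 / 2) :
    ∃ ψ : E → E, ContDiff ℝ ∞ ψ ∧ ∀ x, ∃ γ : ℝ → E, SolvesODE X γ ∧ γ 0 = x ∧ γ 1 = ψ x ∧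
      ∀ v, ∃ η : ℝ → E, η 0 = v ∧ η 1 = fderiv ℝ ψ x v ∧ Continuous η ∧
        ∀ t ∈ Icc (0 : ℝ) 1, HasDerivAt η (fderiv ℝ X (γ t) (η t)) t := by
  let Xc : C(E, E) := ⟨X, hX.continuous⟩
  have hXc : ContDiff ℝ ∞ Xc := hX
  have hLip : LipschitzWith (1 / 2) Xc := lipschitzWith_of_norm_fderiv_le hXc hL
  let P := picardHomeo Xc hLip
  let A : C(I, E) → C(I, E →L[ℝ] E) := fun γ =>
    pathComp ⟨fderiv ℝ X, hX.continuous_fderiv (by simp)⟩ γ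
  have hA : ∀ γ t, ‖A γ t‖ ≤ 1 / 2 := fun γ t => hL _
  have hP' : ∀ γ, HasFDerivAt P (picardDeriv (A γ) (hA γ) : C(I, E) →L[ℝ] C(I, E)) γ := by
    intro γ
    rw [coe_picardDeriv]
    exact hasFDerivAt_picardDefect hXc γ
  -- The derivative is the identity minus an operator of norm less than one, hence invertible, and
  -- the inverse homeomorphism inherits smoothness.
  have hPs : ContDiff ℝ ∞ P.symm := P.contDiff_symm hP' (contDiff_picardDefect hXc)
  let cst : E →L[ℝ] C(I, E) := LinearMap.mkContinuous
    { toFun := fun x => ContinuousMap.const I x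
      map_add' := fun x y => rfl
      map_smul' := fun c x => rfl } 1 (fun x => by
        rw [ContinuousMap.norm_le _ (by positivity)]
        intro t
        rw [one_mul]
        exact le_rfl)
  let ev : C(I, E) →L[ℝ] E := ContinuousMap.evalCLM ℝ (1 : I)
  have hψ : ContDiff ℝ ∞ (fun x => ev (P.symm (cst x))) :=
    ev.contDiff.comp (hPs.comp cst.contDiff)
  refine ⟨fun x => ev (P.symm (cst x)), hψ, fun x => ?_⟩
  let g : C(I, E) := P.symm (cst x)
  have hg : g - pathPrimitive E (pathComp Xc g) = cst x := by
    have := P.apply_symm_apply (cst x)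
    exact this
  -- The integral equation read as a formula for all real times, which provides two-sided
  -- derivatives at 0 and 1.
  let γ : ℝ → E := fun t => x + ∫ s in (0 : ℝ)..t, IccExtend zero_le_one (pathComp Xc g) s
  have hγg : ∀ t : I, γ t = g t := by
    intro t
    have := DFunLike.congr_fun hg t
    rw [ContinuousMap.sub_apply, sub_eq_iff_eq_add] at this
    rw [this]; rfl
  have hγd : ∀ t, HasDerivAt γ (IccExtend zero_le_one (pathComp Xc g) t) t := fun t =>
    (hasDerivAt_primitive_IccExtend _ t).const_add x
  have hγ0 : γ 0 = x := by simp [γ]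
  refine ⟨γ, ⟨continuous_iff_continuousAt.2 fun t => (hγd t).continuousAt, fun t ht => ?_⟩, hγ0,
    hγg 1, fun v => ?_⟩
  · have := hγd t
    rw [IccExtend_of_mem _ _ ht] at this
    have h2 := hγg ⟨t, ht⟩
    simp only at h2
    rw [h2]
    exact this
  -- Applying the inverse of the derivative to a constant path solves the variational equation, so
  -- its endpoint is the derivative of the time-one map.
  · let D := picardDeriv (A g) (hA g)
    let e : C(I, E) := D.symm (cst v)
    have he : e - pathPrimitive E (pathApply E E (A g) e) = cst v := by
      have := D.apply_symm_apply (cst v)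
      exact this
    let η : ℝ → E := fun t =>
      v + ∫ s in (0 : ℝ)..t, IccExtend zero_le_one (pathApply E E (A g) e) s
    have hηe : ∀ t : I, η t = e t := by
      intro t
      have := DFunLike.congr_fun he t
      rw [ContinuousMap.sub_apply, sub_eq_iff_eq_add] at this
      rw [this]; rfl
    have hηd : ∀ t, HasDerivAt η (IccExtend zero_le_one (pathApply E E (A g) e) t) t := fun t =>
      (hasDerivAt_primitive_IccExtend _ t).const_add v
    refine ⟨η, by simp [η], ?_, continuous_iff_continuousAt.2 fun t => (hηd t).continuousAt,
      fun t ht => ?_⟩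
    · have h1 : HasFDerivAt P.symm ((D.symm : C(I, E) ≃L[ℝ] C(I, E)) : C(I, E) →L[ℝ] C(I, E))
          (cst x) :=
        (P.toOpenPartialHomeomorph).hasFDerivAt_symm (by simp) (by exact hP' g)
      have h2 : HasFDerivAt (fun x => ev (P.symm (cst x)))
          (ev.comp (((D.symm : C(I, E) ≃L[ℝ] C(I, E)) : C(I, E) →L[ℝ] C(I, E)).comp cst)) x :=
        ev.hasFDerivAt.comp x (h1.comp x cst.hasFDerivAt)
      rw [h2.fderiv]
      exact hηe 1
    · have := hηd t
      rw [IccExtend_of_mem _ _ ht] at this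
      have h2 := hηe ⟨t, ht⟩
      have h3 := hγg ⟨t, ht⟩
      simp only at h2 h3
      rw [h2, h3]
      exact this

end TimeOneMap

end

noncomputable section

/-! ### Hamiltonian fields, symplectic diffeomorphisms and conjugation of flows. -/

section Symplectic

open Set

variable {d : ℕ}

/-- The coordinate `x_j`. -/
def coordX (j : Fin d) : Phase d →L[ℝ] ℝ :=
  (ContinuousLinearMap.proj j).comp (ContinuousLinearMap.fst ℝ (Fin d → ℝ) (Fin d → ℝ))

/-- The coordinate `y_j`. -/
def coordY (j : Fin d) : Phase d →L[ℝ] ℝ :=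
  (ContinuousLinearMap.proj j).comp (ContinuousLinearMap.snd ℝ (Fin d → ℝ) (Fin d → ℝ))

@[simp] theorem coordX_apply (j : Fin d) (z : Phase d) : coordX j z = z.1 j := rfl

@[simp] theorem coordY_apply (j : Fin d) (z : Phase d) : coordY j z = z.2 j := rfl

/-- The symplectic form as a continuous bilinear map. -/
def sympCLM (d : ℕ) : Phase d →L[ℝ] Phase d →L[ℝ] ℝ :=
  ∑ j, ((coordX j).smulRight (coordY j) - (coordY j).smulRight (coordX j))

theorem sympCLM_apply (u v : Phase d) : sympCLM d u v = sympForm u v := by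
  simp [sympCLM, sympForm]

theorem sympForm_swap (u v : Phase d) : sympForm u v = - sympForm v u := by
  simp only [sympForm, ← Finset.sum_neg_distrib]
  exact Finset.sum_congr rfl fun j _ => by ring

theorem sympForm_self (u : Phase d) : sympForm u u = 0 := by
  have := sympForm_swap u u
  linarith

theorem sympForm_nondegenerate {u w : Phase d} (h : ∀ v, sympForm u v = sympForm w v) : u = w := by
  ext j
  · have := h (0, Pi.single j 1)
    simpa [sympForm, Pi.single_apply] using this
  · have := h (Pi.single j 1, 0)
    simpa [sympForm, Pi.single_apply] using this

theorem phase_eq_sum (v : Phase d) :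
    v = ∑ j, (v.1 j • ((Pi.single j 1, 0) : Phase d) + v.2 j • ((0, Pi.single j 1) : Phase d)) := by
  ext i <;> simp [Prod.fst_sum, Prod.snd_sum, Finset.sum_apply, Pi.single_apply]

theorem sympForm_hamVectorField (H : Phase d → ℝ) (z v : Phase d) :
    sympForm (hamVectorField H z) v = fderiv ℝ H z v := by
  conv_rhs => rw [phase_eq_sum v]
  simp only [map_sum, map_add, map_smul, sympForm, hamVectorField, smul_eq_mul]
  exact Finset.sum_congr rfl fun j _ => by ring

theorem eq_hamVectorField {H : Phase d → ℝ} {z u : Phase d}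
    (h : ∀ v, sympForm u v = fderiv ℝ H z v) : u = hamVectorField H z :=
  sympForm_nondegenerate fun v => by rw [h, sympForm_hamVectorField]

theorem fderiv_apply_hamVectorField_swap (F G : Phase d → ℝ) (z : Phase d) :
    fderiv ℝ F z (hamVectorField G z) = - fderiv ℝ G z (hamVectorField F z) := by
  rw [← sympForm_hamVectorField, ← sympForm_hamVectorField, sympForm_swap]

theorem contDiff_hamVectorField {H : Phase d → ℝ} (hH : ContDiff ℝ ∞ H) :
    ContDiff ℝ ∞ (hamVectorField H) := by
  have h : ContDiff ℝ ∞ (fderiv ℝ H) := hH.fderiv_right (by simp)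
  refine ContDiff.prodMk (contDiff_pi.2 fun j => ?_) (contDiff_pi.2 fun j => ?_)
  · exact h.clm_apply contDiff_const
  · exact (h.clm_apply contDiff_const).neg

theorem sympForm_fderiv_hamVectorField {H : Phase d → ℝ} (hH : ContDiff ℝ ∞ H) (z u v : Phase d) :
    sympForm (fderiv ℝ (hamVectorField H) z u) v = fderiv ℝ (fderiv ℝ H) z u v := by
  have hX := ((contDiff_hamVectorField hH).differentiable (by simp) z).hasFDerivAt
  have hD : ContDiff ℝ ∞ (fderiv ℝ H) := hH.fderiv_right (by simp)
  have h1 : HasFDerivAt (fun z => sympCLM d (hamVectorField H z) v)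
      (((sympCLM d).comp (fderiv ℝ (hamVectorField H) z)).flip v) z :=
    (((sympCLM d).hasFDerivAt.comp z hX).clm_apply (hasFDerivAt_const v z)).congr_fderiv (by
      rw [ContinuousLinearMap.comp_zero, zero_add])
  have h2 : HasFDerivAt (fun z => fderiv ℝ H z v) ((fderiv ℝ (fderiv ℝ H) z).flip v) z :=
    ((hD.differentiable (by simp) z).hasFDerivAt.clm_apply (hasFDerivAt_const v z)).congr_fderiv (by
      rw [ContinuousLinearMap.comp_zero, zero_add])
  have h3 : (fun z => sympCLM d (hamVectorField H z) v) = fun z => fderiv ℝ H z v := by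
    funext z; rw [sympCLM_apply, sympForm_hamVectorField]
  rw [h3] at h1
  have := DFunLike.congr_fun (h1.unique h2) u
  simpa [sympCLM_apply] using this

/-- Symmetry of the Hessian: the linearization of a Hamiltonian field is infinitesimally symplectic.
-/
theorem sympForm_fderiv_hamVectorField_add {H : Phase d → ℝ} (hH : ContDiff ℝ ∞ H)
    (z u v : Phase d) :
    sympForm (fderiv ℝ (hamVectorField H) z u) v + sympForm u (fderiv ℝ (hamVectorField H) z v)
      = 0 := by
  rw [sympForm_swap u, sympForm_fderiv_hamVectorField hH, sympForm_fderiv_hamVectorField hH,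
    (hH.contDiffAt.isSymmSndFDerivAt (by simpa using (mod_cast (le_top : (2 : ℕ∞) ≤ ⊤) : ((2 : ℕ∞) : WithTop ℕ∞) ≤ ∞))) u v, add_neg_cancel]

/-- Smooth symplectic diffeomorphisms of the phase space. -/
structure IsSymplecto (e : Phase d ≃ Phase d) : Prop where
  contDiff : ContDiff ℝ ∞ e
  contDiff_symm : ContDiff ℝ ∞ e.symm
  symp : ∀ z u v, sympForm (fderiv ℝ e z u) (fderiv ℝ e z v) = sympForm u v

theorem IsSymplecto.refl : IsSymplecto (Equiv.refl (Phase d)) where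
  contDiff := contDiff_id
  contDiff_symm := contDiff_id
  symp z u v := by
    have : fderiv ℝ (Equiv.refl (Phase d)) z = ContinuousLinearMap.id ℝ _ := fderiv_id
    rw [this]; rfl

theorem IsSymplecto.trans {e f : Phase d ≃ Phase d} (he : IsSymplecto e) (hf : IsSymplecto f) :
    IsSymplecto (e.trans f) where
  contDiff := hf.contDiff.comp he.contDiff
  contDiff_symm := he.contDiff_symm.comp hf.contDiff_symm
  symp z u v := by
    have : fderiv ℝ (e.trans f) z = (fderiv ℝ f (e z)).comp (fderiv ℝ e z) :=
      fderiv_comp z (hf.contDiff.differentiable (by simp) _) (he.contDiff.differentiable (by simp) _)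
    rw [this, ContinuousLinearMap.comp_apply, ContinuousLinearMap.comp_apply, hf.symp, he.symp]

theorem IsSymplecto.pow {e : Equiv.Perm (Phase d)} (he : IsSymplecto e) (n : ℕ) :
    IsSymplecto (e ^ n : Equiv.Perm (Phase d)) := by
  induction n with
  | zero => exact IsSymplecto.refl
  | succ n ih => rw [pow_succ]; exact he.trans ih

theorem IsSymplecto.fderiv_symm_apply {e : Phase d ≃ Phase d} (he : IsSymplecto e) (z v : Phase d) :
    fderiv ℝ e z (fderiv ℝ e.symm (e z) v) = v := by
  have h1 : HasFDerivAt e (fderiv ℝ e z) (e.symm (e z)) := by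
    rw [e.symm_apply_apply]; exact (he.contDiff.differentiable (by simp) z).hasFDerivAt
  have h2 := (he.contDiff_symm.differentiable (by simp) (e z)).hasFDerivAt
  have h3 := h1.comp (e z) h2
  have h4 : (e ∘ e.symm) = id := by funext x; simp
  rw [h4] at h3
  exact DFunLike.congr_fun (h3.unique (hasFDerivAt_id _)) v

/-- Nondegeneracy characterizes a Hamiltonian field by its pairings, which a symplectic derivative
preserves. -/
theorem IsSymplecto.hamVectorField_comp_symm {e : Phase d ≃ Phase d} (he : IsSymplecto e)
    {h : Phase d → ℝ} (hh : Differentiable ℝ h) (z : Phase d) :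
    fderiv ℝ e z (hamVectorField h z) = hamVectorField (h ∘ e.symm) (e z) := by
  refine eq_hamVectorField fun v => ?_
  rw [← he.fderiv_symm_apply z v, he.symp, sympForm_hamVectorField, he.fderiv_symm_apply z v,
    fderiv_comp (e z) (hh _) (he.contDiff_symm.differentiable (by simp) _),
    ContinuousLinearMap.comp_apply, e.symm_apply_apply]

theorem IsSymplecto.isHamFlow_conj {e : Phase d ≃ Phase d} (he : IsSymplecto e)
    {h : Phase d → ℝ} (hh : Differentiable ℝ h) {Φ : ℝ → Phase d → Phase d} (hΦ : IsHamFlow h Φ) :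
    IsHamFlow (h ∘ e.symm) (fun t z => e (Φ t (e.symm z))) := by
  intro z
  refine ⟨by simp [(hΦ (e.symm z)).1], fun t => ?_⟩
  have h1 := (he.contDiff.differentiable (by simp) (Φ t (e.symm z))).hasFDerivAt.comp_hasDerivAt t
    ((hΦ (e.symm z)).2 t)
  rwa [he.hamVectorField_comp_symm hh] at h1

/-- On a bounded time interval both curves stay in a ball, where the field is Lipschitz. This
identifies the flows of two stages with the same Hamiltonian. -/
theorem IsHamFlow.unique {H : Phase d → ℝ} (hH : ContDiff ℝ ∞ H) {Φ Ψ : ℝ → Phase d → Phase d}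
    (hΦ : IsHamFlow H Φ) (hΨ : IsHamFlow H Ψ) (t : ℝ) (z : Phase d) : Φ t z = Ψ t z := by
  have hc1 : Continuous fun s => Φ s z :=
    continuous_iff_continuousAt.2 fun s => ((hΦ z).2 s).continuousAt
  have hc2 : Continuous fun s => Ψ s z :=
    continuous_iff_continuousAt.2 fun s => ((hΨ z).2 s).continuousAt
  set T := |t| + 1
  have hT : 0 < T := by positivity
  obtain ⟨R1, hR1⟩ := (isCompact_Icc (a := -T) (b := T)).exists_bound_of_continuousOn hc1.continuousOn
  obtain ⟨R2, hR2⟩ := (isCompact_Icc (a := -T) (b := T)).exists_bound_of_continuousOn hc2.continuousOn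
  obtain ⟨K, hK⟩ := ((contDiff_hamVectorField hH).contDiffOn
    (s := Metric.closedBall 0 (max R1 R2))).exists_lipschitzOnWith (by simp) (convex_closedBall _ _)
    (isCompact_closedBall _ _)
  have := ODE_solution_unique_of_mem_Ioo (v := fun _ => hamVectorField H)
    (s := fun _ => Metric.closedBall 0 (max R1 R2)) (K := K) (f := fun s => Φ s z)
    (g := fun s => Ψ s z) (a := -T) (b := T) (t₀ := 0) (fun _ _ => hK) ⟨by linarith, hT⟩
    (fun s hs => ⟨(hΦ z).2 s, by
      simpa using Or.inl (hR1 s (Ioo_subset_Icc_self hs))⟩)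
    (fun s hs => ⟨(hΨ z).2 s, by
      simpa using Or.inr (hR2 s (Ioo_subset_Icc_self hs))⟩)
    (by simp [(hΦ z).1, (hΨ z).1])
  refine this ⟨?_, ?_⟩
  · have := neg_abs_le t; simp only [T]; linarith
  · have := le_abs_self t; simp only [T]; linarith

theorem SolvesODE.eq_right {E : Type} [NormedAddCommGroup E] [NormedSpace ℝ E] {X : E → E}
    {K : NNReal} (hX : LipschitzWith K X) {γ ξ : ℝ → E} (hγ : SolvesODE X γ) (hξ : SolvesODE X ξ)
    (h : γ 0 = ξ 0) : γ 1 = ξ 1 :=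
  ODE_solution_unique (v := fun _ => X) (fun _ => hX) hγ.1.continuousOn
    (fun t ht => (hγ.2 t (Ico_subset_Icc_self ht)).hasDerivWithinAt) hξ.1.continuousOn
    (fun t ht => (hξ.2 t (Ico_subset_Icc_self ht)).hasDerivWithinAt) h (right_mem_Icc.2 zero_le_one)

/-- Backward uniqueness at an equilibrium; it will prevent interior solutions of the push from
reaching a set {r_i = 0}. -/
theorem SolvesODE.eq_of_fixed {E : Type} [NormedAddCommGroup E] [NormedSpace ℝ E] {X : E → E}
    {K : NNReal} (hX : LipschitzWith K X) {γ : ℝ → E} (hγ : SolvesODE X γ) {t : ℝ}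
    (ht : t ∈ Icc (0 : ℝ) 1) {b : E} (hb : X b = 0) (h : γ t = b) : γ 0 = b :=
  ODE_solution_unique_of_mem_Icc_left (v := fun _ => X) (s := fun _ => univ) (K := K) (g := fun _ => b)
    (fun _ _ => hX.lipschitzOnWith) hγ.1.continuousOn
    (fun s hs => (hγ.2 s ⟨hs.1.le, hs.2.trans ht.2⟩).hasDerivWithinAt) (fun _ _ => mem_univ _)
    continuousOn_const (fun s _ => by rw [hb]; exact hasDerivWithinAt_const _ _ _)
    (fun _ _ => mem_univ _) h (left_mem_Icc.2 ht.1)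

theorem SolvesODE.reverse {E : Type} [NormedAddCommGroup E] [NormedSpace ℝ E] {X : E → E}
    {γ : ℝ → E} (hγ : SolvesODE X γ) : SolvesODE (fun x => - X x) (fun t => γ (1 - t)) := by
  refine ⟨hγ.1.comp (by fun_prop), fun t ht => ?_⟩
  have h1 := hγ.2 (1 - t) ⟨by linarith [ht.2], by linarith [ht.1]⟩
  have h2 : HasDerivAt (fun t : ℝ => 1 - t) (-1) t := by
    simpa using (hasDerivAt_id t).const_sub 1
  exact (HasDerivAt.scomp t h1 h2).congr_deriv (by simp)

/-- The time-one map of a Hamiltonian vector field with small derivative is a symplectic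
diffeomorphism. -/
theorem exists_symplecto_timeOne {G : Phase d → ℝ} (hG : ContDiff ℝ ∞ G)
    (hL : ∀ x, ‖fderiv ℝ (hamVectorField G) x‖ ≤ 1 / 2) :
    ∃ e : Phase d ≃ Phase d, IsSymplecto e ∧ ∀ x, ∃ γ : ℝ → Phase d,
      SolvesODE (hamVectorField G) γ ∧ γ 0 = x ∧ γ 1 = e x := by
  have hX := contDiff_hamVectorField hG
  have hXn : ContDiff ℝ ∞ (fun x => - hamVectorField G x) := hX.neg
  have hLn : ∀ x, ‖fderiv ℝ (fun x => - hamVectorField G x) x‖ ≤ 1 / 2 := fun x => by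
    have h : fderiv ℝ (fun x => - hamVectorField G x) x = - fderiv ℝ (hamVectorField G) x :=
      fderiv_neg
    rw [h, norm_neg]; exact hL x
  have hlip : LipschitzWith (1 / 2) (hamVectorField G) :=
    lipschitzWith_of_norm_fderiv_le (X := ⟨_, hX.continuous⟩) hX hL
  have hlipn : LipschitzWith (1 / 2) (fun x => - hamVectorField G x) :=
    lipschitzWith_of_norm_fderiv_le (X := ⟨_, hXn.continuous⟩) hXn hLn
  obtain ⟨ψ, hψ, h1⟩ := exists_timeOneMap hX hL
  obtain ⟨φ, hφ, h2⟩ := exists_timeOneMap hXn hLn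
  -- A solution run backwards solves the equation of the opposite field, so the two time-one maps
  -- are mutually inverse.
  have left : ∀ x, φ (ψ x) = x := by
    intro x
    obtain ⟨γ, hγ, h0, h1', -⟩ := h1 x
    obtain ⟨ξ, hξ, k0, k1, -⟩ := h2 (ψ x)
    have := hγ.reverse.eq_right hlipn hξ (by simp [h1', k0])
    simp only [sub_self] at this
    rw [← k1, ← this, h0]
  have right : ∀ x, ψ (φ x) = x := by
    intro x
    obtain ⟨γ, hγ, h0, h1', -⟩ := h2 x
    obtain ⟨ξ, hξ, k0, k1, -⟩ := h1 (φ x)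
    have hr := hγ.reverse
    simp only [neg_neg] at hr
    have := hr.eq_right hlip hξ (by simp [h1', k0])
    simp only [sub_self] at this
    rw [← k1, ← this, h0]
  refine ⟨⟨ψ, φ, left, right⟩, ⟨hψ, hφ, fun z u v => ?_⟩, fun x => ?_⟩
  · obtain ⟨γ, -, -, -, hη⟩ := h1 z
    obtain ⟨η, η0, η1, hηc, hηd⟩ := hη u
    obtain ⟨ξ, ξ0, ξ1, hξc, hξd⟩ := hη v
    change sympForm (fderiv ℝ ψ z u) (fderiv ℝ ψ z v) = _
    rw [← η1, ← ξ1, ← η0, ← ξ0, ← sympCLM_apply, ← sympCLM_apply]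
    -- The symplectic pairing of two solutions of the variational equation is constant in time.
    refine constant_of_has_deriv_right_zero (f := fun t => sympCLM d (η t) (ξ t)) (a := 0) (b := 1)
      (Continuous.continuousOn (by fun_prop)) (fun t ht => ?_) 1 (right_mem_Icc.2 zero_le_one)
    have ht' := Ico_subset_Icc_self ht
    have key := (((sympCLM d).hasFDerivAt.comp_hasDerivAt t (hηd t ht'))).clm_apply (hξd t ht')
    refine (key.congr_deriv ?_).hasDerivWithinAt
    simp only [sympCLM_apply, Function.comp]
    exact sympForm_fderiv_hamVectorField_add hG _ _ _
  · obtain ⟨γ, hγ, h0, h1', -⟩ := h1 x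
    exact ⟨γ, hγ, h0, h1'⟩

end Symplectic

end

noncomputable section

/-! ### Rotations of the coordinate planes and the flow of ∑ w_i(r_q) r_i. -/

section Rotations

open Set

variable {d : ℕ}

/-- The differential of the action `r_j`. -/
def actionDeriv (j : Fin d) (z : Phase d) : Phase d →L[ℝ] ℝ :=
  z.1 j • coordX j + z.2 j • coordY j

theorem hasFDerivAt_action (j : Fin d) (z : Phase d) :
    HasFDerivAt (action j) (actionDeriv j z) z := by
  have h1 : HasFDerivAt (fun z : Phase d => z.1 j) (coordX j) z := (coordX j).hasFDerivAt
  have h2 : HasFDerivAt (fun z : Phase d => z.2 j) (coordY j) z := (coordY j).hasFDerivAt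
  refine (((h1.pow 2).add (h2.pow 2)).mul_const (1 / 2 : ℝ)).congr_fderiv ?_ |>.congr_of_eventuallyEq
    (Filter.Eventually.of_forall fun z => ?_)
  · apply ContinuousLinearMap.ext
    intro v
    simp [actionDeriv]
    ring
  · simp [action]; ring

theorem contDiff_action (j : Fin d) : ContDiff ℝ ∞ (action (d := d) j) := by
  have h1 : ContDiff ℝ ∞ (fun z : Phase d => z.1 j) := (coordX j).contDiff
  have h2 : ContDiff ℝ ∞ (fun z : Phase d => z.2 j) := (coordY j).contDiff
  exact ((h1.pow 2).add (h2.pow 2)).div_const 2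

theorem continuous_action (j : Fin d) : Continuous (action (d := d) j) :=
  (contDiff_action j).continuous

theorem action_nonneg (j : Fin d) (z : Phase d) : 0 ≤ action j z := by
  unfold action; positivity

theorem action_eq_zero {j : Fin d} {z : Phase d} : action j z = 0 ↔ z.1 j = 0 ∧ z.2 j = 0 := by
  constructor
  · intro h
    unfold action at h
    constructor <;> nlinarith [sq_nonneg (z.1 j), sq_nonneg (z.2 j)]
  · rintro ⟨h1, h2⟩; simp [action, h1, h2]

theorem action_le_norm_sq (j : Fin d) (z : Phase d) : action j z ≤ ‖z‖ ^ 2 := by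
  have h1 : |z.1 j| ≤ ‖z‖ := (norm_le_pi_norm z.1 j).trans (norm_fst_le z)
  have h2 : |z.2 j| ≤ ‖z‖ := (norm_le_pi_norm z.2 j).trans (norm_snd_le z)
  have h3 := sq_le_sq' (by linarith [neg_abs_le (z.1 j)]) ((le_abs_self _).trans h1)
  have h4 := sq_le_sq' (by linarith [neg_abs_le (z.2 j)]) ((le_abs_self _).trans h2)
  unfold action; linarith

theorem norm_le_of_action_le {z : Phase d} {R : ℝ} (hR : 0 ≤ R)
    (h : ∀ j, action j z ≤ R ^ 2 / 2) : ‖z‖ ≤ R := by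
  refine max_le ((pi_norm_le_iff_of_nonneg hR).2 fun j => ?_)
    ((pi_norm_le_iff_of_nonneg hR).2 fun j => ?_)
  · have := h j; unfold action at this
    exact abs_le_of_sq_le_sq (by nlinarith [sq_nonneg (z.2 j)]) hR
  · have := h j; unfold action at this
    exact abs_le_of_sq_le_sq (by nlinarith [sq_nonneg (z.1 j)]) hR

/-- Rotation by the angle `a_j` in each plane `(x_j, y_j)`, in the direction of the flow
of `r_j`. -/
def rotate (a : Fin d → ℝ) (z : Phase d) : Phase d :=
  (fun j => z.1 j * Real.cos (a j) + z.2 j * Real.sin (a j),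
    fun j => z.2 j * Real.cos (a j) - z.1 j * Real.sin (a j))

theorem rotate_zero (z : Phase d) : rotate 0 z = z := by ext j <;> simp [rotate]

theorem action_rotate (j : Fin d) (a : Fin d → ℝ) (z : Phase d) :
    action j (rotate a z) = action j z := by
  simp only [action, rotate]
  linear_combination ((z.1 j ^ 2 + z.2 j ^ 2) / 2) * Real.sin_sq_add_cos_sq (a j)

/-- The rotation generator `∑ Ω_j X_{r_j}`. -/
def rotGen (Ω : Fin d → ℝ) (z : Phase d) : Phase d :=
  (fun j => Ω j * z.2 j, fun j => - (Ω j * z.1 j))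

theorem hasDerivAt_rotate (Ω : Fin d → ℝ) (z : Phase d) (t : ℝ) :
    HasDerivAt (fun s : ℝ => rotate (s • Ω) z) (rotGen Ω (rotate (t • Ω) z)) t := by
  have hlin : ∀ j, HasDerivAt (fun s : ℝ => s * Ω j) (Ω j) t := fun j => by
    simpa using (hasDerivAt_id t).mul_const (Ω j)
  refine HasDerivAt.prodMk (hasDerivAt_pi.2 fun j => ?_) (hasDerivAt_pi.2 fun j => ?_)
  · refine (((hlin j).cos.const_mul (z.1 j)).add ((hlin j).sin.const_mul (z.2 j))).congr_deriv ?_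
    simp [rotate]; ring
  · refine (((hlin j).cos.const_mul (z.2 j)).sub ((hlin j).sin.const_mul (z.1 j))).congr_deriv ?_
    simp [rotate]; ring

theorem sympForm_rotGen (Ω : Fin d → ℝ) (z v : Phase d) :
    sympForm (rotGen Ω z) v = ∑ j, Ω j * actionDeriv j z v := by
  simp only [sympForm, rotGen, actionDeriv, add_apply, smul_apply, coordX_apply, coordY_apply,
    smul_eq_mul]
  exact Finset.sum_congr rfl fun j _ => by ring

/-- The Hamiltonian `∑ w_i(r_q) r_i`. -/
def freqHam (q : Fin d) (w : ℝ → Fin d → ℝ) (z : Phase d) : ℝ :=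
  ∑ i, w (action q z) i * action i z

/-- The frequencies `∂h/∂r_i` of `h = ∑ w_i(r_q) r_i`. -/
def freq (q : Fin d) (w : ℝ → Fin d → ℝ) (z : Phase d) (i : Fin d) : ℝ :=
  w (action q z) i + if i = q then ∑ l, deriv w (action q z) l * action l z else 0

/-- The flow of `∑ w_i(r_q) r_i`. -/
def freqFlow (q : Fin d) (w : ℝ → Fin d → ℝ) (t : ℝ) (z : Phase d) : Phase d :=
  rotate (t • freq q w z) z

theorem contDiff_freqHam (q : Fin d) {w : ℝ → Fin d → ℝ} (hw : ContDiff ℝ ∞ w) :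
    ContDiff ℝ ∞ (freqHam q w) :=
  ContDiff.sum fun i _ => ((contDiff_pi.1 (hw.comp (contDiff_action q))) i).mul (contDiff_action i)

/-- The differential of `w_i(r_q)` is a multiple of that of r_q, so the derivative of `w` affects
the frequency of index `q` only. -/
theorem hamVectorField_freqHam (q : Fin d) {w : ℝ → Fin d → ℝ} (hw : ContDiff ℝ ∞ w)
    (z : Phase d) : hamVectorField (freqHam q w) z = rotGen (freq q w z) z := by
  symm
  refine eq_hamVectorField fun v => ?_
  have hwi : ∀ i, HasDerivAt (fun s => w s i) (deriv w (action q z) i) (action q z) :=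
    hasDerivAt_pi.1 (hw.differentiable (by simp) (action q z)).hasDerivAt
  have h : HasFDerivAt (freqHam q w) (∑ i, (w (action q z) i • actionDeriv i z +
      action i z • (deriv w (action q z) i • actionDeriv q z))) z := by
    refine HasFDerivAt.fun_sum fun i _ => ?_
    exact ((hwi i).comp_hasFDerivAt z (hasFDerivAt_action q z)).mul (hasFDerivAt_action i z)
  rw [h.fderiv, sympForm_rotGen]
  simp only [freq, add_mul, Finset.sum_add_distrib, ite_mul, zero_mul, Finset.sum_ite_eq',
    Finset.mem_univ, if_true, sum_apply, add_apply, smul_apply, smul_eq_mul, Finset.sum_mul]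
  congr 1
  exact Finset.sum_congr rfl fun i _ => by ring

theorem freq_rotate (q : Fin d) (w : ℝ → Fin d → ℝ) (a : Fin d → ℝ) (z : Phase d) :
    freq q w (rotate a z) = freq q w z := by
  funext i
  simp only [freq, action_rotate]

theorem isHamFlow_freqFlow (q : Fin d) {w : ℝ → Fin d → ℝ} (hw : ContDiff ℝ ∞ w) :
    IsHamFlow (freqHam q w) (freqFlow q w) := by
  intro z
  refine ⟨by simp [freqFlow, rotate_zero], fun t => ?_⟩
  rw [hamVectorField_freqHam q hw, freqFlow, freq_rotate]
  exact hasDerivAt_rotate _ z t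

theorem action_freqFlow (q : Fin d) (w : ℝ → Fin d → ℝ) (t : ℝ) (z : Phase d) (j : Fin d) :
    action j (freqFlow q w t z) = action j z := action_rotate j _ z

theorem continuous_rotate {α : Type*} [TopologicalSpace α] {a : α → Fin d → ℝ} {z : α → Phase d}
    (ha : Continuous a) (hz : Continuous z) : Continuous fun x => rotate (a x) (z x) := by
  have ha' : ∀ j, Continuous fun x => a x j := fun j => (continuous_apply j).comp ha
  have h1 : ∀ j, Continuous fun x => (z x).1 j := fun j => (coordX j).continuous.comp hz
  have h2 : ∀ j, Continuous fun x => (z x).2 j := fun j => (coordY j).continuous.comp hz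
  refine Continuous.prodMk (continuous_pi fun j => ?_) (continuous_pi fun j => ?_)
  · exact ((h1 j).mul (Real.continuous_cos.comp (ha' j))).add
      ((h2 j).mul (Real.continuous_sin.comp (ha' j)))
  · exact ((h2 j).mul (Real.continuous_cos.comp (ha' j))).sub
      ((h1 j).mul (Real.continuous_sin.comp (ha' j)))

end Rotations

end

noncomputable section

/-! ### Resonant monomials, cutoffs in the actions and the generator of the push. -/

section Push

open Set

variable {d : ℕ}

/-- The complex coordinate `x_i + √-1 y_i`. -/
def cplx (i : Fin d) (z : Phase d) : ℂ := ⟨z.1 i, z.2 i⟩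

/-- The monomial `∏ z_i ^ k_i`, with negative powers read as powers of the conjugate. -/
def resMonomial (k : Fin d → ℤ) (z : Phase d) : ℂ :=
  ∏ i, (cplx i z ^ (k i).toNat * (starRingEnd ℂ (cplx i z)) ^ (-k i).toNat)

theorem cplx_eq (i : Fin d) (z : Phase d) : cplx i z = (z.1 i : ℂ) + z.2 i * Complex.I := by
  apply Complex.ext <;> simp [cplx]

theorem contDiff_cplx (i : Fin d) : ContDiff ℝ ∞ (cplx (d := d) i) := by
  have h : cplx (d := d) i = fun z => ((coordX i z : ℝ) : ℂ) + (coordY i z : ℝ) * Complex.I := by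
    funext z; exact cplx_eq i z
  rw [h]
  exact (Complex.ofRealCLM.contDiff.comp (coordX i).contDiff).add
    ((Complex.ofRealCLM.contDiff.comp (coordY i).contDiff).mul contDiff_const)

theorem contDiff_resMonomial (k : Fin d → ℤ) : ContDiff ℝ ∞ (resMonomial k) :=
  contDiff_prod fun i _ => ((contDiff_cplx i).pow _).mul
    ((Complex.conjCLE.contDiff.comp (contDiff_cplx i)).pow _)

theorem resMonomial_ne_zero {k : Fin d → ℤ} {z : Phase d} (h : ∀ i, action i z ≠ 0) :
    resMonomial k z ≠ 0 := by
  have hc : ∀ i, cplx i z ≠ 0 := fun i hi => h i (action_eq_zero.2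
    ⟨congrArg Complex.re hi, congrArg Complex.im hi⟩)
  refine Finset.prod_ne_zero_iff.2 fun i _ => mul_ne_zero (pow_ne_zero _ (hc i)) (pow_ne_zero _ ?_)
  exact (map_ne_zero _).2 (hc i)

theorem exp_neg_mul_I_eq (a : ℝ) :
    Complex.exp (-(a : ℂ) * Complex.I) = ⟨Real.cos a, -Real.sin a⟩ := by
  have h : -(a : ℂ) * Complex.I = ((-a : ℝ) : ℂ) * Complex.I := by push_cast; ring
  rw [h]
  apply Complex.ext
  · rw [Complex.exp_ofReal_mul_I_re, Real.cos_neg]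
  · rw [Complex.exp_ofReal_mul_I_im, Real.sin_neg]

theorem cplx_rotate (i : Fin d) (a : Fin d → ℝ) (z : Phase d) :
    cplx i (rotate a z) = Complex.exp (-(a i : ℂ) * Complex.I) * cplx i z := by
  rw [exp_neg_mul_I_eq]
  apply Complex.ext <;> simp [cplx, rotate] <;> ring

theorem exp_pow_mul_conj_pow (a : ℝ) (k : ℤ) :
    Complex.exp (-(a : ℂ) * Complex.I) ^ k.toNat *
      (starRingEnd ℂ (Complex.exp (-(a : ℂ) * Complex.I))) ^ (-k).toNat =
      Complex.exp (-((k * a : ℝ) : ℂ) * Complex.I) := by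
  rw [← Complex.exp_conj, ← Complex.exp_nat_mul, ← Complex.exp_nat_mul, ← Complex.exp_add]
  congr 1
  have h : (k : ℂ) = (k.toNat : ℂ) - ((-k).toNat : ℂ) := by
    have := Int.toNat_sub_toNat_neg k
    exact_mod_cast congrArg (Int.cast : ℤ → ℂ) this.symm
  simp only [map_mul, map_neg, Complex.conj_ofReal, Complex.conj_I]
  push_cast
  rw [h]; ring

/-- Each factor turns by `k i * a i`, conjugates accounting for negative exponents. Hence rotation
with frequency Ω turns Z^k at speed ⟨k, Ω⟩, and a resonance freezes it. -/
theorem resMonomial_rotate (k : Fin d → ℤ) (a : Fin d → ℝ) (z : Phase d) :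
    resMonomial k (rotate a z) =
      Complex.exp (-((∑ i, (k i : ℝ) * a i : ℝ) : ℂ) * Complex.I) * resMonomial k z := by
  have h : Complex.exp (-((∑ i, (k i : ℝ) * a i : ℝ) : ℂ) * Complex.I) =
      ∏ i, Complex.exp (-((k i * a i : ℝ) : ℂ) * Complex.I) := by
    rw [← Complex.exp_sum, ← Finset.sum_mul, Finset.sum_neg_distrib]
    push_cast; rfl
  rw [h, resMonomial, resMonomial, ← Finset.prod_mul_distrib]
  refine Finset.prod_congr rfl fun i _ => ?_
  rw [cplx_rotate, ← exp_pow_mul_conj_pow, map_mul, mul_pow, mul_pow]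
  ring

theorem hamVectorField_action (i : Fin d) (z : Phase d) :
    hamVectorField (action i) z = rotGen (Pi.single i 1) z := by
  refine (eq_hamVectorField fun v => ?_).symm
  rw [(hasFDerivAt_action i z).fderiv, sympForm_rotGen]
  simp [Pi.single_apply]

/-- Derivative of the action `r_i` along `X_G`, `G = -κ Γ Re Z^k` with `Γ` rotation invariant. -/
theorem fderiv_action_hamVectorField {k : Fin d → ℤ} {Γ : Phase d → ℝ} {κ : ℝ}
    (hΓ : ContDiff ℝ ∞ Γ) (hrot : ∀ a z, Γ (rotate a z) = Γ z) (i : Fin d) (z : Phase d) :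
    fderiv ℝ (action i) z (hamVectorField (fun z => -(κ * (Γ z * (resMonomial k z).re))) z) =
      k i * (κ * (Γ z * (resMonomial k z).im)) := by
  set G : Phase d → ℝ := fun z => -(κ * (Γ z * (resMonomial k z).re)) with hG
  have hGd : ContDiff ℝ ∞ G :=
    (contDiff_const.mul (hΓ.mul (Complex.reCLM.contDiff.comp (contDiff_resMonomial k)))).neg
  -- By antisymmetry it suffices to differentiate G along the rotation of the i-th plane, which
  -- changes only the phase of Z^k.
  rw [fderiv_apply_hamVectorField_swap, hamVectorField_action]
  have h0 : rotate ((0 : ℝ) • (Pi.single i 1 : Fin d → ℝ)) z = z := by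
    rw [zero_smul, rotate_zero]
  have h1 := hasDerivAt_rotate (Pi.single i 1) z 0
  rw [h0] at h1
  have h2 : HasDerivAt (fun s : ℝ => G (rotate (s • Pi.single i 1) z))
      (fderiv ℝ G z (rotGen (Pi.single i 1) z)) 0 := by
    refine HasFDerivAt.comp_hasDerivAt (l := G) 0 ?_ h1
    rw [h0]
    exact (hGd.differentiable (by simp) z).hasFDerivAt
  have h3 : (fun s : ℝ => G (rotate (s • Pi.single i 1) z)) = fun s : ℝ =>
      -(κ * (Γ z * (Real.cos (k i * s) * (resMonomial k z).re +
        Real.sin (k i * s) * (resMonomial k z).im))) := by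
    funext s
    have hs : ∑ j, (k j : ℝ) * (s • (Pi.single i 1 : Fin d → ℝ)) j = k i * s := by
      simp [Pi.single_apply]
    simp only [hG, hrot, resMonomial_rotate, hs, exp_neg_mul_I_eq, Complex.mul_re]
    ring
  rw [h3] at h2
  have hl : HasDerivAt (fun s : ℝ => (k i : ℝ) * s) (k i) 0 := by
    simpa using (hasDerivAt_id (0 : ℝ)).const_mul (k i : ℝ)
  have h4 := (((((hl.cos.mul_const (resMonomial k z).re).add
    (hl.sin.mul_const (resMonomial k z).im)).const_mul (Γ z)).const_mul κ).neg)
  have := h2.unique h4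
  rw [this]
  simp
  ring

/-- The bracket of Re Z^k with itself vanishes, so Re Z^k satisfies a homogeneous linear equation
along solutions; therefore {Re Z^k = 0} is invariant. -/
theorem fderiv_re_hamVectorField {k : Fin d → ℤ} {Γ : Phase d → ℝ} {κ : ℝ}
    (hΓ : ContDiff ℝ ∞ Γ) (z : Phase d) :
    fderiv ℝ (fun z => (resMonomial k z).re) z
      (hamVectorField (fun z => -(κ * (Γ z * (resMonomial k z).re))) z) =
      κ * fderiv ℝ Γ z (hamVectorField (fun z => (resMonomial k z).re) z) *
        (resMonomial k z).re := by
  have hC : ContDiff ℝ ∞ (fun z => (resMonomial k z).re) :=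
    Complex.reCLM.contDiff.comp (contDiff_resMonomial k)
  have h1 := (hΓ.differentiable (by simp) z).hasFDerivAt
  have h2 := (hC.differentiable (by simp) z).hasFDerivAt
  rw [fderiv_apply_hamVectorField_swap, ((h1.fun_mul h2).const_mul κ).fun_neg.fderiv]
  have h3 : fderiv ℝ (fun z => (resMonomial k z).re) z
      (hamVectorField (fun z => (resMonomial k z).re) z) = 0 := by
    rw [← sympForm_hamVectorField, sympForm_self]
  simp only [neg_apply, smul_apply, add_apply, h3, smul_eq_mul]
  ring

theorem exists_bump {a b a' b' : ℝ} (h1 : a' < a) (h2 : b < b') :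
    ∃ β : ℝ → ℝ, ContDiff ℝ ∞ β ∧ (∀ s, 0 ≤ β s) ∧ (∀ s ∈ Icc a b, β s = 1) ∧
      ∀ s, s ∉ Ioo a' b' → β s = 0 := by
  refine ⟨fun s => Real.smoothTransition ((s - a') / (a - a')) *
    Real.smoothTransition ((b' - s) / (b' - b)), ?_, ?_, ?_, ?_⟩
  · exact (Real.smoothTransition.contDiff.comp (by fun_prop)).mul
      (Real.smoothTransition.contDiff.comp (by fun_prop))
  · exact fun s => mul_nonneg (Real.smoothTransition.nonneg _) (Real.smoothTransition.nonneg _)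
  · intro s hs
    simp only
    rw [Real.smoothTransition.one_of_one_le, Real.smoothTransition.one_of_one_le, mul_one]
    · rw [one_le_div (by linarith)]; linarith [hs.2]
    · rw [one_le_div (by linarith)]; linarith [hs.1]
  · intro s hs
    simp only
    by_cases h : s ≤ a'
    · rw [Real.smoothTransition.zero_of_nonpos, zero_mul]
      exact div_nonpos_of_nonpos_of_nonneg (by linarith) (by linarith)
    · have : b' ≤ s := by
        by_contra h'
        exact hs ⟨not_le.1 h, not_le.1 h'⟩
      rw [Real.smoothTransition.zero_of_nonpos (x := (b' - s) / (b' - b)), mul_zero]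
      exact div_nonpos_of_nonpos_of_nonneg (by linarith) (by linarith)

/-- A smooth cutoff in the actions: equal to one on the box `[ε, M]^d` intersected with the slab
`c₁ ≤ r_q ≤ c₂`, and supported in a compact subset of the interior within `z₁ ≤ r_q ≤ z₂`. -/
theorem exists_action_cutoff (q : Fin d) {ε M z₁ c₁ c₂ z₂ : ℝ} (hε : 0 < ε) (hz₁ : 0 < z₁)
    (hzc : z₁ < c₁) (hcz : c₂ < z₂) :
    ∃ Γ : Phase d → ℝ, ContDiff ℝ ∞ Γ ∧ (∀ a z, Γ (rotate a z) = Γ z) ∧ (∀ z, 0 ≤ Γ z) ∧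
      HasCompactSupport Γ ∧
      (∀ z, (∀ i, action i z ∈ Icc ε M) → action q z ∈ Icc c₁ c₂ → Γ z = 1) ∧
      (∀ z i, action i z = 0 → ∀ᶠ y in 𝓝 z, Γ y = 0) ∧
      (∀ z, action q z ∉ Icc z₁ z₂ → ∀ᶠ y in 𝓝 z, Γ y = 0) := by
  obtain ⟨β, hβ, hβ0, hβ1, hβs⟩ := exists_bump (a := ε) (b := M) (a' := ε / 2) (b' := M + 1)
    (by linarith) (by linarith)
  obtain ⟨δ, hδ, hδ0, hδ1, hδs⟩ := exists_bump hzc hcz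
  let f : Fin d → ℝ → ℝ := fun i => if i = q then δ else β
  let lo : Fin d → ℝ := fun i => if i = q then z₁ else ε / 2
  let hi : Fin d → ℝ := fun i => if i = q then z₂ else M + 1
  have hf : ∀ i, ContDiff ℝ ∞ (f i) := fun i => by simp only [f]; split_ifs <;> assumption
  have hf0 : ∀ i s, 0 ≤ f i s := fun i => by simp only [f]; split_ifs <;> assumption
  have hlo : ∀ i, 0 < lo i := fun i => by
    simp only [lo]; split_ifs; · exact hz₁
    · linarith
  have hfs : ∀ i s, s ∉ Ioo (lo i) (hi i) → f i s = 0 := fun i => by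
    simp only [f, lo, hi]; split_ifs <;> assumption
  have hzero : ∀ z i, action i z ∉ Icc (lo i) (hi i) →
      ∀ᶠ y in 𝓝 z, ∏ i, f i (action i y) = 0 := by
    intro z i hi'
    have : ∀ᶠ y in 𝓝 z, action i y ∈ (Icc (lo i) (hi i))ᶜ :=
      (continuous_action i).continuousAt.eventually_mem (isClosed_Icc.isOpen_compl.mem_nhds hi')
    filter_upwards [this] with y hy
    exact Finset.prod_eq_zero (Finset.mem_univ i) (hfs i _ fun h => hy (Ioo_subset_Icc_self h))
  refine ⟨fun z => ∏ i, f i (action i z), contDiff_prod fun i _ => (hf i).comp (contDiff_action i),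
    fun a z => by simp only [action_rotate], fun z => Finset.prod_nonneg fun i _ => hf0 i _, ?_, ?_,
    ?_, ?_⟩
  · set R := 2 * (∑ i, |hi i|) + 1 with hR
    have hRi : ∀ i, hi i ≤ R ^ 2 / 2 := by
      intro i
      have h1 : |hi i| ≤ ∑ i, |hi i| :=
        Finset.single_le_sum (f := fun i => |hi i|) (fun i _ => abs_nonneg _) (Finset.mem_univ i)
      have h2 := le_abs_self (hi i)
      have h3 := abs_nonneg (hi i)
      nlinarith
    refine HasCompactSupport.intro (isCompact_closedBall (0 : Phase d) R) fun z hz => ?_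
    by_contra hne
    apply hz
    rw [mem_closedBall_zero_iff]
    refine norm_le_of_action_le (by rw [hR]; positivity) fun i => ?_
    by_contra hlt
    refine hne (Finset.prod_eq_zero (Finset.mem_univ i) (hfs i _ fun h => ?_))
    exact hlt (h.2.le.trans (hRi i))
  · intro z hz hq
    refine Finset.prod_eq_one fun i _ => ?_
    by_cases hi : i = q
    · simp only [f, hi, if_true]; exact hδ1 _ hq
    · simp only [f, hi, if_false]; exact hβ1 _ (hz i)
  · intro z i h0
    exact hzero z i fun h => by have := h.1; rw [h0] at this; linarith [hlo i]
  · intro z hz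
    exact hzero z q (by simpa only [lo, hi, if_true] using hz)

theorem hamVectorField_const_mul {G : Phase d → ℝ} (hG : ContDiff ℝ ∞ G) (κ : ℝ) :
    hamVectorField (fun z => κ * G z) = fun z => κ • hamVectorField G z := by
  funext z
  refine (eq_hamVectorField fun v => ?_).symm
  rw [((hG.differentiable (by simp) z).hasFDerivAt.const_mul κ).fderiv, ← sympCLM_apply, map_smul,
    smul_apply, smul_apply, sympCLM_apply, sympForm_hamVectorField]

/-- Meets the smallness condition of `exists_symplecto_timeOne`. The strength lost by shrinking the
generator is regained by iterating the map in `exists_push`. -/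
theorem exists_small_multiple {G : Phase d → ℝ} (hG : ContDiff ℝ ∞ G) (hc : HasCompactSupport G) :
    ∃ κ : ℝ, 0 < κ ∧ ∀ z, ‖fderiv ℝ (hamVectorField (fun z => κ * G z)) z‖ ≤ 1 / 2 := by
  have hX := contDiff_hamVectorField hG
  have h1 : HasCompactSupport (hamVectorField G) := by
    refine HasCompactSupport.intro (hc.fderiv (𝕜 := ℝ)).isCompact fun z hz => ?_
    have : fderiv ℝ G z = 0 := image_eq_zero_of_notMem_tsupport hz
    ext j <;> simp [hamVectorField, this]
  obtain ⟨B, hB⟩ := (h1.fderiv (𝕜 := ℝ)).exists_bound_of_continuous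
    (hX.continuous_fderiv (by simp))
  have hB0 : 0 ≤ B := (norm_nonneg _).trans (hB 0)
  refine ⟨1 / (2 * (B + 1)), by positivity, fun z => ?_⟩
  have : fderiv ℝ (fun z => (1 / (2 * (B + 1))) • hamVectorField G z) z =
      (1 / (2 * (B + 1))) • fderiv ℝ (hamVectorField G) z :=
    ((hX.differentiable (by simp) z).hasFDerivAt.fun_const_smul _).fderiv
  rw [hamVectorField_const_mul hG, this, norm_smul, Real.norm_of_nonneg (by positivity),
    one_div_mul_eq_div, div_le_div_iff₀ (by positivity) (by norm_num)]
  linarith [hB z]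

end Push

end

noncomputable section

/-! ### Symplectic maps pushing the actions along an integer vector. -/

section PushMap

open Set

variable {d : ℕ}

theorem hamVectorField_eq_zero_of_eventually {G : Phase d → ℝ} {z : Phase d}
    (h : ∀ᶠ y in 𝓝 z, G y = 0) : hamVectorField G z = 0 := by
  have h1 : G =ᶠ[𝓝 z] fun _ => 0 := h
  have : fderiv ℝ G z = 0 := by rw [h1.fderiv_eq]; exact fderiv_const_apply 0
  ext j <;> simp [hamVectorField, this]

/-- A symplectic map that moves the actions in the direction of the integer vector `k` only,
monotonically on `Re Z^k = 0`, with displacement bounded below on a box of actions. -/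
theorem exists_push_step (q : Fin d) (k : Fin d → ℤ) {ε M z₁ c₁ c₂ z₂ : ℝ} (hkq : k q = 0)
    (hε : 0 < ε) (hz₁ : 0 < z₁) (hzc : z₁ < c₁) (hcz : c₂ < z₂) :
    ∃ (e : Phase d ≃ Phase d) (m : ℝ), 0 < m ∧ IsSymplecto e ∧
      (∀ z i, action i z = 0 → e z = z) ∧
      (∀ z, action q z ∉ Icc z₁ z₂ → e z = z) ∧
      (∀ z, ∃ u : ℝ, ∀ i, action i (e z) = action i z + k i * u) ∧
      ∀ σ : ℝ, (σ = 1 ∨ σ = -1) → ∀ y, (resMonomial k y).re = 0 → 0 < σ * (resMonomial k y).im →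
        action q y ∈ Icc c₁ c₂ → (∀ i, action i y ≠ 0) →
        (resMonomial k (e y)).re = 0 ∧ 0 < σ * (resMonomial k (e y)).im ∧
        ∃ u : ℝ, 0 ≤ σ * u ∧ (∀ i, action i (e y) = action i y + k i * u) ∧
          ((∀ i, action i y ∈ Icc ε M) → (∀ i, action i (e y) ∈ Icc ε M) → m ≤ σ * u) := by
  obtain ⟨Γ, hΓ, hrot, hΓ0, hΓc, hΓ1, hΓb, hΓz⟩ := exists_action_cutoff q (M := M) hε hz₁ hzc hcz
  have hC : ContDiff ℝ ∞ (fun z => (resMonomial k z).re) :=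
    Complex.reCLM.contDiff.comp (contDiff_resMonomial k)
  have hS : ContDiff ℝ ∞ (fun z => (resMonomial k z).im) :=
    Complex.imCLM.contDiff.comp (contDiff_resMonomial k)
  have hG0 : ContDiff ℝ ∞ (fun z => -(Γ z * (resMonomial k z).re)) := (hΓ.mul hC).neg
  have hG0c : HasCompactSupport (fun z => -(Γ z * (resMonomial k z).re)) := by
    refine HasCompactSupport.intro hΓc.isCompact fun z hz => ?_
    rw [image_eq_zero_of_notMem_tsupport hz]; simp
  obtain ⟨κ, hκ, hκ2⟩ := exists_small_multiple hG0 hG0c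
  have hGeq : (fun z => κ * -(Γ z * (resMonomial k z).re)) =
      fun z => -(κ * (Γ z * (resMonomial k z).re)) := by funext z; ring
  set G : Phase d → ℝ := fun z => -(κ * (Γ z * (resMonomial k z).re)) with hGdef
  rw [hGeq] at hκ2
  have hG : ContDiff ℝ ∞ G := (contDiff_const.mul (hΓ.mul hC)).neg
  have hlip : LipschitzWith (1 / 2) (hamVectorField G) :=
    lipschitzWith_of_norm_fderiv_le (X := ⟨_, (contDiff_hamVectorField hG).continuous⟩)
      (contDiff_hamVectorField hG) hκ2
  have hX0 : ∀ z, (∀ᶠ y in 𝓝 z, Γ y = 0) → hamVectorField G z = 0 := fun z hz =>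
    hamVectorField_eq_zero_of_eventually (by
      filter_upwards [hz] with y hy
      simp [hGdef, hy])
  obtain ⟨e, he, hγ⟩ := exists_symplecto_timeOne hG hκ2
  have hfix : ∀ z, (∀ᶠ y in 𝓝 z, Γ y = 0) → e z = z := by
    intro z hz
    obtain ⟨γ, hγ, h0, h1⟩ := hγ z
    have hc : SolvesODE (hamVectorField G) (fun _ => z) :=
      ⟨continuous_const, fun t _ => by rw [hX0 z hz]; exact hasDerivAt_const _ _⟩
    rw [← h1]
    exact hγ.eq_right hlip hc h0
  -- motion of the actions along a solution
  have hact : ∀ γ : ℝ → Phase d, SolvesODE (hamVectorField G) γ → ∀ i, ∀ t ∈ Icc (0 : ℝ) 1,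
      action i (γ t) = action i (γ 0) +
        k i * ∫ s in (0 : ℝ)..t, κ * (Γ (γ s) * (resMonomial k (γ s)).im) := by
    intro γ hγ i t ht
    have hcont : Continuous fun s => κ * (Γ (γ s) * (resMonomial k (γ s)).im) :=
      continuous_const.mul ((hΓ.continuous.comp hγ.1).mul (hS.continuous.comp hγ.1))
    have h := constant_of_has_deriv_right_zero (a := 0) (b := 1)
      (f := fun t => action i (γ t) -
        k i * ∫ s in (0 : ℝ)..t, κ * (Γ (γ s) * (resMonomial k (γ s)).im))
      (((continuous_action i).comp hγ.1).sub (continuous_const.mul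
        (intervalIntegral.continuous_primitive (fun a b => hcont.intervalIntegrable a b) 0))
        ).continuousOn
      (fun s hs => by
        have h1 := ((contDiff_action i).differentiable (by simp) (γ s)).hasFDerivAt.comp_hasDerivAt s
          (hγ.2 s (Ico_subset_Icc_self hs))
        rw [fderiv_action_hamVectorField hΓ hrot] at h1
        have h2 := (intervalIntegral.integral_hasDerivAt_right (hcont.intervalIntegrable 0 s)
          (hcont.stronglyMeasurableAtFilter _ _) hcont.continuousAt).const_mul (k i : ℝ)
        refine ((h1.sub h2).congr_deriv ?_).hasDerivWithinAt
        ring) t ht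
    simp only [intervalIntegral.integral_same, mul_zero, sub_zero] at h
    linarith
  -- lower bound of the speed on the box
  have hcompact : IsCompact {z : Phase d | (∀ i, action i z ∈ Icc ε M)} := by
    have hcl : IsClosed {z : Phase d | (∀ i, action i z ∈ Icc ε M)} := by
      simp only [ofPred_forall]
      exact isClosed_iInter fun i => isClosed_Icc.preimage (continuous_action i)
    refine (isCompact_closedBall (0 : Phase d) (2 * |M| + 1)).of_isClosed_subset hcl fun z hz => ?_
    rw [mem_closedBall_zero_iff]
    refine norm_le_of_action_le (by positivity) fun i => ?_
    have h1 := (hz i).2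
    have h2 := le_abs_self M
    have h3 := abs_nonneg M
    nlinarith
  obtain ⟨m, hm, hmle⟩ : ∃ m : ℝ, 0 < m ∧ ∀ z : Phase d, (∀ i, action i z ∈ Icc ε M) →
      m ≤ ‖resMonomial k z‖ := by
    rcases eq_empty_or_nonempty {z : Phase d | (∀ i, action i z ∈ Icc ε M)} with hemp | hne
    · refine ⟨1, one_pos, fun z hz => ?_⟩
      have : z ∈ {z : Phase d | (∀ i, action i z ∈ Icc ε M)} := hz
      rw [hemp] at this
      exact absurd this (notMem_empty z)
    · obtain ⟨z0, hz0, hmin⟩ := hcompact.exists_isMinOn hne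
        (contDiff_resMonomial k).continuous.norm.continuousOn
      refine ⟨‖resMonomial k z0‖, norm_pos_iff.2 (resMonomial_ne_zero fun i => ?_), fun z hz =>
        hmin hz⟩
      exact ne_of_gt (hε.trans_le (hz0 i).1)
  -- Where the cutoff is 1 and Re Z^k = 0, the parameter along k moves at speed κ |Im Z^k| = κ
  -- |Z^k|, which is at least `κ * m` on the box.
  refine ⟨e, κ * m, mul_pos hκ hm, he, fun z i hz => hfix z (hΓb z i hz), fun z hz =>
    hfix z (hΓz z hz), fun z => ?_, fun σ hσ y hCy hSy hqy hy => ?_⟩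
  · obtain ⟨γ, hγ, h0, h1⟩ := hγ z
    refine ⟨∫ s in (0 : ℝ)..1, κ * (Γ (γ s) * (resMonomial k (γ s)).im), fun i => ?_⟩
    rw [← h1, ← h0]
    exact hact γ hγ i 1 (right_mem_Icc.2 zero_le_one)
  · obtain ⟨γ, hγ, h0, h1⟩ := hγ y
    have hσ2 : σ * σ = 1 := by rcases hσ with h | h <;> rw [h] <;> norm_num
    have hσabs : |σ| = 1 := by rcases hσ with h | h <;> rw [h] <;> norm_num
    -- the real part stays zero
    have hre : ∀ t ∈ Icc (0 : ℝ) 1, (resMonomial k (γ t)).re = 0 := by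
      have hac : Continuous fun t =>
          κ * fderiv ℝ Γ (γ t) (hamVectorField (fun z => (resMonomial k z).re) (γ t)) :=
        continuous_const.mul (((hΓ.continuous_fderiv (by simp)).comp hγ.1).clm_apply
          ((contDiff_hamVectorField hC).continuous.comp hγ.1))
      obtain ⟨K, hK⟩ := (isCompact_Icc (a := (0 : ℝ)) (b := 1)).exists_bound_of_continuousOn
        hac.continuousOn
      refine eq_zero_of_abs_deriv_le_mul_abs_self_of_eq_zero_right (K := K)
        (hC.continuous.comp hγ.1).continuousOn
        (f' := fun t => κ * fderiv ℝ Γ (γ t) (hamVectorField (fun z => (resMonomial k z).re) (γ t)) *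
          (resMonomial k (γ t)).re) (fun t ht => ?_) (by rw [h0]; exact hCy) (fun t ht => ?_)
      · have h1 := (hC.differentiable (by simp) (γ t)).hasFDerivAt.comp_hasDerivAt t
          (hγ.2 t (Ico_subset_Icc_self ht))
        rw [fderiv_re_hamVectorField hΓ] at h1
        exact h1.hasDerivWithinAt
      · rw [norm_mul]
        exact mul_le_mul_of_nonneg_right (hK t (Ico_subset_Icc_self ht)) (norm_nonneg _)
    -- the solution stays in the interior
    have hint : ∀ t ∈ Icc (0 : ℝ) 1, ∀ i, action i (γ t) ≠ 0 := by
      intro t ht i hi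
      have := hγ.eq_of_fixed hlip ht (hX0 _ (hΓb _ i hi)) rfl
      rw [h0] at this
      rw [← this] at hi
      exact hy i hi
    -- In the interior Z^k does not vanish; with zero real part its imaginary part keeps its sign,
    -- which makes the motion of the actions monotone.
    have him : ∀ t ∈ Icc (0 : ℝ) 1, (resMonomial k (γ t)).im ≠ 0 := fun t ht h =>
      resMonomial_ne_zero (k := k) (hint t ht) (Complex.ext (hre t ht) h)
    have hpos : ∀ t ∈ Icc (0 : ℝ) 1, 0 < σ * (resMonomial k (γ t)).im := by
      intro t ht
      by_contra hneg
      have hc : ContinuousOn (fun t => σ * (resMonomial k (γ t)).im) (Icc 0 t) :=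
        (continuous_const.mul (hS.continuous.comp hγ.1)).continuousOn
      obtain ⟨s, hs, hs0⟩ := intermediate_value_Icc' ht.1 hc
        (show (0 : ℝ) ∈ Icc _ _ from ⟨not_lt.1 hneg, by simp only [h0]; exact hSy.le⟩)
      have hsne := him s ⟨hs.1, hs.2.trans ht.2⟩
      simp only [mul_eq_zero] at hs0
      rcases hs0 with h | h
      · rw [h] at hσabs; simp at hσabs
      · exact hsne h
    have h11 : (1 : ℝ) ∈ Icc (0 : ℝ) 1 := right_mem_Icc.2 zero_le_one
    rw [← h1]
    refine ⟨hre 1 h11, hpos 1 h11, ?_⟩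
    set g : ℝ → ℝ := fun s => κ * (Γ (γ s) * (resMonomial k (γ s)).im) with hg
    have hcont : Continuous g :=
      continuous_const.mul ((hΓ.continuous.comp hγ.1).mul (hS.continuous.comp hγ.1))
    have hgpos : ∀ s ∈ Icc (0 : ℝ) 1, 0 ≤ σ * g s := by
      intro s hs
      have : σ * g s = κ * (Γ (γ s) * (σ * (resMonomial k (γ s)).im)) := by simp only [hg]; ring
      rw [this]
      exact mul_nonneg hκ.le (mul_nonneg (hΓ0 _) (hpos s hs).le)
    have hii : ∀ a b, IntervalIntegrable (fun s => σ * g s) MeasureTheory.volume a b := fun a b =>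
      (continuous_const.mul hcont).intervalIntegrable a b
    have hU : ∀ t, σ * ∫ s in (0 : ℝ)..t, g s = ∫ s in (0 : ℝ)..t, σ * g s := fun t =>
      (intervalIntegral.integral_const_mul _ _).symm
    have hUnn : ∀ t ∈ Icc (0 : ℝ) 1, 0 ≤ σ * ∫ s in (0 : ℝ)..t, g s := by
      intro t ht
      rw [hU]
      exact intervalIntegral.integral_nonneg ht.1 fun s hs => hgpos s ⟨hs.1, hs.2.trans ht.2⟩
    have hUmono : ∀ t ∈ Icc (0 : ℝ) 1, σ * ∫ s in (0 : ℝ)..t, g s ≤ σ * ∫ s in (0 : ℝ)..1, g s := by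
      intro t ht
      rw [hU, hU, ← intervalIntegral.integral_add_adjacent_intervals (hii 0 t) (hii t 1)]
      have := intervalIntegral.integral_nonneg (f := fun s => σ * g s)
        (μ := MeasureTheory.volume) ht.2 fun s hs => hgpos s ⟨ht.1.trans hs.1, hs.2⟩
      linarith
    have hact' := hact γ hγ
    rw [h0] at hact'
    refine ⟨∫ s in (0 : ℝ)..1, g s, hUnn 1 h11, fun i => hact' i 1 h11, fun hb0 hb1 => ?_⟩
    -- Each action is monotone in time, hence stays between its two endpoint values; the sign of `k
    -- i * σ` decides which endpoint gives which bound.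
    have hbox : ∀ t ∈ Icc (0 : ℝ) 1, ∀ i, action i (γ t) ∈ Icc ε M := by
      intro t ht i
      have e1 := hact' i t ht
      have e2 := hact' i 1 h11
      have b0 := hb0 i
      have b1 := hb1 i
      have hk : (k i : ℝ) = (k i * σ) * σ := by rw [mul_assoc, hσ2, mul_one]
      have e1' : action i (γ t) = action i y + (k i * σ) * (σ * ∫ s in (0 : ℝ)..t, g s) := by
        rw [e1, ← mul_assoc, ← hk]
      have e2' : action i (γ 1) = action i y + (k i * σ) * (σ * ∫ s in (0 : ℝ)..1, g s) := by
        rw [e2, ← mul_assoc, ← hk]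
      have u0 := hUnn t ht
      have u1 := hUmono t ht
      rcases le_total 0 (k i * σ) with hs | hs
      · have p1 := mul_nonneg hs u0
        have p2 := mul_le_mul_of_nonneg_left u1 hs
        exact ⟨by linarith [b0.1], by linarith [b1.2]⟩
      · have p1 := mul_nonpos_of_nonpos_of_nonneg hs u0
        have p2 := mul_le_mul_of_nonpos_left u1 hs
        exact ⟨by linarith [b1.1], by linarith [b0.2]⟩
    have hspeed : ∀ s ∈ Icc (0 : ℝ) 1, κ * m ≤ σ * g s := by
      intro s hs
      have hq : action q (γ s) ∈ Icc c₁ c₂ := by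
        rw [hact' q s hs, hkq]; simpa using hqy
      have h2 : σ * g s = κ * (σ * (resMonomial k (γ s)).im) := by
        simp only [hg, hΓ1 _ (hbox s hs) hq]; ring
      have h3 : ‖resMonomial k (γ s)‖ = σ * (resMonomial k (γ s)).im := by
        have : resMonomial k (γ s) = ((resMonomial k (γ s)).im : ℂ) * Complex.I := by
          apply Complex.ext <;> simp [hre s hs]
        rw [this, norm_mul, Complex.norm_I, mul_one, Complex.norm_real, Real.norm_eq_abs,
          ← one_mul |_|, ← hσabs, ← abs_mul, abs_of_pos]
        · simp
        · exact hpos s hs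
      rw [h2, ← h3]
      exact mul_le_mul_of_nonneg_left (hmle _ (hbox s hs)) hκ.le
    rw [hU]
    have := intervalIntegral.integral_mono_on zero_le_one
      (intervalIntegrable_const (c := κ * m)) (hii 0 1) hspeed
    simpa using this

/-- A symplectic map moving the actions in the direction of `k` only, such that points with
`Re Z^k = 0` in a given slab leave a given box of actions. -/
theorem exists_push (q : Fin d) (k : Fin d → ℤ) {ε M z₁ c₁ c₂ z₂ : ℝ} (hk : k ≠ 0) (hkq : k q = 0)
    (hε : 0 < ε) (hz₁ : 0 < z₁) (hzc : z₁ < c₁) (hcz : c₂ < z₂) :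
    ∃ e : Phase d ≃ Phase d, IsSymplecto e ∧
      (∀ z i, action i z = 0 → e z = z) ∧
      (∀ z, action q z ∉ Icc z₁ z₂ → e z = z) ∧
      (∀ z, ∃ u : ℝ, ∀ i, action i (e z) = action i z + k i * u) ∧
      ∀ σ : ℝ, (σ = 1 ∨ σ = -1) → ∀ y, (resMonomial k y).re = 0 → 0 < σ * (resMonomial k y).im →
        action q y ∈ Icc c₁ c₂ → (∀ i, action i y ≠ 0) →
        ∃ u : ℝ, 0 ≤ σ * u ∧ (∀ i, action i (e y) = action i y + k i * u) ∧
          ∀ (r : Fin d → ℝ) (u₀ : ℝ), 0 ≤ σ * u₀ → (∀ i, r i ∈ Icc ε M) →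
            (∀ i, action i y = r i + k i * u₀) → ∃ i, action i (e y) ∉ Icc ε M := by
  obtain ⟨e, m, hm, he, hfixb, hfixz, hmove, hpush⟩ :=
    exists_push_step (M := M) q k hkq hε hz₁ hzc hcz
  -- Enough iterates for displacements of at least `m` to add up to more than the width of the box.
  obtain ⟨N, hN⟩ := exists_nat_gt ((M - ε) / m)
  have hN' : M - ε < N * m := by rwa [div_lt_iff₀ hm] at hN
  have hsucc : ∀ n z, (e ^ (n + 1) : Equiv.Perm (Phase d)) z = e ((e ^ n : Equiv.Perm _) z) :=
    fun n z => by rw [pow_succ']; rfl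
  have hfix : ∀ n z, e z = z → (e ^ n : Equiv.Perm (Phase d)) z = z := by
    intro n z hz
    induction n with
    | zero => rfl
    | succ n ih => rw [hsucc, ih, hz]
  refine ⟨(e ^ N : Equiv.Perm (Phase d)), IsSymplecto.pow he N, fun z i hz => hfix N z (hfixb z i hz),
    fun z hz => hfix N z (hfixz z hz), fun z => ?_, fun σ hσ y hCy hSy hqy hy => ?_⟩
  · have : ∀ n, ∃ u : ℝ, ∀ i, action i ((e ^ n : Equiv.Perm (Phase d)) z) = action i z + k i * u := by
      intro n
      induction n with
      | zero => exact ⟨0, fun i => by simp⟩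
      | succ n ih =>
        obtain ⟨u, hu⟩ := ih
        obtain ⟨v, hv⟩ := hmove ((e ^ n : Equiv.Perm (Phase d)) z)
        exact ⟨u + v, fun i => by rw [hsucc, hv, hu]; ring⟩
    exact this N
  · have hσ2 : σ * σ = 1 := by rcases hσ with h | h <;> rw [h] <;> norm_num
    -- Displacement is measured from a point `r` of the box, not from `y`: in the application `y`
    -- comes from a preimage under the push itself and may already lie outside the box, displaced in
    -- the direction σ.
    have key : ∀ n : ℕ, (resMonomial k ((e ^ n : Equiv.Perm (Phase d)) y)).re = 0 ∧
        0 < σ * (resMonomial k ((e ^ n : Equiv.Perm (Phase d)) y)).im ∧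
        (∀ i, action i ((e ^ n : Equiv.Perm (Phase d)) y) ≠ 0) ∧
        ∃ u : ℝ, 0 ≤ σ * u ∧
          (∀ i, action i ((e ^ n : Equiv.Perm (Phase d)) y) = action i y + k i * u) ∧
          ∀ (r : Fin d → ℝ) (u₀ : ℝ), 0 ≤ σ * u₀ → (∀ i, r i ∈ Icc ε M) →
            (∀ i, action i y = r i + k i * u₀) →
            (∀ i, action i ((e ^ n : Equiv.Perm (Phase d)) y) ∈ Icc ε M) → n * m ≤ σ * u := by
      intro n
      induction n with
      | zero =>
        exact ⟨hCy, hSy, hy, 0, by simp, fun i => by simp, fun r u₀ _ _ _ _ => by simp⟩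
      | succ n ih =>
        obtain ⟨a1, a2, a3, u, u0, u1, u2⟩ := ih
        have hq' : action q ((e ^ n : Equiv.Perm (Phase d)) y) ∈ Icc c₁ c₂ := by
          rw [u1, hkq]; simpa using hqy
        obtain ⟨b1, b2, v, v0, v1, v2⟩ := hpush σ hσ _ a1 a2 hq' a3
        refine ⟨by rw [hsucc]; exact b1, by rw [hsucc]; exact b2, fun i hi => ?_, u + v, by
          rw [mul_add]; exact add_nonneg u0 v0, fun i => by rw [hsucc, v1, u1]; ring,
          fun r w hw hr hyr hbox => ?_⟩
        · rw [hsucc] at hi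
          have h1 := hfixb _ i hi
          have h2 := e.injective h1
          rw [h2] at hi
          exact a3 i hi
        -- The total displacement from `r` only grows in the direction σ, so the intermediate
        -- actions lie between those of `r` and of the endpoint, both in the box.
        · have hmid : ∀ i, action i ((e ^ n : Equiv.Perm (Phase d)) y) ∈ Icc ε M := by
            intro i
            have e1 : action i ((e ^ n : Equiv.Perm (Phase d)) y) =
                r i + (k i * σ) * (σ * w + σ * u) := by
              rw [u1, hyr]; linear_combination (-(k i : ℝ) * (w + u)) * hσ2
            have e2 : action i ((e ^ (n + 1) : Equiv.Perm (Phase d)) y) =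
                r i + (k i * σ) * (σ * w + σ * u) + (k i * σ) * (σ * v) := by
              rw [hsucc, v1, u1, hyr]; linear_combination (-(k i : ℝ) * (w + u + v)) * hσ2
            have b0 := hr i
            have b1 := hbox i
            rcases le_total 0 (k i * σ) with hs | hs
            · have p1 := mul_nonneg hs (add_nonneg hw u0)
              have p2 := mul_nonneg hs v0
              exact ⟨by linarith [b0.1], by linarith [b1.2]⟩
            · have p1 := mul_nonpos_of_nonpos_of_nonneg hs (add_nonneg hw u0)
              have p2 := mul_nonpos_of_nonpos_of_nonneg hs v0
              exact ⟨by linarith [b1.1], by linarith [b0.2]⟩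
          have h1 := u2 r w hw hr hyr hmid
          have h2 := v2 hmid (fun i => by have := hbox i; rwa [hsucc] at this)
          push_cast
          linarith
    obtain ⟨-, -, -, u, u0, u1, u2⟩ := key N
    refine ⟨u, u0, u1, fun r w hw hr hyr => ?_⟩
    by_contra hall
    push Not at hall
    have h1 := u2 r w hw hr hyr hall
    obtain ⟨i, hi⟩ : ∃ i, k i ≠ 0 := by
      by_contra h; push Not at h; exact hk (funext h)
    -- A nonzero integer coordinate is at least 1 in absolute value, so the corresponding action
    -- moves by at least `N * m`, more than the box allows.
    have hki : (1 : ℝ) ≤ |(k i : ℝ)| := by exact_mod_cast Int.one_le_abs hi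
    have e1 : action i ((e ^ N : Equiv.Perm (Phase d)) y) - r i = k i * (w + u) := by
      rw [u1, hyr]; ring
    have hle : |(k i : ℝ) * (w + u)| ≤ M - ε := by
      rw [← e1, abs_le]
      have b0 := hr i
      have b1 := hall i
      exact ⟨by linarith [b0.2, b1.1], by linarith [b0.1, b1.2]⟩
    have hge : N * m ≤ |w + u| := by
      have : σ * (w + u) ≤ |w + u| := by
        rcases hσ with h | h
        · rw [h, one_mul]; exact le_abs_self _
        · rw [h, neg_one_mul]; exact neg_le_abs _
      linarith [mul_add σ w u]
    rw [abs_mul] at hle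
    have := mul_le_mul_of_nonneg_right hki (abs_nonneg (w + u))
    linarith

end PushMap

end

noncomputable section

/-! ### Zones of r_q, frequency curves and integer resonances. -/

section Zones

open Set

variable {d : ℕ}

/-- A smooth function supported in `[1, 8]` and equal to `1` on `[2, 4]`. -/
def plateau (s : ℝ) : ℝ := Real.smoothTransition (2 - s / 4) - Real.smoothTransition (2 - s)

/-- The rescaled plateau functions. The functions `zoneFun j` and `zoneFun (j + 1)` add up to one
on the zone `1 / 2 ≤ 4 ^ j * s ≤ 4`, where the other ones vanish. -/
def zoneFun (j : ℤ) (s : ℝ) : ℝ := plateau (4 ^ j * s)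

theorem contDiff_zoneFun (j : ℤ) : ContDiff ℝ ∞ (zoneFun j) := by
  unfold zoneFun plateau
  exact (Real.smoothTransition.contDiff.comp (by fun_prop)).sub
    (Real.smoothTransition.contDiff.comp (by fun_prop))

theorem plateau_of_le {s : ℝ} (h : s ≤ 1) : plateau s = 0 := by
  rw [plateau, Real.smoothTransition.one_of_one_le (by linarith),
    Real.smoothTransition.one_of_one_le (by linarith), sub_self]

theorem plateau_of_ge {s : ℝ} (h : 8 ≤ s) : plateau s = 0 := by
  rw [plateau, Real.smoothTransition.zero_of_nonpos (by linarith),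
    Real.smoothTransition.zero_of_nonpos (by linarith), sub_self]

/-- Telescoping: `zoneFun j` is the difference of the transitions at scales `j - 1` and `j`. In the
sum for `j` and `j + 1` the middle transition cancels, and on the zone the outer ones are 1 and 0.
-/
theorem zoneFun_add {j : ℤ} {s : ℝ} (h : 4 ^ j * s ∈ Icc (1 / 2 : ℝ) 4) :
    zoneFun j s + zoneFun (j + 1) s = 1 := by
  have h4 : (4 : ℝ) ^ (j + 1) * s = 4 * (4 ^ j * s) := by
    rw [zpow_add_one₀ (by norm_num)]; ring
  rw [zoneFun, zoneFun, h4, plateau, plateau,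
    Real.smoothTransition.one_of_one_le (x := 2 - 4 ^ j * s / 4) (by linarith [h.2]),
    Real.smoothTransition.zero_of_nonpos (x := 2 - 4 * (4 ^ j * s)) (by linarith [h.1])]
  have : 2 - 4 * (4 ^ j * s) / 4 = 2 - 4 ^ j * s := by ring
  rw [this]; ring

theorem zoneFun_eq_zero {i j : ℤ} {s : ℝ} (h : 4 ^ j * s ∈ Icc (1 / 2 : ℝ) 4) (h1 : i ≠ j)
    (h2 : i ≠ j + 1) : zoneFun i s = 0 := by
  have hi : (4 : ℝ) ^ i * s = 4 ^ (i - j) * (4 ^ j * s) := by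
    rw [← mul_assoc, ← zpow_add₀ (by norm_num), sub_add_cancel]
  rcases lt_or_gt_of_ne h1 with hlt | hgt
  · refine plateau_of_le ?_
    have h3 : (4 : ℝ) ^ (i - j) ≤ 4 ^ (-1 : ℤ) := zpow_le_zpow_right₀ (by norm_num) (by omega)
    rw [zpow_neg_one] at h3
    have h4 : (0 : ℝ) < 4 ^ (i - j) := by positivity
    rw [hi]
    nlinarith [h.1, h.2]
  · refine plateau_of_ge ?_
    have h3 : (4 : ℝ) ^ (2 : ℤ) ≤ 4 ^ (i - j) := zpow_le_zpow_right₀ (by norm_num) (by omega)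
    norm_num at h3
    rw [hi]
    nlinarith [h.1, h.2]

/-- The core interval has endpoint ratio 14/3, greater than the scaling factor 4, so the cores cover
all positive values of r_q, with room left for cutoffs inside the zones. -/
theorem exists_core {s : ℝ} (hs : 0 < s) : ∃ j : ℤ, 4 ^ j * s ∈ Icc (3 / 4 : ℝ) (7 / 2) := by
  obtain ⟨n, h1, h2⟩ := exists_mem_Ico_zpow (x := 4 / 3 * s) (y := (4 : ℝ)) (by positivity)
    (by norm_num)
  refine ⟨-n, ?_⟩
  have hp : (0 : ℝ) < 4 ^ n := by positivity
  rw [zpow_add_one₀ (by norm_num)] at h2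
  rw [zpow_neg, inv_mul_eq_div]
  constructor
  · rw [le_div_iff₀ hp]; linarith
  · rw [div_le_iff₀ hp]; linarith

/-- The frequency curves used in the construction: on each zone they run on a segment. -/
structure IsFreq (ω₀ : Fin d → ℝ) (w : ℝ → Fin d → ℝ) : Prop where
  contDiff : ContDiff ℝ ∞ w
  near_zero : ∃ s₀ > 0, ∀ s < s₀, w s = ω₀
  zone : ∀ j : ℤ, ∃ a b : Fin d → ℝ, ∀ s, 4 ^ j * s ∈ Icc (1 / 2 : ℝ) 4 →
    w s = zoneFun j s • a + zoneFun (j + 1) s • b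

/-- Perturbation of a frequency curve near the zone `j`. -/
def perturb (w : ℝ → Fin d → ℝ) (j : ℤ) (c : (Fin d → ℝ) × (Fin d → ℝ)) (s : ℝ) : Fin d → ℝ :=
  w s + (zoneFun j s • c.1 + zoneFun (j + 1) s • c.2)

theorem isFreq_const (ω₀ : Fin d → ℝ) : IsFreq ω₀ (fun _ => ω₀) where
  contDiff := contDiff_const
  near_zero := ⟨1, one_pos, fun _ _ => rfl⟩
  zone j := ⟨ω₀, ω₀, fun s hs => by rw [← add_smul, zoneFun_add hs, one_smul]⟩

theorem zoneFun_of_lt {j : ℤ} {s : ℝ} (h : s < 1 / 4 ^ j) : zoneFun j s = 0 := by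
  refine plateau_of_le ?_
  have hp : (0 : ℝ) < 4 ^ j := by positivity
  rw [lt_div_iff₀ hp] at h
  linarith

/-- Ensures that a perturbation made for one zone preserves the two-vector form of the curve on
every other zone, overlapping ones included. -/
theorem zoneFun_segment (i j : ℤ) (c : Fin d → ℝ) : ∃ a b : Fin d → ℝ, ∀ s,
    4 ^ j * s ∈ Icc (1 / 2 : ℝ) 4 → zoneFun i s • c = zoneFun j s • a + zoneFun (j + 1) s • b := by
  by_cases h1 : i = j
  · exact ⟨c, 0, fun s _ => by simp [h1]⟩
  by_cases h2 : i = j + 1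
  · exact ⟨0, c, fun s _ => by simp [h2]⟩
  · exact ⟨0, 0, fun s hs => by simp [zoneFun_eq_zero hs h1 h2]⟩

theorem zoneFun_of_lt_min {j : ℤ} {s : ℝ} (h : s < 1 / 4 ^ (j + 1)) :
    zoneFun j s = 0 ∧ zoneFun (j + 1) s = 0 := by
  refine ⟨zoneFun_of_lt (h.trans ?_), zoneFun_of_lt h⟩
  rw [zpow_add_one₀ (by norm_num)]
  have hp : (0 : ℝ) < 4 ^ j := by positivity
  exact one_div_lt_one_div_of_lt hp (by linarith)

theorem IsFreq.perturb {ω₀ : Fin d → ℝ} {w : ℝ → Fin d → ℝ} (hw : IsFreq ω₀ w)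
    (j : ℤ) (c : (Fin d → ℝ) × (Fin d → ℝ)) : IsFreq ω₀ (perturb w j c) where
  contDiff := hw.contDiff.add (((contDiff_zoneFun j).smul contDiff_const).add
    ((contDiff_zoneFun (j + 1)).smul contDiff_const))
  near_zero := by
    obtain ⟨s₀, h0, h⟩ := hw.near_zero
    refine ⟨min s₀ (1 / 4 ^ (j + 1)), by positivity, fun s hs => ?_⟩
    obtain ⟨h1, h2⟩ := zoneFun_of_lt_min (hs.trans_le (min_le_right _ _))
    simp [_root_.perturb, h s (hs.trans_le (min_le_left _ _)), h1, h2]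
  zone i := by
    obtain ⟨a, b, hab⟩ := hw.zone i
    obtain ⟨a1, b1, h1⟩ := zoneFun_segment j i c.1
    obtain ⟨a2, b2, h2⟩ := zoneFun_segment (j + 1) i c.2
    refine ⟨a + (a1 + a2), b + (b1 + b2), fun s hs => ?_⟩
    rw [_root_.perturb, hab s hs, h1 s hs, h2 s hs]
    simp only [smul_add]
    abel

/-- Two vectors of `ℝ^d`, `d ≥ 4`, can be perturbed so as to become orthogonal to the same nonzero
integer vector `k` with `k_q = 0`. -/
theorem exists_resonance (hd : 4 ≤ d) (q : Fin d) (a b : Fin d → ℝ) {δ : ℝ} (hδ : 0 < δ) :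
    ∃ (c : (Fin d → ℝ) × (Fin d → ℝ)) (k : Fin d → ℤ), ‖c‖ ≤ δ ∧ k ≠ 0 ∧ k q = 0 ∧
      ∑ i, (k i : ℝ) * (a i + c.1 i) = 0 ∧ ∑ i, (k i : ℝ) * (b i + c.2 i) = 0 := by
  choose ra hra using fun i => exists_rat_near (a i) hδ
  choose rb hrb using fun i => exists_rat_near (b i) hδ
  -- Orthogonality to rational approximations of `a` and `b`, and vanishing of the coordinate `q`:
  -- three functionals, so the kernel is nonzero when d ≥ 4.
  let f : (Fin d → ℚ) →ₗ[ℚ] (Fin 3 → ℚ) := LinearMap.pi ![∑ i, ra i • LinearMap.proj i,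
    ∑ i, rb i • LinearMap.proj i, LinearMap.proj q]
  have hker : LinearMap.ker f ≠ ⊥ := by
    refine LinearMap.ker_ne_bot_of_finrank_lt ?_
    simp only [Module.finrank_fin_fun]
    omega
  obtain ⟨v, hv, hv0⟩ := (Submodule.ne_bot_iff _).1 hker
  rw [LinearMap.mem_ker] at hv
  have e0 : ∑ i, ra i * v i = 0 := by simpa [f] using congrFun hv 0
  have e1 : ∑ i, rb i * v i = 0 := by simpa [f] using congrFun hv 1
  have e2 : v q = 0 := by simpa [f] using congrFun hv 2
  obtain ⟨D, hD⟩ := IsLocalization.exist_integer_multiples_of_finset (nonZeroDivisors ℤ)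
    (Finset.univ.image v)
  have hD0 : ((D : ℤ) : ℚ) ≠ 0 := by exact_mod_cast nonZeroDivisors.ne_zero D.2
  have hk : ∀ i, ∃ n : ℤ, (n : ℚ) = (D : ℤ) * v i := by
    intro i
    obtain ⟨n, hn⟩ := hD (v i) (Finset.mem_image_of_mem v (Finset.mem_univ i))
    refine ⟨n, ?_⟩
    simpa [Algebra.smul_def] using hn
  choose k hk using hk
  refine ⟨(fun i => ra i - a i, fun i => rb i - b i), k, ?_, ?_, ?_, ?_, ?_⟩
  · refine max_le ((pi_norm_le_iff_of_nonneg hδ.le).2 fun i => ?_)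
      ((pi_norm_le_iff_of_nonneg hδ.le).2 fun i => ?_)
    · rw [Real.norm_eq_abs, abs_sub_comm]; exact (hra i).le
    · rw [Real.norm_eq_abs, abs_sub_comm]; exact (hrb i).le
  · intro h0
    refine hv0 (funext fun i => ?_)
    have := hk i
    rw [h0] at this
    simpa [hD0] using this.symm
  · have := hk q
    rw [e2, mul_zero] at this
    exact_mod_cast this
  · have : ∑ i, (k i : ℚ) * ra i = 0 := by
      have : ∑ i, (k i : ℚ) * ra i = (D : ℤ) * ∑ i, ra i * v i := by
        rw [Finset.mul_sum]
        exact Finset.sum_congr rfl fun i _ => by rw [hk]; ring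
      rw [this, e0, mul_zero]
    simp only [add_sub_cancel]
    exact_mod_cast congrArg (Rat.cast : ℚ → ℝ) this
  · have : ∑ i, (k i : ℚ) * rb i = 0 := by
      have : ∑ i, (k i : ℚ) * rb i = (D : ℤ) * ∑ i, rb i * v i := by
        rw [Finset.mul_sum]
        exact Finset.sum_congr rfl fun i _ => by rw [hk]; ring
      rw [this, e1, mul_zero]
    simp only [add_sub_cancel]
    exact_mod_cast congrArg (Rat.cast : ℚ → ℝ) this

/-- A vector with coordinates of opposite signs can be perturbed so as to become orthogonal to a
nonzero nonnegative integer vector. -/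
theorem exists_nonneg_resonance {q i₀ j₀ : Fin d} (hi : i₀ ≠ q) (hj : j₀ ≠ q) (a : Fin d → ℝ)
    (hai : a i₀ < 0) (haj : 0 < a j₀) {δ : ℝ} (hδ : 0 < δ) :
    ∃ (c : Fin d → ℝ) (k : Fin d → ℤ), ‖c‖ ≤ δ ∧ k ≠ 0 ∧ k q = 0 ∧ (∀ i, 0 ≤ k i) ∧
      ∑ i, (k i : ℝ) * (a i + c i) = 0 := by
  have hij : i₀ ≠ j₀ := fun h => by rw [h] at hai; linarith
  -- Moving only the coordinate `i₀`, to -ρ a_{j₀}, makes the vector orthogonal to den(ρ) e_{i₀} +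
  -- num(ρ) e_{j₀}. The opposite signs make ρ positive and this vector nonnegative.
  obtain ⟨ρ, h1, h2⟩ := exists_rat_btwn
    (show -a i₀ / a j₀ < -a i₀ / a j₀ + δ / a j₀ by have := div_pos hδ haj; linarith)
  have hρ : (0 : ℝ) < ρ := (div_pos (by linarith) haj).trans h1
  have hρ' : 0 < ρ := by exact_mod_cast hρ
  rw [← add_div, lt_div_iff₀ haj] at h2
  rw [div_lt_iff₀ haj] at h1
  refine ⟨Pi.single i₀ (-(ρ * a j₀) - a i₀), Pi.single i₀ (ρ.den : ℤ) + Pi.single j₀ ρ.num, ?_, ?_,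
    ?_, ?_, ?_⟩
  · rw [Pi.norm_single, Real.norm_eq_abs, abs_le]
    constructor <;> linarith
  · intro h
    have := congrFun h i₀
    simp [hij] at this
  · simp [hi.symm, hj.symm]
  · intro i
    have hnum : 0 ≤ ρ.num := (Rat.num_pos.2 hρ').le
    have : 0 ≤ (Pi.single i₀ (ρ.den : ℤ) : Fin d → ℤ) + Pi.single j₀ ρ.num :=
      add_nonneg (Pi.single_nonneg.2 (by positivity)) (Pi.single_nonneg.2 hnum)
    exact this i
  · have hterm : ∀ i, (((Pi.single i₀ (ρ.den : ℤ) + Pi.single j₀ ρ.num : Fin d → ℤ) i : ℤ) : ℝ) *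
        (a i + (Pi.single i₀ (-(ρ * a j₀) - a i₀) : Fin d → ℝ) i) =
        (if i = i₀ then (ρ.den : ℝ) * (-(ρ * a j₀)) else 0) +
        (if i = j₀ then (ρ.num : ℝ) * a j₀ else 0) := by
      intro i
      by_cases h3 : i = i₀
      · subst h3; simp [hij]
      · by_cases h4 : i = j₀
        · subst h4; simp [h3]
        · simp [h3, h4]
    rw [Finset.sum_congr rfl fun i _ => hterm i, Finset.sum_add_distrib]
    simp only [Finset.sum_ite_eq', Finset.mem_univ, if_true]
    have : (ρ.den : ℝ) * ρ = ρ.num := by exact_mod_cast Rat.den_mul_eq_num ρ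
    linear_combination (-a j₀) * this

end Zones

end

noncomputable section

/-! ### Smooth limits of functions with rapidly decreasing increments. -/

section Limits

open Set Filter

theorem dist_limit_le {α : Type*} [PseudoMetricSpace α] {f : ℕ → α} {a : α} {N : ℕ}
    (h : ∀ n ≥ N, dist (f n) (f (n + 1)) ≤ (1 / 2) ^ n) (ha : Tendsto f atTop (𝓝 a)) :
    dist (f N) a ≤ 2 * (1 / 2) ^ N := by
  have h1 := dist_le_of_le_geometric_of_tendsto (1 / 2 : ℝ) ((1 / 2) ^ N) (by norm_num)
    (f := fun n => f (N + n)) (a := a) (fun n => by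
      rw [← pow_add]; exact h (N + n) (by omega))
    (by simpa [add_comm] using (tendsto_add_atTop_iff_nat N).2 ha) 0
  simp only [add_zero, pow_zero, mul_one] at h1
  refine h1.trans (le_of_eq ?_)
  ring

theorem cauchySeq_of_eventually_geometric {α : Type*} [PseudoMetricSpace α] {f : ℕ → α} {N : ℕ}
    (h : ∀ n ≥ N, dist (f n) (f (n + 1)) ≤ (1 / 2) ^ n) : CauchySeq f := by
  have h1 : CauchySeq fun n => f (n + N) := by
    refine cauchySeq_of_le_geometric (1 / 2 : ℝ) ((1 / 2) ^ N) (by norm_num) fun n => ?_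
    rw [← pow_add, add_comm N n]
    have := h (n + N) (by omega)
    rwa [show n + N + 1 = n + 1 + N by ring] at this
  exact (cauchySeq_shift N).1 h1

variable {E : Type} [NormedAddCommGroup E] [NormedSpace ℝ E]

/-- On a fixed ball all but finitely many terms obey the geometric bound; the others are bounded by
compactness. -/
theorem exists_local_summable_bound [FiniteDimensional ℝ E] {G : Type} [NormedAddCommGroup G]
    {f : ℕ → E → G} (hf : ∀ n, Continuous (f n)) {p : ℕ}
    (hb : ∀ n z, p ≤ n → ‖z‖ ≤ n → ‖f n z‖ ≤ (1 / 2) ^ n) (R : ℝ) :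
    ∃ u : ℕ → ℝ, Summable u ∧ ∀ n, ∀ z ∈ Metric.ball (0 : E) R, ‖f n z‖ ≤ u n := by
  have : ProperSpace E := FiniteDimensional.proper ℝ E
  obtain ⟨N, hN⟩ := exists_nat_ge R
  choose B hB using fun n => (isCompact_closedBall (0 : E) R).exists_bound_of_continuousOn
    (hf n).continuousOn
  refine ⟨fun n => if N + p ≤ n then (1 / 2) ^ n else B n, ?_, fun n z hz => ?_⟩
  · rw [← summable_nat_add_iff (N + p)]
    have : (fun n => if N + p ≤ n + (N + p) then ((1 : ℝ) / 2) ^ (n + (N + p)) else B (n + (N + p)))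
        = fun n => (1 / 2) ^ (n + (N + p)) := by
      funext n; rw [if_pos (by omega)]
    rw [this, summable_nat_add_iff (N + p) (f := fun n => ((1 : ℝ) / 2) ^ n)]
    exact summable_geometric_of_lt_one (by norm_num) (by norm_num)
  · have hz' : ‖z‖ < R := by simpa using hz
    by_cases h : N + p ≤ n
    · simp only [h, if_true]
      refine hb n z (by omega) ?_
      have : (N : ℝ) ≤ n := by exact_mod_cast (by omega : N ≤ n)
      linarith
    · simp only [h, if_false]
      exact hB n z (Metric.ball_subset_closedBall hz)

theorem hasFDerivAt_tsum_local [FiniteDimensional ℝ E] {G : Type} [NormedAddCommGroup G] [NormedSpace ℝ G]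
    [CompleteSpace G] {F : ℕ → E → G} (hF : ∀ n, ContDiff ℝ ∞ (F n)) {p : ℕ}
    (hb : ∀ n k z, k + p ≤ n → ‖z‖ ≤ n → ‖iteratedFDeriv ℝ k (F n) z‖ ≤ (1 / 2) ^ n) (z : E) :
    HasFDerivAt (fun y => ∑' n, F n y) (∑' n, fderiv ℝ (F n) z) z ∧
      Summable fun n => fderiv ℝ (F n) z := by
  set R := ‖z‖ + 1
  have hz : z ∈ Metric.ball (0 : E) R := by simp [R]
  obtain ⟨u, hu, hub⟩ := exists_local_summable_bound (f := fun n => fderiv ℝ (F n))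
    (fun n => (hF n).continuous_fderiv (by simp)) (p := p + 1)
    (fun n z hn hz => by
      rw [← norm_iteratedFDeriv_one]; exact hb n 1 z (by omega) hz) R
  obtain ⟨v, hv, hvb⟩ := exists_local_summable_bound (f := F) (fun n => (hF n).continuous) (p := p)
    (fun n z hn hz => by
      rw [← norm_iteratedFDeriv_zero (𝕜 := ℝ)]; exact hb n 0 z (by omega) hz) R
  refine ⟨hasFDerivAt_tsum_of_isPreconnected hu Metric.isOpen_ball
    (convex_ball (0 : E) R).isPreconnected
    (fun n y _ => ((hF n).differentiable (by simp) y).hasFDerivAt) hub hz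
    (Summable.of_norm_bounded hv fun n => hvb n z hz) hz,
    Summable.of_norm_bounded hu fun n => hub n z hz⟩

/-- Each differentiation turns the hypothesis for `p` into the one for `p + 1`; the offset is there
to make the induction close. -/
theorem contDiff_nat_tsum_local [FiniteDimensional ℝ E] (m : ℕ) : ∀ {G : Type} [NormedAddCommGroup G] [NormedSpace ℝ G]
    [CompleteSpace G] {F : ℕ → E → G} {p : ℕ}, (∀ n, ContDiff ℝ ∞ (F n)) →
    (∀ n k z, k + p ≤ n → ‖z‖ ≤ n → ‖iteratedFDeriv ℝ k (F n) z‖ ≤ (1 / 2) ^ n) →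
    ContDiff ℝ m (fun y => ∑' n, F n y) := by
  induction m with
  | zero =>
    intro G _ _ _ F p hF hb
    rw [Nat.cast_zero, contDiff_zero]
    exact continuous_iff_continuousAt.2 fun z => (hasFDerivAt_tsum_local hF hb z).1.continuousAt
  | succ m ih =>
    intro G _ _ _ F p hF hb
    rw [Nat.cast_succ, contDiff_succ_iff_hasFDerivAt]
    refine ⟨fun z => ∑' n, fderiv ℝ (F n) z, ih (p := p + 1) (fun n => (hF n).fderiv_right (by simp))
      (fun n k z hn hz => ?_), fun z => (hasFDerivAt_tsum_local hF hb z).1⟩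
    rw [norm_iteratedFDeriv_fderiv]
    exact hb n (k + 1) z (by omega) hz

/-- Functions that are small in `C^n` on the ball of radius `n`, and of third order at `0`. -/
structure SmallOn (n : ℕ) (η : ℝ) (F : E → ℝ) : Prop where
  contDiff : ContDiff ℝ ∞ F
  bound : ∀ k ≤ n, ∀ z, ‖z‖ ≤ n → ‖iteratedFDeriv ℝ k F z‖ ≤ η
  cubic : ∀ z, ‖z‖ ≤ 1 → |F z| ≤ η * ‖z‖ ^ 3

theorem SmallOn.add {n : ℕ} {η η' : ℝ} {F G : E → ℝ} (hF : SmallOn n η F) (hG : SmallOn n η' G) :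
    SmallOn n (η + η') (fun z => F z + G z) where
  contDiff := hF.contDiff.add hG.contDiff
  bound k hk z hz := by
    have h : iteratedFDeriv ℝ k (fun z => F z + G z) z =
        iteratedFDeriv ℝ k F z + iteratedFDeriv ℝ k G z :=
      iteratedFDeriv_add_apply (hF.contDiff.of_le (by exact_mod_cast le_top)).contDiffAt
        (hG.contDiff.of_le (by exact_mod_cast le_top)).contDiffAt
    rw [h]
    exact (norm_add_le _ _).trans (add_le_add (hF.bound k hk z hz) (hG.bound k hk z hz))
  cubic z hz := by
    rw [add_mul]
    exact (abs_add_le _ _).trans (add_le_add (hF.cubic z hz) (hG.cubic z hz))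

/-- If F vanishes on the ball of radius ρ, then |F| ≤ A'/ρ³ · ‖z‖³ on the unit ball. So the cubic
estimate costs no more than a sup bound. -/
theorem exists_smallOn_bound [FiniteDimensional ℝ E] (n : ℕ) {F : E → ℝ} (hF : ContDiff ℝ ∞ F)
    (h0 : ∀ᶠ z in 𝓝 (0 : E), F z = 0) : ∃ B : ℝ, 0 < B ∧ ∀ c : ℝ, SmallOn n (|c| * B)
      (fun z => c * F z) := by
  have : ProperSpace E := FiniteDimensional.proper ℝ E
  choose A hA using fun k : ℕ => (isCompact_closedBall (0 : E) n).exists_bound_of_continuousOn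
    (hF.continuous_iteratedFDeriv (m := k) (by exact_mod_cast le_top)).continuousOn
  obtain ⟨A', hA'⟩ := (isCompact_closedBall (0 : E) 1).exists_bound_of_continuousOn
    hF.continuous.continuousOn
  obtain ⟨ρ, hρ, hρ0⟩ := Metric.eventually_nhds_iff.1 h0
  set B := ∑ k ∈ Finset.range (n + 1), |A k| + |A'| / ρ ^ 3 + 1 with hB
  have hs : 0 ≤ ∑ k ∈ Finset.range (n + 1), |A k| := Finset.sum_nonneg fun _ _ => abs_nonneg _
  have ht : 0 ≤ |A'| / ρ ^ 3 := by positivity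
  refine ⟨B, by linarith, fun c => ⟨contDiff_const.mul hF, fun k hk z hz => ?_, fun z hz => ?_⟩⟩
  · have h : iteratedFDeriv ℝ k (fun z => c * F z) z = c • iteratedFDeriv ℝ k F z :=
      iteratedFDeriv_const_smul_apply' (a := c) (hF.of_le (by exact_mod_cast le_top)).contDiffAt
    rw [h, norm_smul, Real.norm_eq_abs]
    refine mul_le_mul_of_nonneg_left ?_ (abs_nonneg c)
    have h1 := hA k z (by simpa using hz)
    have h2 : |A k| ≤ ∑ k ∈ Finset.range (n + 1), |A k| :=
      Finset.single_le_sum (f := fun k => |A k|) (fun _ _ => abs_nonneg _)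
        (Finset.mem_range.2 (by omega))
    linarith [le_abs_self (A k)]
  · rw [abs_mul, mul_assoc]
    refine mul_le_mul_of_nonneg_left ?_ (abs_nonneg c)
    by_cases hzρ : ‖z‖ < ρ
    · rw [hρ0 (by simpa using hzρ), abs_zero]
      have : 0 ≤ B := by linarith
      positivity
    · have h1 : |F z| ≤ A' := hA' z (by simpa using hz)
      have h2 : ρ ^ 3 ≤ ‖z‖ ^ 3 := pow_le_pow_left₀ hρ.le (not_lt.1 hzρ) 3
      have h3 : |A'| ≤ |A'| / ρ ^ 3 * ‖z‖ ^ 3 := by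
        rw [div_mul_eq_mul_div, le_div_iff₀ (by positivity)]
        exact mul_le_mul_of_nonneg_left h2 (abs_nonneg _)
      have h4 : |A'| / ρ ^ 3 * ‖z‖ ^ 3 ≤ B * ‖z‖ ^ 3 :=
        mul_le_mul_of_nonneg_right (by linarith) (by positivity)
      linarith [le_abs_self A']

theorem smallOn_zero (n : ℕ) : SmallOn n 0 (fun _ : E => 0) where
  contDiff := contDiff_const
  bound k _ z _ := by
    have : iteratedFDeriv ℝ k (fun _ : E => (0 : ℝ)) = 0 := iteratedFDeriv_fun_zero
    rw [this]; simp
  cubic z _ := by simp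

theorem SmallOn.mono {n : ℕ} {η η' : ℝ} {F : E → ℝ} (hF : SmallOn n η F) (h : η ≤ η') :
    SmallOn n η' F :=
  ⟨hF.contDiff, fun k hk z hz => (hF.bound k hk z hz).trans h, fun z hz =>
    (hF.cubic z hz).trans (mul_le_mul_of_nonneg_right h (by positivity))⟩

theorem exists_small_coeffs [FiniteDimensional ℝ E] {ι : Type*} (s : Finset ι) (n : ℕ) {F : ι → E → ℝ}
    (hF : ∀ i, ContDiff ℝ ∞ (F i)) (h0 : ∀ i, ∀ᶠ z in 𝓝 (0 : E), F i z = 0) :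
    ∀ η : ℝ, 0 < η → ∃ δ : ℝ, 0 < δ ∧ ∀ c : ι → ℝ, (∀ i, |c i| ≤ δ) →
      SmallOn n η (fun z => ∑ i ∈ s, c i * F i z) := by
  classical
  induction s using Finset.induction_on with
  | empty =>
    intro η hη
    refine ⟨1, one_pos, fun c _ => ?_⟩
    simpa using (smallOn_zero (E := E) n).mono hη.le
  | insert a s ha ih =>
    intro η hη
    obtain ⟨δ, hδ, h⟩ := ih (η / 2) (by linarith)
    obtain ⟨B, hB, hBc⟩ := exists_smallOn_bound n (hF a) (h0 a)
    refine ⟨min δ (η / 2 / B), by positivity, fun c hc => ?_⟩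
    simp only [Finset.sum_insert ha]
    refine ((hBc (c a)).add (h c fun i => (hc i).trans (min_le_left _ _))).mono ?_
    have : |c a| * B ≤ η / 2 := by
      rw [← le_div_iff₀ hB]
      exact (hc a).trans (min_le_right _ _)
    linarith

/-- Limits of sequences of functions with rapidly decreasing increments. -/
theorem exists_smooth_limit [FiniteDimensional ℝ E] {H : ℕ → E → ℝ} (h0 : ContDiff ℝ ∞ (H 0))
    (hs : ∀ n, SmallOn n ((1 / 2) ^ n) (fun z => H (n + 1) z - H n z)) :
    ∃ K : E → ℝ, ContDiff ℝ ∞ K ∧ (fun z => K z - H 0 z) =O[𝓝 0] (fun z => ‖z‖ ^ 3) ∧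
      ∀ (N : ℕ) (z : E), 1 ≤ N → ‖z‖ ≤ N →
        ‖fderiv ℝ (H N) z - fderiv ℝ K z‖ ≤ 2 * (1 / 2) ^ N := by
  set F : ℕ → E → ℝ := fun n z => H (n + 1) z - H n z with hFdef
  have hF : ∀ n, ContDiff ℝ ∞ (F n) := fun n => (hs n).contDiff
  have hb : ∀ (n k : ℕ) (z : E), k + 0 ≤ n → ‖z‖ ≤ n → ‖iteratedFDeriv ℝ k (F n) z‖ ≤ (1 / 2) ^ n :=
    fun n k z hk hz => (hs n).bound k (by omega) z hz
  have hS : ContDiff ℝ ∞ (fun z => ∑' n, F n z) :=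
    contDiff_infty.2 fun m => contDiff_nat_tsum_local m hF hb
  have hH : ∀ n, ContDiff ℝ ∞ (H n) := by
    intro n
    induction n with
    | zero => exact h0
    | succ n ih =>
      have : H (n + 1) = fun z => H n z + F n z := by funext z; simp [hFdef]
      rw [this]; exact ih.add (hF n)
  refine ⟨fun z => H 0 z + ∑' n, F n z, h0.add hS, ?_, fun N z hN hz => ?_⟩
  · refine Asymptotics.IsBigO.of_bound 2 ?_
    filter_upwards [Metric.ball_mem_nhds (0 : E) one_pos] with z hz
    have hz' : ‖z‖ ≤ 1 := le_of_lt (by simpa using hz)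
    rw [add_sub_cancel_left, Real.norm_of_nonneg (by positivity : (0 : ℝ) ≤ ‖z‖ ^ 3)]
    have hsum : HasSum (fun n : ℕ => ((1 : ℝ) / 2) ^ n * ‖z‖ ^ 3) (2 * ‖z‖ ^ 3) :=
      hasSum_geometric_two.mul_right _
    exact tsum_of_norm_bounded hsum fun n => (hs n).cubic z hz'
  · have hd := hasFDerivAt_tsum_local hF hb z
    have hK : fderiv ℝ (fun z => H 0 z + ∑' n, F n z) z =
        fderiv ℝ (H 0) z + ∑' n, fderiv ℝ (F n) z :=
      (((h0.differentiable (by simp) z).hasFDerivAt).add hd.1).fderiv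
    have hFd : ∀ n, fderiv ℝ (F n) z = fderiv ℝ (H (n + 1)) z - fderiv ℝ (H n) z := fun n =>
      (((hH (n + 1)).differentiable (by simp) z).hasFDerivAt.sub
        ((hH n).differentiable (by simp) z).hasFDerivAt).fderiv
    have ht : Tendsto (fun n => fderiv ℝ (H n) z) atTop
        (𝓝 (fderiv ℝ (fun z => H 0 z + ∑' n, F n z) z)) := by
      rw [hK]
      have := hd.2.hasSum.tendsto_sum_nat.const_add (fderiv ℝ (H 0) z)
      refine this.congr fun n => ?_
      rw [Finset.sum_congr rfl fun i _ => hFd i, Finset.sum_range_sub (fun n => fderiv ℝ (H n) z),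
        add_sub_cancel]
    rw [← dist_eq_norm]
    refine dist_limit_le (fun n hn => ?_) ht
    rw [dist_comm, dist_eq_norm, ← hFd, ← norm_iteratedFDeriv_one]
    refine hb n 1 z (by omega) (hz.trans (by exact_mod_cast hn))

end Limits

/-! ### Convergence of the flows. -/

section FlowLimit

open Set Filter

variable {d : ℕ}

theorem norm_hamVectorField_sub_le (F G : Phase d → ℝ) (z : Phase d) :
    ‖hamVectorField F z - hamVectorField G z‖ ≤ ‖fderiv ℝ F z - fderiv ℝ G z‖ := by
  have h1 : ∀ j : Fin d, ‖((0, Pi.single j 1) : Phase d)‖ ≤ 1 := fun j => by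
    rw [Prod.norm_def, Pi.norm_single]; simp
  have h2 : ∀ j : Fin d, ‖((Pi.single j 1, 0) : Phase d)‖ ≤ 1 := fun j => by
    rw [Prod.norm_def, Pi.norm_single]; simp
  have h3 : ∀ v : Phase d, ‖v‖ ≤ 1 →
      ‖(fderiv ℝ F z - fderiv ℝ G z) v‖ ≤ ‖fderiv ℝ F z - fderiv ℝ G z‖ := fun v hv =>
    ((fderiv ℝ F z - fderiv ℝ G z).le_opNorm v).trans
      (mul_le_of_le_one_right (norm_nonneg _) hv)
  refine max_le ((pi_norm_le_iff_of_nonneg (norm_nonneg _)).2 fun j => ?_)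
    ((pi_norm_le_iff_of_nonneg (norm_nonneg _)).2 fun j => ?_)
  · exact h3 _ (h1 j)
  · have := h3 _ (h2 j)
    rw [← norm_neg] at this
    refine le_trans (le_of_eq ?_) this
    congr 1
    simp [hamVectorField]; ring

/-- The closeness hypothesis makes the curves converge uniformly on bounded time intervals, and C^1
closeness of the Hamiltonians makes their velocities converge too. The limit is thus an integral
curve for all times, so completeness of the limit field needs no growth bound. -/
theorem exists_flow_limit {H : ℕ → Phase d → ℝ} {K : Phase d → ℝ}
    (hK : ContDiff ℝ ∞ K) (hHK : ∀ (N : ℕ) (z : Phase d), 1 ≤ N → ‖z‖ ≤ N →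
      ‖fderiv ℝ (H N) z - fderiv ℝ K z‖ ≤ 2 * (1 / 2) ^ N)
    {Ψ : ℕ → ℝ → Phase d → Phase d} (hΨ : ∀ n, IsHamFlow (H n) (Ψ n)) {T : ℕ → ℝ}
    (hT : Monotone T) (hT' : Tendsto T atTop atTop)
    (hclose : ∀ n t z, |t| ≤ T n → ‖z‖ ≤ n → ‖Ψ (n + 1) t z - Ψ n t z‖ ≤ (1 / 2) ^ n) :
    ∃ Φ : ℝ → Phase d → Phase d, IsHamFlow K Φ ∧
      (∀ t z, Tendsto (fun n => Ψ n t z) atTop (𝓝 (Φ t z))) ∧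
      ∀ N t z, |t| ≤ T N → ‖z‖ ≤ N → ‖Ψ N t z - Φ t z‖ ≤ 2 * (1 / 2) ^ N := by
  have hstep : ∀ N t z, |t| ≤ T N → ‖z‖ ≤ N → ∀ n ≥ N, dist (Ψ n t z) (Ψ (n + 1) t z) ≤
      (1 / 2) ^ n := by
    intro N t z ht hz n hn
    rw [dist_comm, dist_eq_norm]
    exact hclose n t z (ht.trans (hT hn)) (hz.trans (by exact_mod_cast hn))
  have hex : ∀ (t : ℝ) (z : Phase d), ∃ N : ℕ, |t| ≤ T N ∧ ‖z‖ ≤ N := by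
    intro t z
    obtain ⟨N, hN⟩ := exists_nat_ge ‖z‖
    obtain ⟨n, hn1, hn2⟩ := ((hT'.eventually_ge_atTop |t|).and (eventually_ge_atTop N)).exists
    exact ⟨n, hn1, hN.trans (by exact_mod_cast hn2)⟩
  have hlim : ∀ t z, ∃ y, Tendsto (fun n => Ψ n t z) atTop (𝓝 y) := by
    intro t z
    obtain ⟨N, h1, h2⟩ := hex t z
    exact cauchySeq_tendsto_of_complete (cauchySeq_of_eventually_geometric (hstep N t z h1 h2))
  choose Φ hΦ using hlim
  have hclose' : ∀ N t z, |t| ≤ T N → ‖z‖ ≤ N → ‖Ψ N t z - Φ t z‖ ≤ 2 * (1 / 2) ^ N := by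
    intro N t z h1 h2
    rw [← dist_eq_norm]
    exact dist_limit_le (hstep N t z h1 h2) (hΦ t z)
  refine ⟨Φ, fun z => ⟨?_, fun t => ?_⟩, hΦ, hclose'⟩
  · refine tendsto_nhds_unique (hΦ 0 z) ?_
    have : (fun n => Ψ n 0 z) = fun _ => z := by funext n; exact (hΨ n z).1
    rw [this]; exact tendsto_const_nhds
  · set R := |t| + 1
    have hpow : Tendsto (fun n : ℕ => 2 * ((1 : ℝ) / 2) ^ n) atTop (𝓝 0) := by
      simpa using (tendsto_pow_atTop_nhds_zero_of_lt_one (r := (1 : ℝ) / 2) (by norm_num)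
        (by norm_num)).const_mul 2
    have hev : ∀ᶠ n in atTop, R ≤ T n ∧ ‖z‖ ≤ n :=
      (hT'.eventually_ge_atTop R).and
        ((tendsto_natCast_atTop_atTop (R := ℝ)).eventually_ge_atTop ‖z‖)
    have hu : TendstoUniformlyOn (fun n s => Ψ n s z) (fun s => Φ s z) atTop (Icc (-R) R) := by
      rw [Metric.tendstoUniformlyOn_iff]
      intro ε hε
      filter_upwards [hev, hpow.eventually_lt_const hε] with n hn hp s hs
      rw [dist_comm, dist_eq_norm]
      exact (hclose' n s z ((abs_le.2 hs).trans hn.1) hn.2).trans_lt hp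
    have hcn : ∀ n, Continuous fun s => Ψ n s z := fun n =>
      continuous_iff_continuousAt.2 fun s => ((hΨ n z).2 s).continuousAt
    have hc : ContinuousOn (fun s => Φ s z) (Icc (-R) R) :=
      hu.continuousOn (Frequently.of_forall fun n => (hcn n).continuousOn)
    -- Confines the limit curve, and eventually the approximating ones, to a fixed ball on which the
    -- fields are compared.
    obtain ⟨B, hB⟩ := isCompact_Icc.exists_bound_of_continuousOn hc
    have hX := (contDiff_hamVectorField hK).continuous
    have hXu := (isCompact_closedBall (0 : Phase d) (B + 1)).uniformContinuousOn_of_continuous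
      hX.continuousOn
    refine hasDerivAt_of_tendstoLocallyUniformlyOn (s := Ioo (-R) R) isOpen_Ioo
      (f := fun n s => Ψ n s z) (f' := fun n s => hamVectorField (H n) (Ψ n s z))
      (g' := fun s => hamVectorField K (Φ s z)) (l := atTop)
      (TendstoUniformlyOn.tendstoLocallyUniformlyOn ?_)
      (Eventually.of_forall fun n s _ => (hΨ n z).2 s) (fun s _ => hΦ s z)
      ⟨by have := neg_abs_le t; simp only [R]; linarith, by
        have := le_abs_self t; simp only [R]; linarith⟩
    rw [Metric.tendstoUniformlyOn_iff]
    intro ε hε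
    rw [Metric.uniformContinuousOn_iff] at hXu
    obtain ⟨δ, hδ, hXu⟩ := hXu (ε / 2) (by linarith)
    rw [Metric.tendstoUniformlyOn_iff] at hu
    filter_upwards [hu (min δ 1) (by positivity), hpow.eventually_lt_const (half_pos hε),
      eventually_ge_atTop 1,
      (tendsto_natCast_atTop_atTop (R := ℝ)).eventually_ge_atTop (B + 1)] with n h1 h2 h3 h4 s hs
    have hs' := Ioo_subset_Icc_self hs
    have d1 := h1 s hs'
    have hb1 : ‖Φ s z‖ ≤ B := hB s hs'
    have hb2 : ‖Ψ n s z‖ ≤ B + 1 := by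
      have : ‖Ψ n s z‖ ≤ ‖Φ s z‖ + dist (Φ s z) (Ψ n s z) := by
        rw [dist_comm, dist_eq_norm]
        exact norm_le_norm_add_norm_sub' _ _
      have := d1.trans_le (min_le_right _ _)
      linarith
    have e1 := hXu (Φ s z) (by simpa using hb1.trans (by linarith)) (Ψ n s z) (by simpa using hb2)
      (d1.trans_le (min_le_left _ _))
    have e2 : dist (hamVectorField K (Ψ n s z)) (hamVectorField (H n) (Ψ n s z)) < ε / 2 := by
      rw [dist_comm, dist_eq_norm]
      exact ((norm_hamVectorField_sub_le _ _ _).trans (hHK n _ h3 (hb2.trans h4))).trans_lt h2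
    calc _ ≤ _ := dist_triangle _ (hamVectorField K (Ψ n s z)) _
      _ < ε := by linarith

end FlowLimit

end

noncomputable section

/-! ### Stages of the construction: small perturbations and free conjugations. -/

section States

open Set Filter

variable {d : ℕ}

/-- A stage of the construction: a frequency curve and a symplectic conjugation. -/
structure Stage (q : Fin d) (ω₀ : Fin d → ℝ) where
  w : ℝ → Fin d → ℝ
  e : Phase d ≃ Phase d
  isFreq : IsFreq ω₀ w
  symp : IsSymplecto e
  action_e : ∀ z, action q (e z) = action q z
  e_boundary : ∀ z i, action i z = 0 → e z = z
  e_near : ∃ s₀ > 0, ∀ z, action q z < s₀ → e z = z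

namespace Stage

variable {q : Fin d} {ω₀ : Fin d → ℝ}

/-- The Hamiltonian of a stage. -/
def ham (S : Stage q ω₀) (z : Phase d) : ℝ := freqHam q S.w (S.e.symm z)

/-- The Hamiltonian flow of a stage. -/
def flow (S : Stage q ω₀) (t : ℝ) (z : Phase d) : Phase d := S.e (freqFlow q S.w t (S.e.symm z))

theorem contDiff_ham (S : Stage q ω₀) : ContDiff ℝ ∞ S.ham :=
  (contDiff_freqHam q S.isFreq.contDiff).comp S.symp.contDiff_symm

theorem isHamFlow (S : Stage q ω₀) : IsHamFlow S.ham S.flow :=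
  S.symp.isHamFlow_conj ((contDiff_freqHam q S.isFreq.contDiff).differentiable (by simp))
    (isHamFlow_freqFlow q S.isFreq.contDiff)

theorem action_symm (S : Stage q ω₀) (z : Phase d) : action q (S.e.symm z) = action q z := by
  have := S.action_e (S.e.symm z)
  rwa [S.e.apply_symm_apply, eq_comm] at this

theorem symm_boundary (S : Stage q ω₀) {z : Phase d} {i : Fin d} (h : action i z = 0) :
    S.e.symm z = z := by
  rw [Equiv.symm_apply_eq, S.e_boundary z i h]

/-- The initial stage. -/
def init (q : Fin d) (ω₀ : Fin d → ℝ) : Stage q ω₀ where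
  w := fun _ => ω₀
  e := Equiv.refl _
  isFreq := isFreq_const ω₀
  symp := IsSymplecto.refl
  action_e _ := rfl
  e_boundary _ _ _ := rfl
  e_near := ⟨1, one_pos, fun _ _ => rfl⟩

/-- Perturbation of the frequency curve of a stage. -/
def perturb (S : Stage q ω₀) (j : ℤ) (c : (Fin d → ℝ) × (Fin d → ℝ)) : Stage q ω₀ where
  w := _root_.perturb S.w j c
  e := S.e
  isFreq := S.isFreq.perturb j c
  symp := S.symp
  action_e := S.action_e
  e_boundary := S.e_boundary
  e_near := S.e_near

/-- Because e preserves r_q, the change of Hamiltonian is linear in `c`, with coefficient functions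
vanishing near the origin; `exists_small_coeffs` then applies. -/
theorem ham_perturb_sub (S : Stage q ω₀) (j : ℤ) (c : (Fin d → ℝ) × (Fin d → ℝ)) (z : Phase d) :
    (S.perturb j c).ham z - S.ham z = ∑ i : Fin d ⊕ Fin d, Sum.elim c.1 c.2 i *
      (Sum.elim (fun i z => zoneFun j (action q z) * action i (S.e.symm z))
        (fun i z => zoneFun (j + 1) (action q z) * action i (S.e.symm z)) i z) := by
  simp only [ham, perturb, freqHam, _root_.perturb, Fintype.sum_sum_type, Sum.elim_inl, Sum.elim_inr,
    Pi.add_apply, Pi.smul_apply, smul_eq_mul, S.action_symm, ← Finset.sum_sub_distrib,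
    ← Finset.sum_add_distrib]
  exact Finset.sum_congr rfl fun i _ => by ring

theorem exists_ham_perturb_small (S : Stage q ω₀) (j : ℤ) (n : ℕ) {η : ℝ} (hη : 0 < η) :
    ∃ δ : ℝ, 0 < δ ∧ ∀ c, ‖c‖ ≤ δ →
      SmallOn n η (fun z => (S.perturb j c).ham z - S.ham z) := by
  have hsm : ∀ i j, ContDiff ℝ ∞ fun z => zoneFun j (action q z) * action i (S.e.symm z) := fun i j =>
    ((contDiff_zoneFun j).comp (contDiff_action q)).mul
      ((contDiff_action i).comp S.symp.contDiff_symm)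
  have h0 : ∀ j i, ∀ᶠ z in 𝓝 (0 : Phase d),
      zoneFun j (action q z) * action i (S.e.symm z) = 0 := by
    intro j i
    have : action q (0 : Phase d) < 1 / 4 ^ j := by
      have : action q (0 : Phase d) = 0 := by simp [action]
      rw [this]; positivity
    filter_upwards [(continuous_action q).continuousAt.eventually_lt_const this] with z hz
    rw [zoneFun_of_lt hz, zero_mul]
  obtain ⟨δ, hδ, h⟩ := exists_small_coeffs (Finset.univ : Finset (Fin d ⊕ Fin d)) n
    (F := Sum.elim (fun i z => zoneFun j (action q z) * action i (S.e.symm z))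
        (fun i z => zoneFun (j + 1) (action q z) * action i (S.e.symm z)))
    (by rintro (i | i) <;> exact hsm _ _) (by rintro (i | i) <;> exact h0 _ _) η hη
  refine ⟨δ, hδ, fun c hc => ?_⟩
  simp only [ham_perturb_sub]
  refine h _ ?_
  rintro (i | i)
  · exact ((norm_le_pi_norm c.1 i).trans (norm_fst_le c)).trans hc
  · exact ((norm_le_pi_norm c.2 i).trans (norm_snd_le c)).trans hc

theorem freq_perturb {w : ℝ → Fin d → ℝ} (hw : ContDiff ℝ ∞ w) (q : Fin d) (j : ℤ)
    (c : (Fin d → ℝ) × (Fin d → ℝ)) (z : Phase d) (i : Fin d) :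
    freq q (_root_.perturb w j c) z i =
      (w (action q z) i + (zoneFun j (action q z) * c.1 i + zoneFun (j + 1) (action q z) * c.2 i)) +
      if i = q then ∑ l, (deriv w (action q z) l + (deriv (zoneFun j) (action q z) * c.1 l +
        deriv (zoneFun (j + 1)) (action q z) * c.2 l)) * action l z else 0 := by
  have hz : ∀ j s, HasDerivAt (zoneFun j) (deriv (zoneFun j) s) s := fun j s =>
    ((contDiff_zoneFun j).differentiable (by simp) s).hasDerivAt
  have h : HasDerivAt (_root_.perturb w j c) (deriv w (action q z) +
      (deriv (zoneFun j) (action q z) • c.1 + deriv (zoneFun (j + 1)) (action q z) • c.2))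
      (action q z) :=
    ((hw.differentiable (by simp) _).hasDerivAt).add (((hz j _).smul_const c.1).add
      ((hz (j + 1) _).smul_const c.2))
  simp only [freq, h.deriv]
  simp [_root_.perturb]

theorem perturb_zero (w : ℝ → Fin d → ℝ) (j : ℤ) : _root_.perturb w j 0 = w := by
  funext s; simp [_root_.perturb]

theorem continuous_flow_perturb (S : Stage q ω₀) (j : ℤ) :
    Continuous fun p : ((Fin d → ℝ) × (Fin d → ℝ)) × (ℝ × Phase d) =>
      (S.perturb j p.1).flow p.2.1 p.2.2 := by
  have hs : Continuous fun p : ((Fin d → ℝ) × (Fin d → ℝ)) × (ℝ × Phase d) =>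
      S.e.symm p.2.2 := S.symp.contDiff_symm.continuous.comp (by fun_prop)
  have ha : ∀ l, Continuous fun p : ((Fin d → ℝ) × (Fin d → ℝ)) × (ℝ × Phase d) =>
      action l (S.e.symm p.2.2) := fun l => (continuous_action l).comp hs
  have hc1 : ∀ l, Continuous fun p : ((Fin d → ℝ) × (Fin d → ℝ)) × (ℝ × Phase d) => p.1.1 l :=
    fun l => by fun_prop
  have hc2 : ∀ l, Continuous fun p : ((Fin d → ℝ) × (Fin d → ℝ)) × (ℝ × Phase d) => p.1.2 l :=
    fun l => by fun_prop
  have hz : ∀ j, Continuous (zoneFun j) := fun j => (contDiff_zoneFun j).continuous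
  have hz' : ∀ j, Continuous (deriv (zoneFun j)) := fun j =>
    (contDiff_zoneFun j).continuous_deriv (by simp)
  have hw : ∀ l, Continuous fun s => S.w s l := fun l =>
    (continuous_apply l).comp S.isFreq.contDiff.continuous
  have hw' : ∀ l, Continuous fun s => deriv S.w s l := fun l =>
    (continuous_apply l).comp (S.isFreq.contDiff.continuous_deriv (by simp))
  refine S.symp.contDiff.continuous.comp (continuous_rotate ?_ hs)
  refine (continuous_fst.comp continuous_snd).smul (continuous_pi fun i => ?_)
  simp only [perturb, freq_perturb S.isFreq.contDiff]
  refine (((hw i).comp (ha q)).add ((((hz j).comp (ha q)).mul (hc1 i)).add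
    (((hz (j + 1)).comp (ha q)).mul (hc2 i)))).add ?_
  by_cases hi : i = q
  · simp only [hi, if_true]
    exact continuous_finsetSum _ fun l _ => ((((hw' l).comp (ha q)).add
      ((((hz' j).comp (ha q)).mul (hc1 l)).add (((hz' (j + 1)).comp (ha q)).mul (hc2 l))))).mul (ha l)
  · simp only [hi, if_false]
    exact continuous_const

/-- Joint continuity of the explicit flow in the parameter, the time and the point, and compactness
of the time interval times the ball. -/
theorem exists_flow_perturb_small (S : Stage q ω₀) (j : ℤ) (n : ℕ) (T : ℝ) {η : ℝ} (hη : 0 < η) :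
    ∃ δ : ℝ, 0 < δ ∧ ∀ c, ‖c‖ ≤ δ → ∀ t z, |t| ≤ T → ‖z‖ ≤ n →
      ‖(S.perturb j c).flow t z - S.flow t z‖ ≤ η := by
  have hS0 : ∀ t z, (S.perturb j 0).flow t z = S.flow t z := fun t z => by
    simp only [flow, perturb, perturb_zero]
  have hcont := S.continuous_flow_perturb j
  have h0 : Continuous fun p : ((Fin d → ℝ) × (Fin d → ℝ)) × (ℝ × Phase d) =>
      S.flow p.2.1 p.2.2 := by
    have : Continuous fun p : ((Fin d → ℝ) × (Fin d → ℝ)) × (ℝ × Phase d) =>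
      (S.perturb j 0).flow p.2.1 p.2.2 :=
      hcont.comp (g := fun p : ((Fin d → ℝ) × (Fin d → ℝ)) × (ℝ × Phase d) =>
        (S.perturb j p.1).flow p.2.1 p.2.2) 
        (f := fun p : ((Fin d → ℝ) × (Fin d → ℝ)) × (ℝ × Phase d) => (0, p.2)) (by fun_prop)
    simpa only [hS0] using this
  have hK : IsCompact ((Icc (-T) T) ×ˢ Metric.closedBall (0 : Phase d) n) :=
    isCompact_Icc.prod (isCompact_closedBall _ _)
  have := hK.eventually_forall_of_forall_eventually (x₀ := (0 : (Fin d → ℝ) × (Fin d → ℝ)))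
    (P := fun c p => ‖(S.perturb j c).flow p.1 p.2 - S.flow p.1 p.2‖ < η) (fun p _ => by
      refine (hcont.sub h0).norm.continuousAt.eventually_lt_const ?_
      simp [hS0, hη])
  obtain ⟨δ, hδ, h⟩ := Metric.eventually_nhds_iff.1 this
  refine ⟨δ / 2, by linarith, fun c hc t z ht hz => ?_⟩
  exact (h (y := c) (by rw [dist_zero_right]; linarith) (t, z)
    ⟨abs_le.1 ht, by simpa using hz⟩).le

theorem exists_perturb_small (S : Stage q ω₀) (j : ℤ) (n : ℕ) (T : ℝ) {η : ℝ} (hη : 0 < η) :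
    ∃ δ : ℝ, 0 < δ ∧ ∀ c, ‖c‖ ≤ δ →
      SmallOn n η (fun z => (S.perturb j c).ham z - S.ham z) ∧ ∀ t z, |t| ≤ T → ‖z‖ ≤ n →
      ‖(S.perturb j c).flow t z - S.flow t z‖ ≤ η := by
  obtain ⟨δ, hδ, h⟩ := S.exists_ham_perturb_small j n hη
  obtain ⟨δ', hδ', h'⟩ := S.exists_flow_perturb_small j n T hη
  exact ⟨min δ δ', by positivity, fun c hc =>
    ⟨h c (hc.trans (min_le_left _ _)), h' c (hc.trans (min_le_right _ _))⟩⟩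

theorem mem_zone_iff (j : ℤ) (s a b : ℝ) : s ∈ Icc (a / 4 ^ j) (b / 4 ^ j) ↔
    4 ^ j * s ∈ Icc a b := by
  have hp : (0 : ℝ) < 4 ^ j := by positivity
  simp only [mem_Icc, div_le_iff₀ hp, le_div_iff₀ hp, mul_comm s]

/-- At a resonance, the conjugation of a stage can be modified without changing its Hamiltonian. -/
theorem exists_conj (S : Stage q ω₀) (j : ℤ) {k : Fin d → ℤ} (hk : k ≠ 0) (hkq : k q = 0)
    (hres : ∀ s, 4 ^ j * s ∈ Icc (1 / 2 : ℝ) 4 → ∑ i, (k i : ℝ) * S.w s i = 0) {ε M : ℝ}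
    (hε : 0 < ε) :
    ∃ (S' : Stage q ω₀) (f : Phase d ≃ Phase d), S'.w = S.w ∧ S'.e = f.trans S.e ∧
      S'.ham = S.ham ∧ (∀ t z, S'.flow t z = S.flow t z) ∧
      (∀ z i, action i z = 0 → f z = z) ∧
      (∀ z, ∃ u : ℝ, ∀ i, action i (f z) = action i z + k i * u) ∧
      ∀ σ : ℝ, (σ = 1 ∨ σ = -1) → ∀ y, (resMonomial k y).re = 0 → 0 < σ * (resMonomial k y).im →
        4 ^ j * action q y ∈ Icc (3 / 4 : ℝ) (7 / 2) → (∀ i, action i y ≠ 0) →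
        ∃ u : ℝ, 0 ≤ σ * u ∧ (∀ i, action i (f y) = action i y + k i * u) ∧
          ∀ (r : Fin d → ℝ) (u₀ : ℝ), 0 ≤ σ * u₀ → (∀ i, r i ∈ Icc ε M) →
            (∀ i, action i y = r i + k i * u₀) → ∃ i, action i (f y) ∉ Icc ε M := by
  have hp : (0 : ℝ) < 4 ^ j := by positivity
  obtain ⟨f, hf, hfb, hfz, hfm, hfp⟩ := exists_push (M := M) (z₁ := (1 / 2) / 4 ^ j)
    (c₁ := (3 / 4) / 4 ^ j) (c₂ := (7 / 2) / 4 ^ j) (z₂ := 4 / 4 ^ j) q k hk hkq hε (by positivity)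
    (div_lt_div_of_pos_right (by norm_num) hp) (div_lt_div_of_pos_right (by norm_num) hp)
  simp only [mem_zone_iff] at hfz hfp
  have hq : ∀ z, action q (f z) = action q z := by
    intro z
    obtain ⟨u, hu⟩ := hfm z
    rw [hu, hkq]; simp
  -- At fixed r_q the function h is linear in the actions with coefficients `w(r_q)`. In the zone
  -- these are orthogonal to the displacement direction `k`; elsewhere f is the identity.
  have hham : ∀ z, freqHam q S.w (f z) = freqHam q S.w z := by
    intro z
    by_cases hz : 4 ^ j * action q z ∈ Icc (1 / 2 : ℝ) 4
    · obtain ⟨u, hu⟩ := hfm z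
      have h1 := hres _ hz
      simp only [freqHam, hq, hu, mul_add, Finset.sum_add_distrib]
      have : ∑ i, S.w (action q z) i * ((k i : ℝ) * u) =
          u * ∑ i, (k i : ℝ) * S.w (action q z) i := by
        rw [Finset.mul_sum]
        exact Finset.sum_congr rfl fun i _ => by ring
      rw [this, h1, mul_zero, add_zero]
    · rw [hfz z hz]
  let S' : Stage q ω₀ :=
    { w := S.w
      e := f.trans S.e
      isFreq := S.isFreq
      symp := hf.trans S.symp
      action_e := fun z => by rw [Equiv.trans_apply, S.action_e, hq]
      e_boundary := fun z i hz => by rw [Equiv.trans_apply, hfb z i hz, S.e_boundary z i hz]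
      e_near := by
        obtain ⟨s₀, h0, h⟩ := S.e_near
        refine ⟨min s₀ ((1 / 2) / 4 ^ j), by positivity, fun z hz => ?_⟩
        have : f z = z := by
          refine hfz z fun hz' => ?_
          have h1 := hz.trans_le (min_le_right _ _)
          rw [lt_div_iff₀ hp] at h1
          linarith [hz'.1]
        rw [Equiv.trans_apply, this, h z (hz.trans_le (min_le_left _ _))] }
  have hhamS : S'.ham = S.ham := by
    funext z
    have := hham (f.symm (S.e.symm z))
    rw [f.apply_symm_apply] at this
    exact this.symm
  refine ⟨S', f, rfl, rfl, hhamS, fun t z => ?_, hfb, hfm, hfp⟩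
  exact IsHamFlow.unique S'.contDiff_ham S'.isHamFlow (hhamS ▸ S.isHamFlow) t z

end Stage

/-- The angle `t * l` is taken so as to turn Z onto σ |Z| times the imaginary unit; its
representative modulo 2π is chosen right after `a * l`. -/
theorem exists_time_phase {Z : ℂ} (hZ : Z ≠ 0) {l : ℝ} (hl : 0 < l) (a : ℝ) {σ : ℝ}
    (hσ : σ = 1 ∨ σ = -1) :
    ∃ t : ℝ, a ≤ t ∧ t ≤ a + 2 * Real.pi / l ∧
      (Complex.exp (-((t * l : ℝ) : ℂ) * Complex.I) * Z).re = 0 ∧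
      0 < σ * (Complex.exp (-((t * l : ℝ) : ℂ) * Complex.I) * Z).im := by
  obtain ⟨m, hm, -⟩ := existsUnique_add_zsmul_mem_Ico Real.two_pi_pos
    (Complex.arg Z - σ * (Real.pi / 2)) (a * l)
  set θ := Complex.arg Z - σ * (Real.pi / 2) + m • (2 * Real.pi) with hθ
  have htl : θ / l * l = θ := div_mul_cancel₀ _ hl.ne'
  have key : Complex.exp (-((θ / l * l : ℝ) : ℂ) * Complex.I) * Z = ‖Z‖ * (σ * Complex.I) := by
    rw [htl]
    conv_lhs => rw [← Complex.norm_mul_exp_arg_mul_I Z]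
    rw [mul_left_comm, ← Complex.exp_add]
    congr 1
    have : -(θ : ℂ) * Complex.I + Complex.arg Z * Complex.I =
        ((σ * (Real.pi / 2) : ℝ) : ℂ) * Complex.I - m * (2 * Real.pi * Complex.I) := by
      rw [hθ]; simp only [zsmul_eq_mul]; push_cast; ring
    rw [this, Complex.exp_sub, Complex.exp_int_mul_two_pi_mul_I, div_one]
    rcases hσ with h | h
    · rw [h, one_mul]; push_cast; rw [Complex.exp_pi_div_two_mul_I]; simp
    · rw [h]
      have : ((-1 * (Real.pi / 2) : ℝ) : ℂ) * Complex.I = -(Real.pi / 2 * Complex.I) := by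
        push_cast; ring
      rw [this, Complex.exp_neg, Complex.exp_pi_div_two_mul_I]; simp
  refine ⟨θ / l, ?_, ?_, ?_, ?_⟩
  · rw [le_div_iff₀ hl]; exact hm.1
  · rw [div_le_iff₀ hl, add_mul, div_mul_cancel₀ _ hl.ne']; exact hm.2.le
  · rw [key]; simp
  · rw [key]
    have hσ2 : σ * σ = 1 := by rcases hσ with h | h <;> rw [h] <;> norm_num
    have : σ * ((‖Z‖ : ℂ) * (σ * Complex.I)).im = ‖Z‖ * (σ * σ) := by simp; ring
    rw [this, hσ2, mul_one]
    exact norm_pos_iff.2 hZ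

end States

end

noncomputable section

/-! ### The inductive steps: escape and diffusion. -/

section Steps

open Set Filter

variable {d : ℕ}

/-- `freq` differs from `w` at the index `q` only, where `k` vanishes, so derivatives of `w` do not
affect the speed of Z^k. -/
theorem sum_mul_freq {q : Fin d} {k : Fin d → ℤ} (hkq : k q = 0) (w : ℝ → Fin d → ℝ) (z : Phase d) :
    ∑ i, (k i : ℝ) * freq q w z i = ∑ i, (k i : ℝ) * w (action q z) i := by
  refine Finset.sum_congr rfl fun i _ => ?_
  by_cases hi : i = q
  · rw [hi, hkq]; simp
  · simp [freq, hi]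

theorem resMonomial_freqFlow {q : Fin d} {k : Fin d → ℤ} (hkq : k q = 0) {w : ℝ → Fin d → ℝ}
    {z : Phase d} {l : ℝ} (hl : ∑ i, (k i : ℝ) * w (action q z) i = l) (t : ℝ) :
    resMonomial k (freqFlow q w t z) =
      Complex.exp (-((t * l : ℝ) : ℂ) * Complex.I) * resMonomial k z := by
  have : ∑ i, (k i : ℝ) * (t • freq q w z) i = t * l := by
    rw [← hl, ← sum_mul_freq hkq, Finset.mul_sum]
    exact Finset.sum_congr rfl fun i _ => by simp only [Pi.smul_apply, smul_eq_mul]; ring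
  rw [freqFlow, resMonomial_rotate, this]

namespace Stage

variable {q : Fin d} {ω₀ : Fin d → ℝ}

/-- The Hamiltonians and flows of two stages are close. -/
def Close (n : ℕ) (T η : ℝ) (S S' : Stage q ω₀) : Prop :=
  SmallOn n η (fun z => S'.ham z - S.ham z) ∧
    ∀ t z, |t| ≤ T → ‖z‖ ≤ n → ‖S'.flow t z - S.flow t z‖ ≤ η

theorem Close.trans {n : ℕ} {T η η' : ℝ} {S S' S'' : Stage q ω₀} (h : Close n T η S S')
    (h' : Close n T η' S' S'') : Close n T (η + η') S S'' := by
  refine ⟨?_, fun t z ht hz => ?_⟩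
  · have := h.1.add h'.1
    have e : (fun z => S''.ham z - S.ham z) =
        fun z => S'.ham z - S.ham z + (S''.ham z - S'.ham z) := by funext z; ring
    rw [e]; exact this
  · have e : S''.flow t z - S.flow t z =
        (S'.flow t z - S.flow t z) + (S''.flow t z - S'.flow t z) := by abel
    rw [e]
    exact (norm_add_le _ _).trans (add_le_add (h.2 t z ht hz) (h'.2 t z ht hz))

/-- A small perturbation reaches the resonance, where the conjugation costs nothing; a second one
leaves it in the direction `k`. The latter is sized after f is known, so f may be arbitrarily large,
at the price of a possibly tiny speed `l`. The predicate `P` transmits the sign condition needed for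
diffusion. -/
theorem exists_resonant_step (S : Stage q ω₀) (j : ℤ) (n : ℕ) (T : ℝ) {P : (Fin d → ℤ) → Prop}
    (hres : ∀ δ : ℝ, 0 < δ → ∃ (c : (Fin d → ℝ) × (Fin d → ℝ)) (k : Fin d → ℤ), ‖c‖ ≤ δ ∧ k ≠ 0 ∧
      k q = 0 ∧ P k ∧ ∀ s, 4 ^ j * s ∈ Icc (1 / 2 : ℝ) 4 →
        ∑ i, (k i : ℝ) * _root_.perturb S.w j c s i = 0)
    {ε M : ℝ} (hε : 0 < ε) :
    ∃ (S' : Stage q ω₀) (f : Phase d ≃ Phase d) (k : Fin d → ℤ) (l : ℝ), P k ∧ k q = 0 ∧ 0 < l ∧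
      Close n T ((1 / 2) ^ n) S S' ∧ S'.e = f.trans S.e ∧
      (∀ s, 4 ^ j * s ∈ Icc (1 / 2 : ℝ) 4 → ∑ i, (k i : ℝ) * S'.w s i = l) ∧
      (∀ z i, action i z = 0 → f z = z) ∧
      (∀ z, ∃ u : ℝ, ∀ i, action i (f z) = action i z + k i * u) ∧
      ∀ σ : ℝ, (σ = 1 ∨ σ = -1) → ∀ y, (resMonomial k y).re = 0 → 0 < σ * (resMonomial k y).im →
        4 ^ j * action q y ∈ Icc (3 / 4 : ℝ) (7 / 2) → (∀ i, action i y ≠ 0) →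
        ∃ u : ℝ, 0 ≤ σ * u ∧ (∀ i, action i (f y) = action i y + k i * u) ∧
          ∀ (r : Fin d → ℝ) (u₀ : ℝ), 0 ≤ σ * u₀ → (∀ i, r i ∈ Icc ε M) →
            (∀ i, action i y = r i + k i * u₀) → ∃ i, action i (f y) ∉ Icc ε M := by
  have hη : (0 : ℝ) < (1 / 2) ^ n / 2 := by positivity
  obtain ⟨δ, hδ, hsmall⟩ := S.exists_perturb_small j n T hη
  obtain ⟨c, k, hc, hk, hkq, hP, hzone⟩ := hres δ hδ
  obtain ⟨S₁, f, hw, he, hham, hflow, hfb, hfm, hfp⟩ :=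
    (S.perturb j c).exists_conj j hk hkq hzone (M := M) hε
  have hclose : Close n T ((1 / 2) ^ n / 2) S S₁ := by
    have := hsmall c hc
    refine ⟨by rw [hham]; exact this.1, fun t z ht hz => by rw [hflow]; exact this.2 t z ht hz⟩
  obtain ⟨δ', hδ', hsmall'⟩ := S₁.exists_perturb_small j n T hη
  let kr : Fin d → ℝ := fun i => k i
  have hkr : kr ≠ 0 := fun h => hk (funext fun i => by
    have := congrFun h i; simpa [kr] using this)
  have hkn : 0 < ‖kr‖ := norm_pos_iff.2 hkr
  have hksq : 0 < ∑ i, (k i : ℝ) * (k i : ℝ) := by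
    obtain ⟨i, hi⟩ : ∃ i, k i ≠ 0 := by
      by_contra h; push Not at h; exact hk (funext h)
    refine Finset.sum_pos' (fun i _ => mul_self_nonneg _) ⟨i, Finset.mem_univ i, ?_⟩
    exact mul_self_pos.2 (by exact_mod_cast hi)
  -- Using ρ k for both vectors adds exactly ρ k to the curve on the whole zone, so the speed of Z^k
  -- becomes ρ |k|², constant and positive there.
  set ρ := δ' / ‖kr‖ with hρ
  have hρ0 : 0 < ρ := by positivity
  have hnorm : ‖((ρ • kr, ρ • kr) : (Fin d → ℝ) × (Fin d → ℝ))‖ ≤ δ' := by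
    rw [Prod.norm_def, max_self, norm_smul, Real.norm_of_nonneg hρ0.le, hρ,
      div_mul_cancel₀ _ hkn.ne']
  have hclose' := hsmall' _ hnorm
  refine ⟨S₁.perturb j (ρ • kr, ρ • kr), f, k, ρ * ∑ i, (k i : ℝ) * (k i : ℝ), hP, hkq,
    mul_pos hρ0 hksq, ?_, he, fun s hs => ?_, hfb, hfm, hfp⟩
  · have := hclose.trans (S'' := S₁.perturb j (ρ • kr, ρ • kr)) hclose'
    rwa [add_halves] at this
  · have h1 : (S₁.perturb j (ρ • kr, ρ • kr)).w s = S₁.w s + ρ • kr := by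
      change _root_.perturb S₁.w j (ρ • kr, ρ • kr) s = _
      rw [_root_.perturb, ← add_smul, zoneFun_add hs, one_smul]
    have h2 := hzone s hs
    rw [h1, hw]
    change ∑ i, (k i : ℝ) * (_root_.perturb S.w j c s i + ρ * k i) = _
    simp only [mul_add, Finset.sum_add_distrib, h2, zero_add, Finset.mul_sum]
    exact Finset.sum_congr rfl fun i _ => by ring

theorem core_subset {x : ℝ} (h : x ∈ Icc (3 / 4 : ℝ) (7 / 2)) : x ∈ Icc (1 / 2 : ℝ) 4 :=
  ⟨by linarith [h.1], by linarith [h.2]⟩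

/-- A compact exhaustion of the set where no action vanishes. -/
def inner (d n : ℕ) : Set (Phase d) := {z | ‖z‖ ≤ n ∧ ∀ i, 1 / ((n : ℝ) + 1) ≤ action i z}

theorem isCompact_inner (d n : ℕ) : IsCompact (inner d n) := by
  have hcl : IsClosed (inner d n) := by
    have : inner d n = Metric.closedBall 0 n ∩ ⋂ i, action i ⁻¹' Ici (1 / ((n : ℝ) + 1)) := by
      ext z; simp [inner]
    rw [this]
    exact Metric.isClosed_closedBall.inter
      (isClosed_iInter fun i => isClosed_Ici.preimage (continuous_action i))
  exact (isCompact_closedBall (0 : Phase d) n).of_isClosed_subset hcl fun z hz => by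
    simpa using hz.1

theorem exists_action_box (hd : 0 < d) {K : Set (Phase d)} (hK : IsCompact K)
    (hpos : ∀ z ∈ K, ∀ i, 0 < action i z) :
    ∃ ε M : ℝ, 0 < ε ∧ ∀ z ∈ K, ∀ i, action i z ∈ Icc ε M := by
  rcases K.eq_empty_or_nonempty with rfl | hne
  · exact ⟨1, 1, one_pos, fun z hz => absurd hz (notMem_empty z)⟩
  have : Nonempty (Fin d) := ⟨⟨0, hd⟩⟩
  choose zmin hz1 hz2 using fun i => hK.exists_isMinOn hne (continuous_action i).continuousOn
  choose zmax hy1 hy2 using fun i => hK.exists_isMaxOn hne (continuous_action i).continuousOn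
  refine ⟨Finset.univ.inf' Finset.univ_nonempty fun i => action i (zmin i),
    Finset.univ.sup' Finset.univ_nonempty fun i => action i (zmax i), ?_, fun z hz i => ⟨?_, ?_⟩⟩
  · rw [Finset.lt_inf'_iff]
    exact fun i _ => hpos _ (hz1 i) i
  · exact (Finset.inf'_le _ (Finset.mem_univ i)).trans (hz2 i hz)
  · exact le_trans (hy2 i hz) (Finset.le_sup' (fun i => action i (zmax i)) (Finset.mem_univ i))

/-- A small change of a stage after which all orbits starting in a given compact part of the
interior leave it, at large times. -/
theorem exists_escape_step (hd : 4 ≤ d) (S : Stage q ω₀) (j : ℤ) (n : ℕ) (T : ℝ) :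
    ∃ (S' : Stage q ω₀) (T' : ℝ), T ≤ T' ∧ (n : ℝ) ≤ T' ∧ Close n T ((1 / 2) ^ n) S S' ∧
      ∀ z ∈ inner d n, 4 ^ j * action q z ∈ Icc (3 / 4 : ℝ) (7 / 2) →
        ∃ t : ℝ, n ≤ t ∧ t ≤ T' ∧ S'.flow t z ∉ inner d n := by
  obtain ⟨a, b, hab⟩ := S.isFreq.zone j
  have hres : ∀ δ : ℝ, 0 < δ → ∃ (c : (Fin d → ℝ) × (Fin d → ℝ)) (k : Fin d → ℤ), ‖c‖ ≤ δ ∧ k ≠ 0 ∧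
      k q = 0 ∧ True ∧ ∀ s, 4 ^ j * s ∈ Icc (1 / 2 : ℝ) 4 →
        ∑ i, (k i : ℝ) * _root_.perturb S.w j c s i = 0 := by
    intro δ hδ
    obtain ⟨c, k, hc, hk, hkq, h1, h2⟩ := exists_resonance hd q a b hδ
    refine ⟨c, k, hc, hk, hkq, trivial, fun s hs => ?_⟩
    have : ∀ i, (k i : ℝ) * _root_.perturb S.w j c s i = zoneFun j s * ((k i : ℝ) * (a i + c.1 i)) +
        zoneFun (j + 1) s * ((k i : ℝ) * (b i + c.2 i)) := by
      intro i
      simp only [_root_.perturb, hab s hs, Pi.add_apply, Pi.smul_apply, smul_eq_mul]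
      ring
    rw [Finset.sum_congr rfl fun i _ => this i, Finset.sum_add_distrib, ← Finset.mul_sum,
      ← Finset.mul_sum, h1, h2, mul_zero, mul_zero, add_zero]
  -- The box of actions is taken in the coordinates before conjugation; there the compact set still
  -- avoids every {r_i = 0}, because e fixes these sets pointwise.
  set K := S.e.symm '' inner d n with hKdef
  have hK : IsCompact K := (isCompact_inner d n).image S.symp.contDiff_symm.continuous
  have hKpos : ∀ z ∈ K, ∀ i, 0 < action i z := by
    rintro z ⟨y, hy, rfl⟩ i
    refine lt_of_le_of_ne (action_nonneg _ _) fun h => ?_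
    have h1 := S.e_boundary _ i h.symm
    rw [S.e.apply_symm_apply] at h1
    have h2 := hy.2 i
    rw [h1, ← h] at h2
    have : (0 : ℝ) < 1 / ((n : ℝ) + 1) := by positivity
    linarith
  obtain ⟨ε, M, hε, hbox⟩ := exists_action_box (by omega) hK hKpos
  obtain ⟨S', f, k, l, -, hkq, hl, hclose, he, hw, hfb, hfm, hfp⟩ :=
    S.exists_resonant_step j n T hres (M := M) hε
  refine ⟨S', max T (n + 2 * Real.pi / l), le_max_left _ _, le_max_of_le_right (by
    have := Real.pi_pos; have : 0 < 2 * Real.pi / l := by positivity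
    linarith), hclose, fun z hz hzone => ?_⟩
  set x := S.e.symm z with hx
  have hxK : x ∈ K := mem_image_of_mem _ hz
  set y := f.symm x with hy
  have hfy : f y = x := f.apply_symm_apply x
  obtain ⟨u, hu⟩ := hfm y
  rw [hfy] at hu
  have hqy : action q y = action q z := by
    have := hu q
    rw [hkq, S.action_symm] at this
    simpa using this.symm
  have hyint : ∀ i, action i y ≠ 0 := by
    intro i hi
    have h1 := hfb y i hi
    rw [hfy] at h1
    rw [← h1] at hi
    exact (hKpos x hxK i).ne' hi
  -- Passing from x to y = f⁻¹ x displaces the actions by -u along `k`. The sign is chosen so that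
  -- the second push continues this displacement instead of undoing it.
  obtain ⟨σ, hσ, hσu⟩ : ∃ σ : ℝ, (σ = 1 ∨ σ = -1) ∧ 0 ≤ σ * (-u) := by
    rcases le_total u 0 with h | h
    · exact ⟨1, Or.inl rfl, by linarith⟩
    · exact ⟨-1, Or.inr rfl, by linarith⟩
  have hly : ∑ i, (k i : ℝ) * S'.w (action q y) i = l := by
    rw [hqy]; exact hw _ (core_subset hzone)
  obtain ⟨t, ht1, ht2, hre, him⟩ := exists_time_phase (resMonomial_ne_zero (k := k) hyint) hl n hσ
  rw [← resMonomial_freqFlow hkq hly] at hre him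
  obtain ⟨v, -, -, hout⟩ := hfp σ hσ _ hre him (by rw [action_freqFlow, hqy]; exact hzone)
    (fun i => by rw [action_freqFlow]; exact hyint i)
  obtain ⟨i, hi⟩ := hout (fun i => action i x) (-u) hσu (hbox x hxK) (fun i => by
    rw [action_freqFlow]; simp only [hu i]; ring)
  refine ⟨t, ht1, ht2.trans (le_max_right _ _), fun hmem => hi ?_⟩
  have hflow : S'.flow t z = S.e (f (freqFlow q S'.w t y)) := by
    simp only [flow, he, Equiv.symm_trans_apply, Equiv.trans_apply, hy, hx]
  rw [hflow] at hmem
  refine hbox _ ⟨_, hmem, S.e.symm_apply_apply _⟩ i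

/-- A small change of a stage after which some orbit visits both a small and a large ball. -/
theorem exists_diffusion_step {i₀ j₀ : Fin d} (hi : i₀ ≠ q) (hj : j₀ ≠ q) (hωi : ω₀ i₀ < 0)
    (hωj : 0 < ω₀ j₀) (S : Stage q ω₀) (n : ℕ) (T : ℝ) :
    ∃ (S' : Stage q ω₀) (T' : ℝ), T ≤ T' ∧ (n : ℝ) ≤ T' ∧ Close n T ((1 / 2) ^ n) S S' ∧
      ∃ (p : Phase d) (t : ℝ), ‖p‖ ≤ 1 / ((n : ℝ) + 1) ∧ |t| ≤ T' ∧ n ≤ ‖S'.flow t p‖ := by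
  obtain ⟨s₁, hs₁, hw₁⟩ := S.isFreq.near_zero
  obtain ⟨s₂, hs₂, he₂⟩ := S.e_near
  -- A zone so low that `w = ω₀` and e is the identity there, and that actions at most ρ force a
  -- norm at most 1/(n+1).
  set κ := min (min s₁ s₂) (1 / (((n : ℝ) + 1) ^ 2)) with hκ
  have hκ0 : 0 < κ := by positivity
  obtain ⟨j', hj'⟩ := exists_pow_lt_of_lt_one (show 0 < κ / 8 by positivity)
    (show (1 / 4 : ℝ) < 1 by norm_num)
  obtain ⟨j, hjdef⟩ : ∃ j : ℤ, j = (j' : ℤ) := ⟨_, rfl⟩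
  have hp : (0 : ℝ) < 4 ^ j := by positivity
  set ρ : ℝ := 1 / 4 ^ j with hρ
  have hρ0 : 0 < ρ := by positivity
  have hρj : 4 ^ j * ρ = 1 := mul_one_div_cancel hp.ne'
  have hρκ : 8 * ρ < κ := by
    have : ρ = (1 / 4) ^ j' := by rw [hρ, hjdef, zpow_natCast, one_div_pow]
    rw [this]; linarith
  have hκ1 : κ ≤ s₁ := (min_le_left _ _).trans (min_le_left _ _)
  have hκ2 : κ ≤ s₂ := (min_le_left _ _).trans (min_le_right _ _)
  have hκ3 : κ ≤ 1 / ((n : ℝ) + 1) ^ 2 := min_le_right _ _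
  have hres : ∀ δ : ℝ, 0 < δ → ∃ (c : (Fin d → ℝ) × (Fin d → ℝ)) (k : Fin d → ℤ), ‖c‖ ≤ δ ∧ k ≠ 0 ∧
      k q = 0 ∧ (∀ i, 0 ≤ k i) ∧ ∀ s, 4 ^ j * s ∈ Icc (1 / 2 : ℝ) 4 →
        ∑ i, (k i : ℝ) * _root_.perturb S.w j c s i = 0 := by
    intro δ hδ
    obtain ⟨c, k, hc, hk, hkq, hk0, h⟩ := exists_nonneg_resonance hi hj ω₀ hωi hωj hδ
    refine ⟨(c, c), k, by rwa [Prod.norm_def, max_self], hk, hkq, hk0, fun s hs => ?_⟩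
    have hs' : s < s₁ := by
      have h1 : s ≤ 4 * ρ := by
        have : 4 ^ j * s ≤ 4 ^ j * (4 * ρ) := by
          have : (4 : ℝ) ^ j * (4 * ρ) = 4 := by linear_combination 4 * hρj
          rw [this]; exact hs.2
        exact le_of_mul_le_mul_left this hp
      linarith
    have : _root_.perturb S.w j (c, c) s = ω₀ + c := by
      rw [_root_.perturb, hw₁ s hs', ← add_smul, zoneFun_add hs, one_smul]
    rw [this]; exact h
  -- The starting actions all equal ρ, the lower corner of the box. As `k` is nonnegative, an upward
  -- push can leave only through an upper face, where some action exceeds n² and the norm exceeds n.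
  obtain ⟨S', f, k, l, hk0, hkq, hl, hclose, he, hw, hfb, hfm, hfp⟩ :=
    S.exists_resonant_step j n T hres (ε := ρ) (M := ρ + (n : ℝ) ^ 2) hρ0
  let y₀ : Phase d := (fun _ => Real.sqrt (2 * ρ), 0)
  have hy₀ : ∀ i, action i y₀ = ρ := by
    intro i
    simp only [action, y₀, Pi.zero_apply]
    rw [Real.sq_sqrt (by positivity)]; ring
  have hcore : 4 ^ j * ρ ∈ Icc (3 / 4 : ℝ) (7 / 2) := by rw [hρj]; constructor <;> norm_num
  have hl' : ∀ y, action q y = ρ → ∑ i, (k i : ℝ) * S'.w (action q y) i = l := fun y hy => by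
    rw [hy]; exact hw _ (core_subset hcore)
  have hne : ∀ y : Phase d, (∀ i, action i y = ρ) → ∀ i, action i y ≠ 0 := fun y hy i => by
    rw [hy i]; exact hρ0.ne'
  -- the lower point
  obtain ⟨t₁, -, -, hre₁, him₁⟩ := exists_time_phase
    (resMonomial_ne_zero (k := k) (hne y₀ hy₀)) hl 0 (Or.inr rfl : (-1 : ℝ) = 1 ∨ (-1 : ℝ) = -1)
  rw [← resMonomial_freqFlow hkq (hl' y₀ (hy₀ q))] at hre₁ him₁
  set y₁ := freqFlow q S'.w t₁ y₀ with hy₁def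
  have hy₁ : ∀ i, action i y₁ = ρ := fun i => by rw [hy₁def, action_freqFlow, hy₀]
  obtain ⟨u, hu, hfu, -⟩ := hfp (-1) (Or.inr rfl) y₁ hre₁ him₁ (by rw [hy₁]; exact hcore)
    (hne y₁ hy₁)
  -- the upper point
  obtain ⟨t, ht1, ht2, hre₂, him₂⟩ := exists_time_phase
    (resMonomial_ne_zero (k := k) (hne y₁ hy₁)) hl 0 (Or.inl rfl : (1 : ℝ) = 1 ∨ (1 : ℝ) = -1)
  rw [← resMonomial_freqFlow hkq (hl' y₁ (hy₁ q))] at hre₂ him₂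
  set y₂ := freqFlow q S'.w t y₁ with hy₂def
  have hy₂ : ∀ i, action i y₂ = ρ := fun i => by rw [hy₂def, action_freqFlow, hy₁]
  obtain ⟨v, hv, hfv, hout⟩ := hfp 1 (Or.inl rfl) y₂ hre₂ him₂ (by rw [hy₂]; exact hcore)
    (hne y₂ hy₂)
  have hSe : ∀ z, action q z = ρ → S.e z = z := fun z hz => he₂ z (by rw [hz]; linarith)
  have hqf : ∀ y, action q y = ρ → action q (f y) = ρ := by
    intro y hy
    obtain ⟨u, hu⟩ := hfm y
    rw [hu, hkq, hy]; simp
  have hk0' : ∀ i, (0 : ℝ) ≤ k i := fun i => by exact_mod_cast hk0 i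
  refine ⟨S', max (max T n) (2 * Real.pi / l), (le_max_left _ _).trans (le_max_left _ _),
    (le_max_right _ _).trans (le_max_left _ _), hclose, S'.e y₁, t, ?_, ?_, ?_⟩
  · rw [he, Equiv.trans_apply, hSe _ (hqf _ (hy₁ q))]
    refine norm_le_of_action_le (by positivity) fun i => ?_
    have h1 : (k i : ℝ) * u ≤ 0 := mul_nonpos_of_nonneg_of_nonpos (hk0' i) (by linarith)
    rw [hfu, hy₁, div_pow, one_pow]
    linarith
  · rw [abs_of_nonneg ht1]
    exact (by linarith : t ≤ 2 * Real.pi / l).trans (le_max_right _ _)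
  · have hflow : S'.flow t (S'.e y₁) = f y₂ := by
      rw [flow, Equiv.symm_apply_apply, he, Equiv.trans_apply, hSe _ (hqf _ (hy₂ q))]
    obtain ⟨i, hi⟩ := hout (fun _ => ρ) 0 (by simp) (fun i => ⟨le_rfl, by
      have : (0 : ℝ) ≤ (n : ℝ) ^ 2 := by positivity
      linarith⟩) (fun i => by rw [hy₂]; simp)
    have h1 : 0 ≤ (k i : ℝ) * v := mul_nonneg (hk0' i) (by linarith)
    have h2 : ρ + (n : ℝ) ^ 2 < action i (f y₂) := by
      by_contra hle
      exact hi ⟨by rw [hfv, hy₂]; linarith, not_lt.1 hle⟩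
    rw [hflow]
    have h3 := action_le_norm_sq i (f y₂)
    exact le_of_sq_le_sq (by linarith) (norm_nonneg _)

theorem close_refl (S : Stage q ω₀) (n : ℕ) (T : ℝ) {η : ℝ} (hη : 0 ≤ η) : Close n T η S S := by
  refine ⟨?_, fun t z _ _ => by simpa using hη⟩
  simpa using (smallOn_zero (E := Phase d) n).mono hη

/-- An enumeration of the zones in which each zone occurs infinitely often. -/
def zoneIndex (n : ℕ) : ℤ := Denumerable.ofNat ℤ (Nat.unpair n).1

theorem exists_zoneIndex_eq (j : ℤ) (N : ℕ) : ∃ n ≥ N, zoneIndex n = j :=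
  ⟨Nat.pair (Encodable.encode j) N, Nat.right_le_pair _ _, by
    rw [zoneIndex, Nat.unpair_pair]; exact Denumerable.ofNat_encode j⟩

/-- Odd indices serve the escape of interior orbits and even ones diffusion; if ω₀ has no opposite
signs, an even step only lengthens the time span. -/
theorem exists_step (hd : 4 ≤ d) (hq : ∀ i j, ω₀ i < 0 → 0 < ω₀ j →
      ∃ i₀ j₀, i₀ ≠ q ∧ j₀ ≠ q ∧ ω₀ i₀ < 0 ∧ 0 < ω₀ j₀) (S : Stage q ω₀) (n : ℕ) (T : ℝ) :
    ∃ (S' : Stage q ω₀) (T' : ℝ), T ≤ T' ∧ (n : ℝ) ≤ T' ∧ Close n T ((1 / 2) ^ n) S S' ∧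
      (Odd n → ∀ z ∈ inner d n, 4 ^ zoneIndex (n / 2) * action q z ∈ Icc (3 / 4 : ℝ) (7 / 2) →
        ∃ t : ℝ, n ≤ t ∧ t ≤ T' ∧ S'.flow t z ∉ inner d n) ∧
      (Even n → (∃ i j, ω₀ i < 0 ∧ 0 < ω₀ j) →
        ∃ (p : Phase d) (t : ℝ), ‖p‖ ≤ 1 / ((n : ℝ) + 1) ∧ |t| ≤ T' ∧ n ≤ ‖S'.flow t p‖) := by
  rcases Nat.even_or_odd n with hn | hn
  · by_cases hmix : ∃ i j, ω₀ i < 0 ∧ 0 < ω₀ j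
    · obtain ⟨i, j, hi, hj⟩ := hmix
      obtain ⟨i₀, j₀, h1, h2, h3, h4⟩ := hq i j hi hj
      obtain ⟨S', T', a1, a2, a3, a4⟩ := S.exists_diffusion_step h1 h2 h3 h4 n T
      exact ⟨S', T', a1, a2, a3, fun ho => absurd hn (Nat.not_even_iff_odd.2 ho), fun _ _ => a4⟩
    · exact ⟨S, max T n, le_max_left _ _, le_max_right _ _, S.close_refl n T (by positivity),
        fun ho => absurd hn (Nat.not_even_iff_odd.2 ho), fun _ h => absurd h hmix⟩
  · obtain ⟨S', T', a1, a2, a3, a4⟩ := S.exists_escape_step hd (zoneIndex (n / 2)) n T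
    exact ⟨S', T', a1, a2, a3, fun _ => a4, fun he => absurd he (Nat.not_even_iff_odd.2 hn)⟩

/-- The sequence of stages. -/
theorem exists_stages (hd : 4 ≤ d) (hq : ∀ i j, ω₀ i < 0 → 0 < ω₀ j →
      ∃ i₀ j₀, i₀ ≠ q ∧ j₀ ≠ q ∧ ω₀ i₀ < 0 ∧ 0 < ω₀ j₀) :
    ∃ (S : ℕ → Stage q ω₀) (T : ℕ → ℝ), S 0 = init q ω₀ ∧ Monotone T ∧ Tendsto T atTop atTop ∧
      (∀ n, Close n (T n) ((1 / 2) ^ n) (S n) (S (n + 1))) ∧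
      (∀ n : ℕ, Odd n → ∀ z ∈ inner d n,
        4 ^ zoneIndex (n / 2) * action q z ∈ Icc (3 / 4 : ℝ) (7 / 2) →
        ∃ t : ℝ, n ≤ t ∧ t ≤ T (n + 1) ∧ (S (n + 1)).flow t z ∉ inner d n) ∧
      (∀ n : ℕ, Even n → (∃ i j, ω₀ i < 0 ∧ 0 < ω₀ j) → ∃ (p : Phase d) (t : ℝ),
        ‖p‖ ≤ 1 / ((n : ℝ) + 1) ∧ |t| ≤ T (n + 1) ∧ n ≤ ‖(S (n + 1)).flow t p‖) := by
  choose nextS nextT h1 h2 h3 h4 h5 using fun (S : Stage q ω₀) (n : ℕ) (T : ℝ) =>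
    exists_step hd hq S n T
  -- The time span is updated together with the stage, so later changes are small over times that
  -- include the excursions just created.
  let seq : ℕ → Stage q ω₀ × ℝ := fun n =>
    Nat.rec (init q ω₀, 0) (fun n p => (nextS p.1 n p.2, nextT p.1 n p.2)) n
  refine ⟨fun n => (seq n).1, fun n => (seq n).2, rfl, monotone_nat_of_le_succ fun n => h1 _ _ _, ?_,
    fun n => h3 _ _ _, fun n => h4 (seq n).1 n (seq n).2, fun n => h5 (seq n).1 n (seq n).2⟩
  rw [← tendsto_add_atTop_iff_nat 1]
  exact tendsto_atTop_mono (fun n => h2 (seq n).1 n (seq n).2) tendsto_natCast_atTop_atTop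

end Stage

end Steps

end

noncomputable section

/-! ### The sets {r = c} as smooth tori with linear flow. -/

section ActionTori

open Set Filter

variable {d : ℕ}

theorem rotate_rotate (a b : Fin d → ℝ) (z : Phase d) :
    rotate a (rotate b z) = rotate (a + b) z := by
  ext j <;> simp only [rotate, Pi.add_apply, Real.cos_add, Real.sin_add] <;> ring

theorem rotate_congr {a b : Fin d → ℝ} {z : Phase d} (h : ∀ j, action j z ≠ 0 → a j = b j) :
    rotate a z = rotate b z := by
  have key : ∀ j, (z.1 j = 0 ∧ z.2 j = 0) ∨ a j = b j := fun j => by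
    by_cases hj : action j z = 0
    · exact Or.inl (action_eq_zero.1 hj)
    · exact Or.inr (h j hj)
  ext j <;> rcases key j with ⟨h1, h2⟩ | h1 <;> simp [rotate, *]

/-- The embedding of the torus `{r = c}`, whose nonzero actions are those in the range of `σ`. -/
def actionTorus {k : ℕ} (c : Fin d → ℝ) (σ : Fin k → Fin d) (θ : Fin k → ℝ) : Phase d :=
  -- The minus sign compensates the clockwise direction of `rotate`, giving the standard angle;
  -- planes outside the range of σ get angle 0.
  rotate (-(2 * Real.pi) • Function.extend σ θ 0) (fun j => √(2 * c j), 0)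

variable {k : ℕ} {c : Fin d → ℝ} {σ : Fin k → Fin d}

theorem action_actionTorus (hc : ∀ j, 0 ≤ c j) (θ : Fin k → ℝ) (j : Fin d) :
    action j (actionTorus c σ θ) = c j := by
  rw [actionTorus, action_rotate]
  have := hc j
  simp only [action, Real.sq_sqrt (show 0 ≤ 2 * c j by linarith), Pi.zero_apply]
  ring

theorem extend_add_smul (σ : Fin k → Fin d) (θ v : Fin k → ℝ) (s : ℝ) :
    Function.extend σ (θ + s • v) 0 = Function.extend σ θ 0 + s • Function.extend σ v 0 := by
  funext j
  by_cases h : ∃ a, σ a = j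
  · simp only [Function.extend_def, dif_pos h, Pi.add_apply, Pi.smul_apply]
  · simp only [Function.extend_apply' _ _ _ h, Pi.add_apply, Pi.smul_apply, Pi.zero_apply, smul_zero,
      add_zero]

theorem actionTorus_add_smul (θ v : Fin k → ℝ) (s : ℝ) :
    actionTorus c σ (θ + s • v) =
      rotate (s • (-(2 * Real.pi) • Function.extend σ v 0)) (actionTorus c σ θ) := by
  rw [actionTorus, actionTorus, rotate_rotate, extend_add_smul, smul_add, add_comm, smul_comm]

theorem contDiff_actionTorus : ContDiff ℝ ∞ (actionTorus c σ) := by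
  have hx : ∀ j, ContDiff ℝ ∞ fun θ : Fin k → ℝ => Function.extend σ θ 0 j := by
    intro j
    by_cases h : ∃ a, σ a = j
    · simp only [Function.extend_def, dif_pos h]
      exact contDiff_apply _ _ _
    · simp only [Function.extend_apply' _ _ _ h]
      exact contDiff_const
  have ha : ∀ j, ContDiff ℝ ∞ fun θ : Fin k → ℝ =>
      (-(2 * Real.pi) • Function.extend σ θ 0) j := fun j => contDiff_const.mul (hx j)
  refine ContDiff.prodMk (contDiff_pi.2 fun j => ?_) (contDiff_pi.2 fun j => ?_)
  · exact (contDiff_const.mul (ha j).cos).add (contDiff_const.mul (ha j).sin)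
  · exact (contDiff_const.mul (ha j).cos).sub (contDiff_const.mul (ha j).sin)

theorem actionTorus_fst (hσ : Function.Injective σ) (θ : Fin k → ℝ) (l : Fin k) :
    (actionTorus c σ θ).1 (σ l) = √(2 * c (σ l)) * Real.cos (2 * Real.pi * θ l) := by
  simp [actionTorus, rotate, hσ.extend_apply]

theorem actionTorus_snd (hσ : Function.Injective σ) (θ : Fin k → ℝ) (l : Fin k) :
    (actionTorus c σ θ).2 (σ l) = √(2 * c (σ l)) * Real.sin (2 * Real.pi * θ l) := by
  simp [actionTorus, rotate, hσ.extend_apply]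

theorem eq_actionTorus_iff (hc : ∀ j, 0 ≤ c j) (hσ : Function.Injective σ)
    (hσc : ∀ j, c j ≠ 0 → j ∈ range σ) {z : Phase d} (hz : ∀ j, action j z = c j) (θ : Fin k → ℝ) :
    z = actionTorus c σ θ ↔ ∀ l, z.1 (σ l) = √(2 * c (σ l)) * Real.cos (2 * Real.pi * θ l) ∧
      z.2 (σ l) = √(2 * c (σ l)) * Real.sin (2 * Real.pi * θ l) := by
  constructor
  · rintro rfl l
    exact ⟨actionTorus_fst hσ θ l, actionTorus_snd hσ θ l⟩
  · intro h
    have key : ∀ j, z.1 j = (actionTorus c σ θ).1 j ∧ z.2 j = (actionTorus c σ θ).2 j := by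
      intro j
      by_cases hj : c j = 0
      · have h1 := action_eq_zero.1 ((hz j).trans hj)
        have h2 := action_eq_zero.1 ((action_actionTorus (σ := σ) hc θ j).trans hj)
        exact ⟨h1.1.trans h2.1.symm, h1.2.trans h2.2.symm⟩
      · obtain ⟨l, rfl⟩ := hσc j hj
        rw [actionTorus_fst hσ, actionTorus_snd hσ]
        exact h l
    ext j
    exacts [(key j).1, (key j).2]

/-- On planes with nonzero action, cosine and sine determine the angle modulo 2π. The derivative
along v is a rotation generator with speeds -2π v, which vanishes only for v = 0. -/
theorem isTorusEmbedding_actionTorus (hc : ∀ j, 0 ≤ c j) (hσ : Function.Injective σ)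
    (hσc : ∀ j, c j ≠ 0 ↔ j ∈ range σ) : IsTorusEmbedding ⊤ (actionTorus c σ) := by
  refine ⟨contDiff_actionTorus, fun θ θ' => ?_, fun θ => ?_⟩
  · rw [eq_actionTorus_iff hc hσ (fun j => (hσc j).1) (action_actionTorus hc θ)]
    simp only [actionTorus_fst hσ, actionTorus_snd hσ]
    constructor
    · intro h
      have : ∀ l, ∃ m : ℤ, θ' l = θ l + m := by
        intro l
        have h0 : √(2 * c (σ l)) ≠ 0 := by
          have h1 := hc (σ l)
          have h2 := (hσc (σ l)).2 ⟨l, rfl⟩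
          have : 0 < c (σ l) := lt_of_le_of_ne h1 h2.symm
          positivity
        obtain ⟨m, hm⟩ := Real.Angle.angle_eq_iff_two_pi_dvd_sub.1
          (Real.Angle.cos_sin_inj (mul_left_cancel₀ h0 (h l).1) (mul_left_cancel₀ h0 (h l).2)).symm
        refine ⟨m, ?_⟩
        have hpi := Real.two_pi_pos.ne'
        apply mul_left_cancel₀ hpi
        linarith
      choose m hm using this
      exact ⟨m, funext hm⟩
    · rintro ⟨m, rfl⟩ l
      have : 2 * Real.pi * (θ + fun j => (m j : ℝ)) l = 2 * Real.pi * θ l + m l * (2 * Real.pi) := by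
        simp only [Pi.add_apply]; ring
      rw [this, Real.cos_add_int_mul_two_pi, Real.sin_add_int_mul_two_pi]
      exact ⟨rfl, rfl⟩
  · rw [injective_iff_map_eq_zero]
    intro v hv
    have h1 : HasDerivAt (fun s : ℝ => actionTorus c σ (θ + s • v))
        (fderiv ℝ (actionTorus c σ) θ v) 0 := by
      have hF := (contDiff_actionTorus (c := c) (σ := σ)).differentiable (by simp) θ
      have hl : HasDerivAt (fun s : ℝ => θ + s • v) v 0 := by
        simpa using ((hasDerivAt_id (0 : ℝ)).smul_const v).const_add θ
      exact hF.hasFDerivAt.comp_hasDerivAt_of_eq 0 hl (by simp)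
    simp only [actionTorus_add_smul] at h1
    have h2 := h1.unique (hasDerivAt_rotate _ (actionTorus c σ θ) 0)
    rw [hv, zero_smul, rotate_zero] at h2
    funext l
    by_contra hl
    apply (hσc (σ l)).2 ⟨l, rfl⟩
    rw [← action_actionTorus (σ := σ) hc θ, action_eq_zero]
    have hne : (-(2 * Real.pi) • Function.extend σ v 0) (σ l) ≠ 0 := by
      simpa [hσ.extend_apply, Real.pi_ne_zero] using hl
    have e1 := congrFun (congrArg Prod.fst h2) (σ l)
    have e2 := congrFun (congrArg Prod.snd h2) (σ l)
    simp only [rotGen, Prod.fst_zero, Prod.snd_zero, Pi.zero_apply, zero_eq_mul, zero_eq_neg] at e1 e2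
    exact ⟨(mul_eq_zero.1 e2).resolve_left hne, e1.resolve_left hne⟩

theorem range_actionTorus (hc : ∀ j, 0 ≤ c j) (hσ : Function.Injective σ)
    (hσc : ∀ j, c j ≠ 0 → j ∈ range σ) : range (actionTorus c σ) = {z | ∀ j, action j z = c j} := by
  ext z
  constructor
  · rintro ⟨θ, rfl⟩ j
    exact action_actionTorus hc θ j
  · intro hz
    let ζ : Fin k → ℂ := fun l => ⟨z.1 (σ l), z.2 (σ l)⟩
    refine ⟨fun l => (ζ l).arg / (2 * Real.pi), ((eq_actionTorus_iff hc hσ hσc hz _).2 fun l => ?_).symm⟩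
    have hn : √(2 * c (σ l)) = ‖ζ l‖ := by
      rw [← hz (σ l), Complex.norm_def, Complex.normSq_apply, action]
      congr 1
      simp only [ζ]; ring
    rw [hn, mul_div_cancel₀ _ Real.two_pi_pos.ne', Complex.norm_mul_cos_arg,
      Complex.norm_mul_sin_arg]
    exact ⟨rfl, rfl⟩

/-- If a flow rotates the points of `{r = r(p)}` at a common speed, that set is a torus carrying
a linear flow. -/
theorem exists_linear_actionTorus {Φ : ℝ → Phase d → Phase d} {i : Fin d} {p : Phase d}
    (hp : action i p = 0) {Ω : Fin d → ℝ}
    (hΩ : ∀ t z, (∀ j, action j z = action j p) → Φ t z = rotate (t • Ω) z) :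
    ∃ k ≤ d - 1, ∃ (ι : (Fin k → ℝ) → Phase d) (α : Fin k → ℝ),
      IsTorusEmbedding ⊤ ι ∧ IsLinearFlowOn Φ ι α ∧
      Set.range ι = {z | ∀ j, action j z = action j p} := by
  classical
  let s : Finset (Fin d) := {j | action j p ≠ 0}
  have hmem : ∀ j, action j p ≠ 0 ↔ j ∈ range (s.orderEmbOfFin rfl) := by
    intro j
    rw [Finset.range_orderEmbOfFin]
    simp [s]
  have hcard : s.card ≤ d - 1 := by
    have : s ⊆ Finset.univ.erase i := by
      intro j hj
      have hj' : action j p ≠ 0 := by simpa [s] using hj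
      rw [Finset.mem_erase]
      exact ⟨fun h => hj' (h ▸ hp), Finset.mem_univ _⟩
    simpa using Finset.card_le_card this
  have hσ : Function.Injective (s.orderEmbOfFin rfl) := (s.orderEmbOfFin rfl).injective
  have hc : ∀ j, 0 ≤ action j p := fun j => action_nonneg j p
  refine ⟨s.card, hcard, actionTorus (fun j => action j p) (s.orderEmbOfFin rfl),
    fun l => -(Ω (s.orderEmbOfFin rfl l) / (2 * Real.pi)), isTorusEmbedding_actionTorus hc hσ hmem,
    fun t θ => ?_, range_actionTorus hc hσ fun j => (hmem j).1⟩
  rw [hΩ t _ (action_actionTorus hc θ), actionTorus_add_smul]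
  refine rotate_congr fun j hj => ?_
  rw [action_actionTorus hc] at hj
  obtain ⟨l, rfl⟩ := (hmem j).1 hj
  simp only [Pi.smul_apply, hσ.extend_apply, smul_eq_mul]
  field_simp

end ActionTori

end

noncomputable section

/-! ### Functions invariant under a nonresonant linear flow. -/

section InvariantFunctions

open UnitAddTorus MeasureTheory

variable {k : ℕ}

theorem mFourier_add_apply (m : Fin k → ℤ) (x y : UnitAddTorus (Fin k)) :
    mFourier m (x + y) = mFourier m x * mFourier m y := by
  simp only [mFourier, ContinuousMap.coe_mk, Pi.add_apply, fourier_apply, smul_add,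
    AddCircle.toCircle_add, Circle.coe_mul, Finset.prod_mul_distrib]

theorem mFourierCoeff_comp_add_right (f : UnitAddTorus (Fin k) → ℂ) (a : UnitAddTorus (Fin k))
    (m : Fin k → ℤ) :
    mFourierCoeff (fun x => f (x + a)) m = mFourier m a * mFourierCoeff f m := by
  rw [mFourierCoeff, mFourierCoeff]
  let _ : MeasureSpace UnitAddCircle := ⟨AddCircle.haarAddCircle⟩
  have _ : Measure.IsAddHaarMeasure (volume : Measure UnitAddCircle) :=
    inferInstanceAs (Measure.IsAddHaarMeasure AddCircle.haarAddCircle)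
  have := integral_add_right_eq_self (μ := (volume : Measure (UnitAddTorus (Fin k))))
    (fun x => mFourier m a * (mFourier (-m) x • f x)) a
  rw [← integral_const_mul]
  refine Eq.trans ?_ this
  congr 1
  funext x
  rw [mFourier_add_apply, mFourier_neg (x := a)]
  simp only [smul_eq_mul]
  have : mFourier m a * (starRingEnd ℂ) (mFourier m a) = 1 := by
    rw [← mFourier_neg, ← mFourier_add, add_neg_cancel, mFourier_zero]; rfl
  linear_combination (-(mFourier (-m) x * f (x + a))) * this

theorem mFourier_coe (m : Fin k → ℤ) (θ : Fin k → ℝ) :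
    mFourier m (fun j => (θ j : UnitAddCircle)) =
      Complex.exp (((2 * Real.pi * ∑ j, (m j : ℝ) * θ j : ℝ) : ℂ) * Complex.I) := by
  simp only [mFourier, ContinuousMap.coe_mk, fourier_coe_apply]
  rw [← Complex.exp_sum]
  congr 1
  push_cast
  rw [Finset.mul_sum, Finset.sum_mul]
  exact Finset.sum_congr rfl fun j _ => by simp; ring

/-- A continuous function on the torus that is invariant under a nonresonant linear flow is
constant. -/
theorem eq_of_nonresonant_invariant {α : Fin k → ℝ} (hα : IsNonresonant α)
    (F : C(UnitAddTorus (Fin k), ℂ))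
    (hF : ∀ (t : ℝ) x, F (x + fun j => ((t * α j : ℝ) : UnitAddCircle)) = F x)
    (x y : UnitAddTorus (Fin k)) : F x = F y := by
  have hcoeff : ∀ m ≠ 0, mFourierCoeff F m = 0 := by
    intro m hm
    obtain ⟨l, hl⟩ : ∃ l, l = ∑ j, (m j : ℝ) * α j := ⟨_, rfl⟩
    have hl0 : l ≠ 0 := hl ▸ hα m hm
    -- At time 1/(2l) the character of index m turns by π, so invariance makes the coefficient equal
    -- to its opposite.
    have h := mFourierCoeff_comp_add_right F (fun j => ((1 / (2 * l) * α j : ℝ) : UnitAddCircle)) m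
    have h1 : (fun x => F (x + fun j => ((1 / (2 * l) * α j : ℝ) : UnitAddCircle))) = F :=
      funext fun x => hF _ x
    have h2 : 2 * Real.pi * ∑ j, (m j : ℝ) * (1 / (2 * l) * α j) = Real.pi := by
      have : ∑ j, (m j : ℝ) * (1 / (2 * l) * α j) = 1 / (2 * l) * l := by
        conv_rhs => rw [hl, Finset.mul_sum, ← hl]
        exact Finset.sum_congr rfl fun j _ => by ring
      rw [this]; field_simp
    rw [h1, mFourier_coe, h2, Complex.exp_pi_mul_I] at h
    linear_combination (1 / 2) * h
  have hs : Summable (mFourierCoeff F) :=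
    summable_of_hasFiniteSupport (Set.Finite.subset (Set.finite_singleton 0) fun m hm => by
      by_contra h; exact hm (hcoeff m h))
  have hval : ∀ x, F x = mFourierCoeff F 0 := by
    intro x
    have h1 := hasSum_mFourier_series_apply_of_summable hs x
    have h2 := hasSum_single (f := fun i => mFourierCoeff F i • mFourier i x) 0
      fun m hm => by simp [hcoeff m hm]
    rw [h1.unique h2, mFourier_zero]
    simp
  rw [hval, hval]

theorem eq_of_nonresonant_periodic {α : Fin k → ℝ} (hα : IsNonresonant α) {f : (Fin k → ℝ) → ℝ}
    (hf : Continuous f) (hper : ∀ θ (m : Fin k → ℤ), f (θ + fun j => (m j : ℝ)) = f θ)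
    (hinv : ∀ (t : ℝ) θ, f (θ + t • α) = f θ) (θ θ' : Fin k → ℝ) : f θ = f θ' := by
  let π : (Fin k → ℝ) → UnitAddTorus (Fin k) := Pi.map fun _ x => (x : UnitAddCircle)
  have hπ : IsOpenQuotientMap π := IsOpenQuotientMap.piMap fun _ => QuotientAddGroup.isOpenQuotientMap_mk
  have hfib : ∀ θ θ', π θ = π θ' → f θ = f θ' := by
    intro θ θ' h
    have : ∀ j, ∃ m : ℤ, θ' j = θ j + m := by
      intro j
      have hj : ((θ' j : ℝ) : UnitAddCircle) = (θ j : ℝ) := (congrFun h j).symm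
      rw [← sub_eq_zero, ← AddCircle.coe_sub, AddCircle.coe_eq_zero_iff] at hj
      obtain ⟨m, hm⟩ := hj
      exact ⟨m, by simp at hm; linarith⟩
    choose m hm using this
    rw [show θ' = θ + fun j => (m j : ℝ) from funext hm, hper]
  let g : UnitAddTorus (Fin k) → ℂ := fun x => f (Function.surjInv hπ.surjective x)
  have hg : ∀ θ, g (π θ) = f θ := fun θ => by
    simp only [g]
    rw [hfib _ θ (Function.surjInv_eq hπ.surjective (π θ))]
  have hgc : Continuous g := by
    rw [hπ.isQuotientMap.continuous_iff]
    have : g ∘ π = fun θ => (f θ : ℂ) := funext hg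
    rw [this]
    exact Complex.continuous_ofReal.comp hf
  have h := eq_of_nonresonant_invariant hα ⟨g, hgc⟩ (fun t x => by
    obtain ⟨θ, rfl⟩ := hπ.surjective x
    have : (π θ + fun j => ((t * α j : ℝ) : UnitAddCircle)) = π (θ + t • α) := by
      funext j; simp [π]
    simp only [ContinuousMap.coe_mk]
    rw [this, hg, hg, hinv]) (π θ) (π θ')
  simp only [ContinuousMap.coe_mk, hg] at h
  exact_mod_cast h

end InvariantFunctions

/-! ### Obstructions to invariant tori. -/

section Obstructions

open Set Filter

variable {d k : ℕ}

/-- By Baire, one action vanishes on an open piece of the torus, whose tangent spaces then lie in a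
symplectic space of dimension 2d - 2, too small for an isotropic space of dimension d. -/
theorem not_isIsotropic_of_action_eq_zero {ι : (Fin d → ℝ) → Phase d} (hι : IsTorusEmbedding 1 ι)
    (hb : ∀ θ, ∃ i, action i (ι θ) = 0) : ¬ IsIsotropic ι := by
  intro hiso
  obtain ⟨hsm, -, himm⟩ := hι
  have hdiff : Differentiable ℝ ι := hsm.differentiable (by simp)
  obtain ⟨i, θ, hθ⟩ := nonempty_interior_of_iUnion_of_closed
    (f := fun i => {θ | action i (ι θ) = 0})
    (fun i => isClosed_eq ((continuous_action i).comp hdiff.continuous) continuous_const)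
    (by ext θ; simpa using hb θ)
  set D := fderiv ℝ ι θ
  have hD : HasFDerivAt ι D θ := (hdiff θ).hasFDerivAt
  have hev : ∀ᶠ x in 𝓝 θ, action i (ι x) = 0 := mem_interior_iff_mem_nhds.1 hθ
  have hx : ∀ u, (D u).1 i = 0 := by
    intro u
    have h1 : HasFDerivAt (fun x => (ι x).1 i) ((coordX i).comp D) θ :=
      (coordX i).hasFDerivAt.comp θ hD
    have h2 : HasFDerivAt (fun x => (ι x).1 i) (0 : (Fin d → ℝ) →L[ℝ] ℝ) θ :=
      (hasFDerivAt_const 0 θ).congr_of_eventuallyEq (hev.mono fun x h => (action_eq_zero.1 h).1)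
    exact DFunLike.congr_fun (h1.unique h2) u
  have hy : ∀ u, (D u).2 i = 0 := by
    intro u
    have h1 : HasFDerivAt (fun x => (ι x).2 i) ((coordY i).comp D) θ :=
      (coordY i).hasFDerivAt.comp θ hD
    have h2 : HasFDerivAt (fun x => (ι x).2 i) (0 : (Fin d → ℝ) →L[ℝ] ℝ) θ :=
      (hasFDerivAt_const 0 θ).congr_of_eventuallyEq (hev.mono fun x h => (action_eq_zero.1 h).2)
    exact DFunLike.congr_fun (h1.unique h2) u
  -- In complex notation this is (u, v) ↦ Du - i Dv. An isotropic image L of D meets iL trivially,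
  -- so M is injective and hence onto, although its component in the i-th plane is zero.
  let M : Phase d →ₗ[ℝ] Phase d :=
    { toFun := fun p => (fun j => (D p.1).1 j + (D p.2).2 j, fun j => (D p.1).2 j - (D p.2).1 j)
      map_add' := fun p p' => by
        ext j <;> simp only [Prod.fst_add, Prod.snd_add, map_add, Pi.add_apply] <;> ring
      map_smul' := fun a p => by
        ext j <;> simp only [Prod.smul_fst, Prod.smul_snd, map_smul, Pi.smul_apply, smul_eq_mul,
          RingHom.id_apply] <;> ring }
  have hM : Function.Injective M := by
    rw [injective_iff_map_eq_zero]
    rintro ⟨u, v⟩ huv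
    have h1 : ∀ j, (D u).1 j + (D v).2 j = 0 := fun j => congrFun (congrArg Prod.fst huv) j
    have h2 : ∀ j, (D u).2 j - (D v).1 j = 0 := fun j => congrFun (congrArg Prod.snd huv) j
    have h3 : ∑ j, ((D v).1 j ^ 2 + (D v).2 j ^ 2) = 0 := by
      have := hiso θ u v
      rw [sympForm] at this
      rw [← neg_eq_zero, ← this, ← Finset.sum_neg_distrib]
      refine Finset.sum_congr rfl fun j _ => ?_
      linear_combination (-(D v).2 j) * h1 j + (D v).1 j * h2 j
    have h4 := (Finset.sum_eq_zero_iff_of_nonneg fun j _ => by positivity).1 h3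
    have h5 : ∀ j, (D v).1 j = 0 ∧ (D v).2 j = 0 := fun j => by
      have := h4 j (Finset.mem_univ j)
      constructor <;> nlinarith [sq_nonneg ((D v).1 j), sq_nonneg ((D v).2 j)]
    have hv : v = 0 := (injective_iff_map_eq_zero D).1 (himm θ) v (by
      ext j
      exacts [(h5 j).1, (h5 j).2])
    have hu : u = 0 := (injective_iff_map_eq_zero D).1 (himm θ) u (by
      ext j
      · have := h1 j; rw [(h5 j).2] at this; simpa using this
      · have := h2 j; rw [(h5 j).1] at this; simpa using this)
    rw [hu, hv]; rfl
  obtain ⟨p, hp⟩ := LinearMap.injective_iff_surjective.1 hM (Pi.single i 1, 0)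
  have h1 : (D p.1).1 i + (D p.2).2 i = 1 :=
    (congrFun (congrArg Prod.fst hp) i).trans (Pi.single_eq_same i 1)
  rw [hx, hy] at h1
  norm_num at h1

/-- Tangent vectors of {r = c} are determined by their angular components, and these vanish where
c_i = 0; no d-dimensional tangent space fits. -/
theorem false_of_action_const {ι : (Fin d → ℝ) → Phase d} (hι : IsTorusEmbedding 1 ι)
    {i : Fin d} (hi : action i (ι 0) = 0) (hconst : ∀ j θ, action j (ι θ) = action j (ι 0)) :
    False := by
  obtain ⟨hsm, -, himm⟩ := hι
  set D := fderiv ℝ ι 0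
  have hD : HasFDerivAt ι D 0 := (hsm.differentiable (by simp) 0).hasFDerivAt
  have hact : ∀ j u, (ι 0).1 j * (D u).1 j + (ι 0).2 j * (D u).2 j = 0 := by
    intro j u
    have h1 := (hasFDerivAt_action j (ι 0)).comp 0 hD
    have h2 : HasFDerivAt (action j ∘ ι) (0 : (Fin d → ℝ) →L[ℝ] ℝ) 0 :=
      (hasFDerivAt_const (action j (ι 0)) 0).congr_of_eventuallyEq (Eventually.of_forall (hconst j))
    simpa [actionDeriv] using DFunLike.congr_fun (h1.unique h2) u
  have hzero : ∀ j u, action j (ι 0) = 0 → (D u).1 j = 0 ∧ (D u).2 j = 0 := by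
    intro j u hj
    have h0 : ∀ x, (ι x).1 j = 0 ∧ (ι x).2 j = 0 := fun x =>
      action_eq_zero.1 ((hconst j x).trans hj)
    have h1 : HasFDerivAt (fun x => (ι x).1 j) ((coordX j).comp D) 0 :=
      (coordX j).hasFDerivAt.comp 0 hD
    have h2 : HasFDerivAt (fun x => (ι x).2 j) ((coordY j).comp D) 0 :=
      (coordY j).hasFDerivAt.comp 0 hD
    simp only [h0] at h1 h2
    exact ⟨DFunLike.congr_fun (h1.unique (hasFDerivAt_const 0 0)) u,
      DFunLike.congr_fun (h2.unique (hasFDerivAt_const 0 0)) u⟩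
  let M : (Fin d → ℝ) →ₗ[ℝ] (Fin d → ℝ) :=
    { toFun := fun u j => (ι 0).2 j * (D u).1 j - (ι 0).1 j * (D u).2 j
      map_add' := fun u u' => by
        ext j; simp only [Prod.fst_add, Prod.snd_add, map_add, Pi.add_apply]; ring
      map_smul' := fun a u => by
        ext j; simp only [Prod.smul_fst, Prod.smul_snd, map_smul, Pi.smul_apply, smul_eq_mul,
          RingHom.id_apply]; ring }
  have hM : Function.Injective M := by
    rw [injective_iff_map_eq_zero]
    intro u hu
    have h1 : ∀ j, (ι 0).2 j * (D u).1 j - (ι 0).1 j * (D u).2 j = 0 := fun j => congrFun hu j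
    have h2 : ∀ j, (D u).1 j = 0 ∧ (D u).2 j = 0 := by
      intro j
      by_cases hj : action j (ι 0) = 0
      · exact hzero j u hj
      · constructor <;> refine (mul_eq_zero.1 ?_).resolve_left hj
        · rw [action]; linear_combination ((ι 0).1 j / 2) * hact j u + ((ι 0).2 j / 2) * h1 j
        · rw [action]; linear_combination ((ι 0).2 j / 2) * hact j u - ((ι 0).1 j / 2) * h1 j
    refine (injective_iff_map_eq_zero D).1 (himm 0) u ?_
    ext j
    exacts [(h2 j).1, (h2 j).2]
  obtain ⟨u, hu⟩ := LinearMap.injective_iff_surjective.1 hM (Pi.single i 1)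
  have h1 : (ι 0).2 i * (D u).1 i - (ι 0).1 i * (D u).2 i = 1 :=
    (congrFun hu i).trans (Pi.single_eq_same i 1)
  rw [(hzero i u hi).1, (hzero i u hi).2] at h1
  norm_num at h1

theorem isCompact_range_of_periodic {X : Type*} [TopologicalSpace X] {ι : (Fin k → ℝ) → X}
    (hι : Continuous ι) (hper : ∀ θ (m : Fin k → ℤ), ι (θ + fun j => (m j : ℝ)) = ι θ) :
    IsCompact (range ι) := by
  have : range ι = ι '' Icc 0 1 := by
    refine Subset.antisymm ?_ (image_subset_range _ _)
    rintro _ ⟨θ, rfl⟩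
    refine ⟨θ + fun j => ((-⌊θ j⌋ : ℤ) : ℝ), ⟨fun j => ?_, fun j => ?_⟩, hper θ _⟩
    · have := Int.floor_le (θ j)
      simp only [Pi.zero_apply, Pi.add_apply, Int.cast_neg]; linarith
    · have := Int.lt_floor_add_one (θ j)
      simp only [Pi.one_apply, Pi.add_apply, Int.cast_neg]; linarith
  rw [this]
  exact isCompact_Icc.image hι

variable {Φ : ℝ → Phase d → Phase d}

theorem IsCompact.accumulatesOn {γ : ℝ → Phase d} {K : Set (Phase d)} (hK : IsCompact K)
    (hγ : ∀ t, γ t ∈ K)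
    (h : (∃ i, AccumulatesOn γ {z | action i z = 0}) ∨ AccumulatesAtInfinity γ) :
    ∃ i, AccumulatesOn γ {z | action i z = 0} := by
  refine h.resolve_right ?_
  rintro ⟨t, -, ht⟩
  obtain ⟨R, hR⟩ := hK.isBounded.exists_norm_le
  obtain ⟨n, hn⟩ := (ht.eventually_gt_atTop R).exists
  exact absurd (hR _ (hγ (t n))) (not_le.2 hn)

/-- A torus with linear flow lies in the union of the sets `{r_i = 0}`. -/
theorem exists_action_eq_zero_of_isLinearFlowOn
    (hinv : ∀ i p, action i p = 0 → ∀ t j, action j (Φ t p) = action j p)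
    (hacc : ∀ p, (∀ i, action i p ≠ 0) → (∃ i, AccumulatesOn (fun t => Φ t p) {z | action i z = 0}) ∨
      AccumulatesAtInfinity (fun t => Φ t p))
    {ι : (Fin k → ℝ) → Phase d} {α : Fin k → ℝ} (hι : Continuous ι)
    (hper : ∀ θ (m : Fin k → ℤ), ι (θ + fun j => (m j : ℝ)) = ι θ) (hlin : IsLinearFlowOn Φ ι α)
    (θ : Fin k → ℝ) : ∃ i, action i (ι θ) = 0 := by
  by_contra! hne
  obtain ⟨i, p, hp, t, -, ht⟩ := (isCompact_range_of_periodic hι hper).accumulatesOn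
    (fun t => ⟨θ + t • α, (hlin t θ).symm⟩) (hacc _ hne)
  -- Integer translations bring the angles back to the unit cube, so that a subsequence converges.
  let m : ℕ → Fin k → ℤ := fun n j => -⌊(θ + t n • α) j⌋
  have hmem : ∀ n, θ + t n • α + (fun j => (m n j : ℝ)) ∈ Icc (0 : Fin k → ℝ) 1 := by
    intro n
    refine ⟨fun j => ?_, fun j => ?_⟩
    · have := Int.floor_le ((θ + t n • α) j)
      simp only [m, Pi.zero_apply, Pi.add_apply, Int.cast_neg] at this ⊢; linarith
    · have := Int.lt_floor_add_one ((θ + t n • α) j)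
      simp only [m, Pi.one_apply, Pi.add_apply, Int.cast_neg] at this ⊢; linarith
  obtain ⟨θ', -, φ, hφ, hlim⟩ := isCompact_Icc.tendsto_subseq hmem
  have hιθ' : ι θ' = p := by
    refine tendsto_nhds_unique ((hι.tendsto θ').comp hlim) ?_
    refine (ht.comp hφ.tendsto_atTop).congr fun n => ?_
    simp only [Function.comp_apply, hper]
    exact hlin _ _
  -- Translations are isometries: if θ + t_n α tends to θ' modulo integers, then θ' - t_n α tends to
  -- θ. Since r_i vanishes along the orbit of ι θ', it vanishes at ι θ.
  have hback : Tendsto (fun n => ι (θ' + (-t (φ n)) • α)) atTop (𝓝 (ι θ)) := by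
    have h1 : Tendsto (fun n => θ' + (θ - ((fun n => θ + t n • α + fun j => (m n j : ℝ)) ∘ φ) n))
        atTop (𝓝 (θ' + (θ - θ'))) := tendsto_const_nhds.add (tendsto_const_nhds.sub hlim)
    rw [add_sub_cancel] at h1
    refine ((hι.tendsto θ).comp h1).congr fun n => ?_
    rw [← hper (θ' + (-t (φ n)) • α) (fun j => - m (φ n) j)]
    simp only [Function.comp_apply]
    congr 1
    funext j
    simp
    ring
  apply hne i
  refine tendsto_nhds_unique ((continuous_action i |>.tendsto _).comp hback) ?_
  refine tendsto_const_nhds.congr fun n => ?_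
  simp only [Function.comp_apply]
  rw [← hlin, hιθ', hinv i p hp]
  exact hp.symm

/-- The torus lies in ⋃ {r_i = 0}, where the flow preserves all actions. Nonresonance would make
them constant on the torus, which `false_of_action_const` forbids. -/
theorem not_isotropic_and_not_nonresonant
    (hinv : ∀ i p, action i p = 0 → ∀ t j, action j (Φ t p) = action j p)
    (hacc : ∀ p, (∀ i, action i p ≠ 0) → (∃ i, AccumulatesOn (fun t => Φ t p) {z | action i z = 0}) ∨
      AccumulatesAtInfinity (fun t => Φ t p))
    {ι : (Fin d → ℝ) → Phase d} {α : Fin d → ℝ} (hι : IsTorusEmbedding 1 ι)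
    (hlin : IsLinearFlowOn Φ ι α) : ¬ IsIsotropic ι ∧ ¬ IsNonresonant α := by
  have hc : Continuous ι := hι.1.continuous
  have hper : ∀ θ (m : Fin d → ℤ), ι (θ + fun j => (m j : ℝ)) = ι θ := fun θ m =>
    ((hι.2.1 θ _).2 ⟨m, rfl⟩).symm
  have hb := exists_action_eq_zero_of_isLinearFlowOn hinv hacc hc hper hlin
  refine ⟨not_isIsotropic_of_action_eq_zero hι hb, fun hα => ?_⟩
  obtain ⟨i, hi⟩ := hb 0
  refine false_of_action_const hι hi fun j θ =>
    eq_of_nonresonant_periodic hα ((continuous_action j).comp hc) (fun θ m => by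
      simp only [Function.comp_apply, hper]) (fun t θ => ?_) θ 0
  obtain ⟨l, hl⟩ := hb θ
  simp only [Function.comp_apply]
  rw [← hlin, hinv l _ hl]

/-- An orbit in a compact invariant set cannot go to infinity, and its accumulation points remain in
the set. -/
theorem exists_action_eq_zero_of_compact
    (hacc : ∀ p, (∀ i, action i p ≠ 0) → (∃ i, AccumulatesOn (fun t => Φ t p) {z | action i z = 0}) ∨
      AccumulatesAtInfinity (fun t => Φ t p))
    {K : Set (Phase d)} (hK : IsCompact K) (hne : K.Nonempty) (hinv : ∀ t, Φ t '' K = K) :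
    ∃ p ∈ K, ∃ i, action i p = 0 := by
  obtain ⟨p, hp⟩ := hne
  by_contra! h
  have hmem : ∀ t, Φ t p ∈ K := fun t => hinv t ▸ mem_image_of_mem _ hp
  obtain ⟨i, z, hz, t, -, ht⟩ := hK.accumulatesOn hmem (hacc p (h p hp))
  exact h z (hK.isClosed.mem_of_tendsto ht (Eventually.of_forall fun n => hmem _)) i hz

end Obstructions

end

noncomputable section

/-! ### Properties inherited by the limit flow. -/

section Limit

open Set Filter

variable {d : ℕ} {q : Fin d} {ω₀ : Fin d → ℝ}

namespace Stage

theorem flow_boundary (S : Stage q ω₀) {z : Phase d} {i : Fin d} (h : action i z = 0) (t : ℝ) :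
    S.flow t z = rotate (t • freq q S.w z) z := by
  rw [flow, S.symm_boundary h, S.e_boundary _ i (by rw [action_freqFlow, h]), freqFlow]

theorem hamVectorField_boundary (S : Stage q ω₀) {z : Phase d} {i : Fin d} (h : action i z = 0) :
    hamVectorField S.ham z = rotGen (freq q S.w z) z := by
  have h1 := (S.isHamFlow z).2 0
  rw [(S.isHamFlow z).1] at h1
  simp only [S.flow_boundary h] at h1
  have h2 := h1.unique (hasDerivAt_rotate (freq q S.w z) z 0)
  rwa [zero_smul, rotate_zero] at h2

/-- On `{r_i = 0}` the limit flow is a rotation whose speed depends on the actions only. -/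
theorem exists_limit_rotation {S : ℕ → Stage q ω₀} {K : Phase d → ℝ} {Φ : ℝ → Phase d → Phase d}
    (hK : ∀ (N : ℕ) (z : Phase d), 1 ≤ N → ‖z‖ ≤ N →
      ‖fderiv ℝ (S N).ham z - fderiv ℝ K z‖ ≤ 2 * (1 / 2) ^ N)
    (hΦ : ∀ t z, Tendsto (fun n => (S n).flow t z) atTop (𝓝 (Φ t z))) {i : Fin d} {p : Phase d}
    (hp : action i p = 0) :
    ∃ Ω : Fin d → ℝ, ∀ t z, (∀ j, action j z = action j p) → Φ t z = rotate (t • Ω) z := by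
  classical
  have hX : Tendsto (fun n => hamVectorField (S n).ham p) atTop (𝓝 (hamVectorField K p)) := by
    rw [tendsto_iff_norm_sub_tendsto_zero]
    obtain ⟨N, hN⟩ := exists_nat_ge ‖p‖
    refine squeeze_zero' (Eventually.of_forall fun _ => norm_nonneg _)
      (g := fun n => 2 * (1 / 2 : ℝ) ^ n) ?_ ?_
    · filter_upwards [eventually_ge_atTop N, eventually_ge_atTop 1] with n hn h1
      exact (norm_hamVectorField_sub_le _ _ _).trans
        (hK n p h1 (hN.trans (by exact_mod_cast hn)))
    · simpa using (tendsto_pow_atTop_nhds_zero_of_lt_one (by norm_num)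
        (by norm_num : (1 / 2 : ℝ) < 1)).const_mul 2
  let X := hamVectorField K p
  -- The rotation speeds are recovered from the limit field at `p`, since y_j X_{x_j} - x_j X_{y_j}
  -- = 2 r_j Ω_j. Where r_j = 0 the speed is immaterial and set to 0, as the stage frequencies there
  -- need not converge.
  let Ω : Fin d → ℝ := fun j => if action j p = 0 then 0 else
    (p.2 j * X.1 j - p.1 j * X.2 j) / (2 * action j p)
  let Ωs : ℕ → Fin d → ℝ := fun n j => if action j p = 0 then 0 else freq q (S n).w p j
  have hlim : Tendsto Ωs atTop (𝓝 Ω) := by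
    refine tendsto_pi_nhds.2 fun j => ?_
    by_cases hj : action j p = 0
    · simp only [Ωs, Ω, if_pos hj]; exact tendsto_const_nhds
    · simp only [Ωs, Ω, if_neg hj]
      have h1 := ((coordX j).continuous.tendsto _).comp hX
      have h2 := ((coordY j).continuous.tendsto _).comp hX
      refine (((h1.const_mul (p.2 j)).sub (h2.const_mul (p.1 j))).div_const
        (2 * action j p)).congr fun n => ?_
      simp only [Function.comp_apply, coordX_apply, coordY_apply, (S n).hamVectorField_boundary hp,
        rotGen]
      rw [div_eq_iff (by simpa using hj), action]
      ring
  refine ⟨Ω, fun t z hz => tendsto_nhds_unique (hΦ t z) ?_⟩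
  have hcont : Continuous fun a : Fin d → ℝ => rotate (t • a) z :=
    continuous_rotate (continuous_const_smul t) continuous_const
  refine ((hcont.tendsto Ω).comp hlim).congr fun n => ?_
  have hfreq : freq q (S n).w z = freq q (S n).w p := by
    funext l; simp only [freq, hz]
  rw [(S n).flow_boundary ((hz i).trans hp), hfreq]
  refine rotate_congr fun j hj => ?_
  rw [hz] at hj
  simp [Ωs, hj]

theorem eventually_mem_inner {p : Phase d} (hp : ∀ i, action i p ≠ 0) :
    ∀ᶠ n : ℕ in atTop, p ∈ inner d n := by
  have h1 : ∀ᶠ n : ℕ in atTop, ‖p‖ ≤ n := tendsto_natCast_atTop_atTop.eventually_ge_atTop _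
  have h2 : ∀ᶠ n : ℕ in atTop, ∀ i, 1 / ((n : ℝ) + 1) ≤ action i p :=
    eventually_all.2 fun i => tendsto_one_div_add_atTop_nhds_zero_nat.eventually_le_const
      (lt_of_le_of_ne (action_nonneg i p) (hp i).symm)
  filter_upwards [h1, h2] with n h1 h2 using ⟨h1, h2⟩

end Stage

/-- An orbit that keeps leaving, up to small errors, the sets exhausting the complement of
`⋃ {r_i = 0}` accumulates on one of the sets `{r_i = 0}` or at infinity. -/
theorem accumulates_of_escape {γ : ℝ → Phase d}
    (h : ∀ N : ℕ, ∃ n ≥ N, ∃ (t : ℝ) (y : Phase d), n ≤ t ∧ y ∉ Stage.inner d n ∧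
      ‖y - γ t‖ ≤ (1 / 2) ^ n) :
    (∃ i, AccumulatesOn γ {z | action i z = 0}) ∨ AccumulatesAtInfinity γ := by
  choose n hn t y ht hy hyt using h
  have hnN : ∀ N : ℕ, (N : ℝ) ≤ n N := fun N => by exact_mod_cast hn N
  have htlim : Tendsto (fun N => |t N|) atTop atTop :=
    tendsto_atTop_mono (fun N => (hnN N).trans ((ht N).trans (le_abs_self _)))
      tendsto_natCast_atTop_atTop
  by_cases hinf : Tendsto (fun N => ‖γ (t N)‖) atTop atTop
  · exact Or.inr ⟨t, htlim, hinf⟩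
  left
  rw [tendsto_atTop] at hinf
  push Not at hinf
  obtain ⟨R, hR⟩ := hinf
  obtain ⟨a, -, φ, hφ, hlim⟩ := (isCompact_closedBall (0 : Phase d) R).tendsto_subseq'
    (x := fun N => γ (t N)) (hR.mono fun N hN => by simpa using hN.le)
  have hylim : Tendsto (fun N => y (φ N)) atTop (𝓝 a) := by
    have h0 : Tendsto (fun N => y N - γ (t N)) atTop (𝓝 0) := by
      rw [tendsto_zero_iff_norm_tendsto_zero]
      refine squeeze_zero (fun _ => norm_nonneg _)
        (fun N => (hyt N).trans (pow_le_pow_of_le_one (by norm_num) (by norm_num) (hn N))) ?_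
      exact tendsto_pow_atTop_nhds_zero_of_lt_one (by norm_num) (by norm_num)
    have := (h0.comp hφ.tendsto_atTop).add hlim
    simpa [Function.comp_def] using this
  have hexists : ∃ i, action i a = 0 := by
    -- If no action vanished at the limit point, the nearby points `y` would eventually lie in the
    -- exhausting compact sets that they avoid.
    by_contra! hne
    have h1 : ∀ᶠ N in atTop, ‖y (φ N)‖ ≤ ‖a‖ + 1 :=
      (hylim.norm.eventually_lt_const (lt_add_one _)).mono fun _ => le_of_lt
    have h2 : ∀ᶠ N in atTop, ‖a‖ + 1 ≤ (φ N : ℝ) :=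
      (tendsto_natCast_atTop_atTop.comp hφ.tendsto_atTop).eventually_ge_atTop _
    have h3 : ∀ᶠ N in atTop, ∀ i, 1 / ((φ N : ℝ) + 1) < action i (y (φ N)) :=
      eventually_all.2 fun i => (tendsto_one_div_add_atTop_nhds_zero_nat.comp
        hφ.tendsto_atTop).eventually_lt (((continuous_action i).tendsto a).comp hylim)
          (lt_of_le_of_ne (action_nonneg i a) (hne i).symm)
    obtain ⟨N, h1, h2, h3⟩ := (h1.and (h2.and h3)).exists
    refine hy (φ N) ⟨h1.trans (h2.trans (hnN _)), fun i => le_trans ?_ (h3 i).le⟩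
    exact one_div_le_one_div_of_le (by positivity) (by linarith [hnN (φ N)])
  obtain ⟨i, hi⟩ := hexists
  exact ⟨i, a, hi, fun N => t (φ N), htlim.comp hφ.tendsto_atTop, hlim⟩

/-- The distinguished index must differ from the two coordinates of opposite sign, so that an
integer vector supported on these has `k q = 0`. -/
theorem exists_ne_of_opposite_signs (hd : 4 ≤ d) (ω₀ : Fin d → ℝ) :
    ∃ q : Fin d, ∀ i j, ω₀ i < 0 → 0 < ω₀ j →
      ∃ i₀ j₀, i₀ ≠ q ∧ j₀ ≠ q ∧ ω₀ i₀ < 0 ∧ 0 < ω₀ j₀ := by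
  classical
  by_cases h : ∃ i j, ω₀ i < 0 ∧ 0 < ω₀ j
  · obtain ⟨i₀, j₀, hi, hj⟩ := h
    have hcard : ({i₀, j₀} : Finset (Fin d)).card < (Finset.univ : Finset (Fin d)).card := by
      have := Finset.card_le_two (a := i₀) (b := j₀)
      rw [Finset.card_univ, Fintype.card_fin]
      omega
    obtain ⟨q, -, hq⟩ := Finset.exists_mem_notMem_of_card_lt_card hcard
    simp only [Finset.mem_insert, Finset.mem_singleton, not_or] at hq
    exact ⟨q, fun _ _ _ _ => ⟨i₀, j₀, Ne.symm hq.1, Ne.symm hq.2, hi, hj⟩⟩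
  · exact ⟨⟨0, by omega⟩, fun i j hi hj => absurd ⟨i, j, hi, hj⟩ h⟩

end Limit

end

/-! ### Assembly of the theorem. -/

theorem theoremA (d : ℕ) (hd : 4 ≤ d) (ω₀ : Fin d → ℝ) :
    ∃ (H : Phase d → ℝ) (Φ : ℝ → Phase d → Phase d),
      -- `H` is smooth, of the form `⟨ω₀, r⟩ + O³`, with (complete) Hamiltonian flow `Φ`
      ContDiff ℝ ∞ H ∧
      (fun z => H z - quadPart ω₀ z) =O[𝓝 0] (fun z => ‖z‖ ^ 3) ∧
      IsHamFlow H Φ ∧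
      -- no invariant torus of dimension `d`: none with linear flow that is Lagrangian or
      -- whose frequency vector is nonresonant ...
      (∀ (ι : (Fin d → ℝ) → Phase d) (α : Fin d → ℝ),
        IsTorusEmbedding 1 ι → IsLinearFlowOn Φ ι α → ¬ IsIsotropic ι ∧ ¬ IsNonresonant α) ∧
      -- ... and none at all, whatever the dynamics on it, off the sets `{r_i = 0}`
      (∀ T : Set (Phase d), Nonempty (T ≃ₜ (Fin d → UnitAddCircle)) →
        (∀ t, Φ t '' T = T) → ∃ p ∈ T, ∃ i, action i p = 0) ∧
      -- each set `{r_i = 0}` is foliated by the sets `{r = c}` with `c_i = 0`, which are smooth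
      -- invariant tori of dimension at most `d - 1` with linear flow
      (∀ (i : Fin d) (p : Phase d), action i p = 0 →
        ∃ k ≤ d - 1, ∃ (ι : (Fin k → ℝ) → Phase d) (α : Fin k → ℝ),
          IsTorusEmbedding ⊤ ι ∧ IsLinearFlowOn Φ ι α ∧
          Set.range ι = {q | ∀ j, action j q = action j p}) ∧
      -- all other orbits accumulate on these sets or at infinity
      (∀ p : Phase d, (∀ i, action i p ≠ 0) →
        (∃ i, AccumulatesOn (fun t => Φ t p) {q | action i q = 0}) ∨
        AccumulatesAtInfinity (fun t => Φ t p)) ∧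
      -- diffusion when two coordinates of `ω₀` have opposite signs
      ((∃ i j, ω₀ i < 0 ∧ 0 < ω₀ j) → IsDiffusive Φ) := by
  obtain ⟨q, hq⟩ := exists_ne_of_opposite_signs hd ω₀
  obtain ⟨S, T, hS0, hT, hT', hclose, hesc, hdiff⟩ := Stage.exists_stages hd hq
  obtain ⟨H, hH, hO, hHf⟩ := exists_smooth_limit (H := fun n => (S n).ham)
    (S 0).contDiff_ham fun n => (hclose n).1
  obtain ⟨Φ, hΦ, hlim, hnear⟩ := exists_flow_limit (H := fun n => (S n).ham) hH hHf
    (fun n => (S n).isHamFlow) hT hT' fun n => (hclose n).2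
  have hrot : ∀ (i : Fin d) (p : Phase d), action i p = 0 → ∃ Ω : Fin d → ℝ, ∀ t z,
      (∀ j, action j z = action j p) → Φ t z = rotate (t • Ω) z := fun i p hp =>
    Stage.exists_limit_rotation hHf hlim hp
  have hinv : ∀ i p, action i p = 0 → ∀ t j, action j (Φ t p) = action j p := by
    intro i p hp t j
    obtain ⟨Ω, hΩ⟩ := hrot i p hp
    rw [hΩ t p fun _ => rfl, action_rotate]
  have hpow : ∀ n : ℕ, 2 * (1 / 2 : ℝ) ^ (n + 1) = (1 / 2) ^ n := fun n => by rw [pow_succ]; ring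
  have hacc : ∀ p : Phase d, (∀ i, action i p ≠ 0) →
      (∃ i, AccumulatesOn (fun t => Φ t p) {z | action i z = 0}) ∨
      AccumulatesAtInfinity (fun t => Φ t p) := by
    intro p hp
    refine accumulates_of_escape fun N => ?_
    obtain ⟨j, hj⟩ := exists_core (lt_of_le_of_ne (action_nonneg q p) (hp q).symm)
    obtain ⟨N', hN'⟩ := Filter.eventually_atTop.1 (Stage.eventually_mem_inner hp)
    -- The zone of `p` recurs at arbitrarily late m, and the odd step 2m + 1 treats it because (2m +
    -- 1) / 2 = m in integer division.
    obtain ⟨m, hm, hmj⟩ := Stage.exists_zoneIndex_eq j (max N N')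
    have hm1 := (le_max_left N N').trans hm
    have hm2 := (le_max_right N N').trans hm
    have hmem := hN' (2 * m + 1) (by omega)
    obtain ⟨t, ht1, ht2, ht3⟩ := hesc (2 * m + 1) ⟨m, rfl⟩ p hmem
      (by rwa [show (2 * m + 1) / 2 = m by omega, hmj])
    have ht0 : 0 ≤ t := (Nat.cast_nonneg _).trans ht1
    refine ⟨2 * m + 1, by omega, t, _, ht1, ht3, ?_⟩
    rw [← hpow]
    refine hnear _ t p (by rwa [abs_of_nonneg ht0]) (hmem.1.trans ?_)
    exact_mod_cast Nat.le_succ _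
  refine ⟨H, Φ, hH, ?_, hΦ, fun ι α hι hlin => not_isotropic_and_not_nonresonant hinv hacc hι hlin,
    ?_, fun i p hp => ?_, hacc, fun hmix A hA => ?_⟩
  · rw [hS0] at hO
    exact hO
  · rintro K ⟨f⟩ hK
    have hcomp : CompactSpace K := f.symm.compactSpace
    have hne : Nonempty K := ⟨f.symm 0⟩
    exact exists_action_eq_zero_of_compact hacc (isCompact_iff_compactSpace.2 hcomp)
      (Set.nonempty_coe_sort.1 hne) hK
  · obtain ⟨Ω, hΩ⟩ := hrot i p hp
    exact exists_linear_actionTorus hp hΩ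
  -- The extra 1 absorbs the distance between the stage flow and the limit flow; doubling m makes
  -- the index even.
  · obtain ⟨m, hm⟩ := exists_nat_ge (A + 1)
    obtain ⟨p, t, hp, ht, hpt⟩ := hdiff (m + m) ⟨m, rfl⟩ hmix
    push_cast at hp hpt
    have hp1 : 1 / ((m : ℝ) + m + 1) ≤ A⁻¹ := by
      rw [← one_div]
      exact one_div_le_one_div_of_le hA (by linarith)
    have hp2 : 1 / ((m : ℝ) + m + 1) ≤ 1 := by
      rw [div_le_one (by positivity)]
      linarith
    have h := hnear (m + m + 1) t p ht (by push_cast; linarith)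
    rw [hpow] at h
    have h1 : (1 / 2 : ℝ) ^ (m + m) ≤ 1 := pow_le_one₀ (by norm_num) (by norm_num)
    refine ⟨p, 0, t, by rw [(hΦ p).1]; exact hp.trans hp1, ?_⟩
    have h2 := norm_sub_norm_le ((S (m + m + 1)).flow t p) (Φ t p)
    linarith
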